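/- Two finite subgroups $\Gamma_1,\Gamma_2$ of a Lie group $G$ are called almost conjugate in $G$ if there is a bijection $\phi:\Gamma_1\to\Gamma_2$ such that every $\gamma\in\Gamma_1$ is conjugate to $\phi(\gamma)$ by an element $x=x(\gamma)\in G$; they are called conjugate in $G$ if $g\Gamma_1g^{-1}=\Gamma_2$ for a single $g\in G$. Let $\mathrm{Pin}(n)$ be the group of all products of unit vectors of $\mathbb{R}^n$ in the Clifford algebra of $\mathbb{R}^n$ with $v\cdot v=-|v|^2$, and let $\mathrm{Spin}(n)\subset\mathrm{Pin}(n)$ be its subgroup of even elements. The following statements hold. (a) Any two almost conjugate finite subgroups of $\mathrm{SU}(2)$ are conjugate in $\mathrm{SU}(2)$. (b) Any two almost conjugate finite subgroups of $\mathrm{Spin}(4)$ are conjugate in $\mathrm{Spin}(4)$; equivalently (since $\mathrm{Spin}(4)\cong\mathrm{SU}(2)\times\mathrm{SU}(2)$), any two almost conjugate finite subgroups of $\mathrm{SU}(2)\times\mathrm{SU}(2)$ are conjugate in $\mathrm{SU}(2)\times\mathrm{SU}(2)$. (c) For each $G\in\{\mathrm{O}(6),\mathrm{Spin}(6),\mathrm{Pin}(6)\}$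 there are finite subgroups of $G$ that are almost conjugate in $G$ but not conjugate in $G$. -/

import Mathlib

/-- Two subgroups of a group `G` are almost conjugate (in `G`) if they are finite and there is a
bijection between them that sends every element to a `G`-conjugate of itself; the conjugating
element may depend on the element. -/
def AlmostConjugate {G : Type*} [Group G] (Γ₁ Γ₂ : Subgroup G) : Prop :=
  Finite Γ₁ ∧ Finite Γ₂ ∧
    ∃ φ : Γ₁ ≃ Γ₂, ∀ γ : Γ₁, ∃ x : G, x * (γ : G) * x⁻¹ = (φ γ : G)

/-- Two subgroups of a group `G` are conjugate (in `G`) if `Γ₂ = g Γ₁ g⁻¹` for a single `g : G`. -/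
def ConjugateSubgroups {G : Type*} [Group G] (Γ₁ Γ₂ : Subgroup G) : Prop :=
  ∃ g : G, Γ₁.map (MulAut.conj g).toMonoidHom = Γ₂

/-- The negative definite form `v ↦ -(v₁² + ⋯ + vₙ²)` on `ℝⁿ`. In its Clifford algebra the standard
basis vectors satisfy `eᵢ² = -1` and `eᵢ eⱼ = - eⱼ eᵢ` for `i ≠ j`. -/
noncomputable def negEuclideanForm (n : ℕ) : QuadraticForm ℝ (Fin n → ℝ) :=
  QuadraticMap.weightedSumSquares ℝ (fun _ : Fin n => (-1 : ℝ))

/-- The compact group `SU(n)`. -/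
abbrev SUGroup (n : ℕ) : Type := Matrix.specialUnitaryGroup (Fin n) ℂ

/-- The compact group `O(n)`. -/
abbrev OGroup (n : ℕ) : Type := Matrix.orthogonalGroup (Fin n) ℝ

/-- The compact group `Pin(n)`, inside the Clifford algebra with `eᵢ² = -1`. Mathlib's `pinGroup`
asks for `star x * x = 1`, where `star v = -v` on vectors, so that it is for the negative definite
form (and not for the positive definite one) that it contains the unit vectors; it consists of all
products of unit vectors of `ℝⁿ`. -/
abbrev PinGroup (n : ℕ) : Type := pinGroup (negEuclideanForm n)

/-- The compact group `Spin(n)`: the even elements of `Pin(n)`. -/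
abbrev SpinGroup (n : ℕ) : Type := spinGroup (negEuclideanForm n)

/-! `SU(2)` is the group of unit quaternions and `Spin(4)` is the product of two copies of it. Two
unit quaternions are conjugate exactly when their real parts agree, so almost conjugacy of finite
groups is equality of the multisets of real parts (in the product: of pairs of real parts). Moreover
re x, re y and re (xy) determine the pair (x, y) up to simultaneous conjugation
(`exists_conj_pair`); this turns coincidences of traces into actual conjugations.

A finite group A of unit quaternions is of one of three kinds (`commOn_or_dih_or_exc`): commutative,
hence cyclic and inside a torus; dihedral, with a cyclic subgroup of index two outside which all
real parts vanish; or exceptional. Counting the poles of an exceptional group leads to 1/a + 1/b +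
1/c = 1 + 2/n and hence to the orders 24, 48 and 120 (`Exc.classify`). In an exceptional group two
noncommuting elements of equal trace and of maximal order modulo the center generate everything
(`Exc.closure_pair`), and the trace of their product is almost forced (`Exc.pair`).

A subgroup Γ of the product is analysed in the manner of Goursat: two projections, two kernels, and
an isomorphism between the quotients `pr1 Γ / k1 Γ` and `pr2 Γ / k2 Γ`. Almost conjugacy passes to
projections and kernels. In each case the second group is moved by a conjugation until the two
groups share enough elements to cover a projection; equality of orders and of kernels then finishes
(`eq_of_lifts`). The cases are: quotient of order at most two; cyclic and dihedral projections;
exceptional projections with central kernels, or with a kernel of order eight and quotient of order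
3 or 6. The exceptional case for a single copy follows by applying the product statement to
diagonals.

For the counterexamples, the diagonal sign matrices of two binary codes of length 6 with the same
weights are almost conjugate in `O(6)`. They are not conjugate, since the words of weight two
generate -1 in only one of them. In `Spin(6)` the volume element is central, and modulo it a product
of four generators is a product of two; this gives a commutative group almost conjugate to a
noncommutative one, and the example persists in `Pin(6)`. -/

open Quaternion

/-- The group of unit quaternions. -/
noncomputable abbrev UnitQuat : Type := unitary ℍ[ℝ]

/-! ### Unit quaternions: real part, conjugacy classes, the standard torus. -/

namespace UnitQuat

/-- The real part of a unit quaternion. -/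
noncomputable def re (x : UnitQuat) : ℝ := (x : ℍ[ℝ]).re

theorem coe_inv' (x : UnitQuat) : ((x⁻¹ : UnitQuat) : ℍ[ℝ]) = star (x : ℍ[ℝ]) := rfl

theorem sq_sum (x : UnitQuat) :
    (x : ℍ[ℝ]).re ^ 2 + (x : ℍ[ℝ]).imI ^ 2 + (x : ℍ[ℝ]).imJ ^ 2 + (x : ℍ[ℝ]).imK ^ 2 = 1 := by
  have h := (Unitary.mem_iff.1 x.2).1
  have h2 : (star (x : ℍ[ℝ]) * (x : ℍ[ℝ])).re = (1 : ℍ[ℝ]).re := by rw [h]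
  simp only [Quaternion.re_mul, Quaternion.re_star, Quaternion.imI_star, Quaternion.imJ_star,
    Quaternion.imK_star, Quaternion.re_one] at h2
  linarith

theorem ext' {x y : UnitQuat} (h1 : (x : ℍ[ℝ]).re = (y : ℍ[ℝ]).re)
    (h2 : (x : ℍ[ℝ]).imI = (y : ℍ[ℝ]).imI) (h3 : (x : ℍ[ℝ]).imJ = (y : ℍ[ℝ]).imJ)
    (h4 : (x : ℍ[ℝ]).imK = (y : ℍ[ℝ]).imK) : x = y :=
  Subtype.ext (QuaternionAlgebra.ext h1 h2 h3 h4)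

/-- The quaternion with given coordinates. -/
def quat (a b c d : ℝ) : ℍ[ℝ] := ⟨a, b, c, d⟩

@[simp] theorem quat_re (a b c d : ℝ) : (quat a b c d).re = a := rfl
@[simp] theorem quat_imI (a b c d : ℝ) : (quat a b c d).imI = b := rfl
@[simp] theorem quat_imJ (a b c d : ℝ) : (quat a b c d).imJ = c := rfl
@[simp] theorem quat_imK (a b c d : ℝ) : (quat a b c d).imK = d := rfl

/-- The unit quaternion with given coordinates. -/
noncomputable def mk4 (a b c d : ℝ) (h : a ^ 2 + b ^ 2 + c ^ 2 + d ^ 2 = 1) : UnitQuat :=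
  ⟨quat a b c d, by
    rw [Unitary.mem_iff]
    constructor <;> apply Quaternion.ext <;> simp <;> linarith⟩

@[simp] theorem coe_mk4 (a b c d : ℝ) (h : a ^ 2 + b ^ 2 + c ^ 2 + d ^ 2 = 1) :
    (mk4 a b c d h : ℍ[ℝ]) = quat a b c d := rfl

@[simp] theorem re_one : re 1 = 1 := by simp [re]
@[simp] theorem re_neg (x : UnitQuat) : re (-x) = - re x := by
  simp only [re, Unitary.coe_neg, Quaternion.re_neg]
@[simp] theorem re_inv (x : UnitQuat) : re x⁻¹ = re x := by simp [re, coe_inv']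

theorem re_mul_comm (x y : UnitQuat) : re (x * y) = re (y * x) := by
  simp [re]; ring

@[simp] theorem re_conj (g x : UnitQuat) : re (g * x * g⁻¹) = re x := by
  rw [re_mul_comm]; simp

theorem re_mul_add_re_mul_inv (x y : UnitQuat) :
    re (x * y) + re (x * y⁻¹) = 2 * re x * re y := by
  simp [re, coe_inv']; ring

theorem re_le_one (x : UnitQuat) : re x ^ 2 ≤ 1 := by
  have := sq_sum x
  simp only [re]; nlinarith [sq_nonneg (x : ℍ[ℝ]).imI, sq_nonneg (x : ℍ[ℝ]).imJ,
    sq_nonneg (x : ℍ[ℝ]).imK]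

theorem eq_one_or_of_re_sq {x : UnitQuat} (h : re x ^ 2 = 1) : x = 1 ∨ x = -1 := by
  have := sq_sum x
  simp only [re] at h
  have h2 : (x : ℍ[ℝ]).imI = 0 := by
    nlinarith [sq_nonneg (x : ℍ[ℝ]).imI, sq_nonneg (x : ℍ[ℝ]).imJ, sq_nonneg (x : ℍ[ℝ]).imK]
  have h3 : (x : ℍ[ℝ]).imJ = 0 := by
    nlinarith [sq_nonneg (x : ℍ[ℝ]).imI, sq_nonneg (x : ℍ[ℝ]).imJ, sq_nonneg (x : ℍ[ℝ]).imK]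
  have h4 : (x : ℍ[ℝ]).imK = 0 := by
    nlinarith [sq_nonneg (x : ℍ[ℝ]).imI, sq_nonneg (x : ℍ[ℝ]).imJ, sq_nonneg (x : ℍ[ℝ]).imK]
  rcases (by simpa using h : (x : ℍ[ℝ]).re = 1 ∨ (x : ℍ[ℝ]).re = -1) with h | h
  · left; apply ext' <;> simp [*]
  · right; apply ext' <;> rw [Unitary.coe_neg] <;> simp [*]

theorem eq_one_of_re {x : UnitQuat} (h : re x = 1) : x = 1 := by
  rcases eq_one_or_of_re_sq (x := x) (by rw [h]; norm_num) with h1 | h1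
  · exact h1
  · rw [h1] at h; norm_num at h

theorem eq_neg_one_of_re {x : UnitQuat} (h : re x = -1) : x = -1 := by
  have : re (-x) = 1 := by rw [re_neg, h]; norm_num
  have := eq_one_of_re this
  rw [← this, neg_neg]

theorem neg_one_ne_one : (-1 : UnitQuat) ≠ 1 := by
  intro h
  have := congrArg re h
  norm_num at this

theorem sq_coords (x : UnitQuat) : re (x ^ 2) = 2 * re x ^ 2 - 1 := by
  have := sq_sum x
  rw [pow_two]
  simp [re]; linarith

theorem sq_eq_neg_one_iff {x : UnitQuat} : x ^ 2 = -1 ↔ re x = 0 := by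
  constructor
  · intro h
    have := sq_coords x
    rw [h] at this
    simp at this
    nlinarith
  · intro h
    apply eq_neg_one_of_re
    rw [sq_coords, h]; norm_num

theorem sq_eq_one_iff {x : UnitQuat} : x ^ 2 = 1 ↔ x = 1 ∨ x = -1 := by
  constructor
  · intro h
    have := sq_coords x
    rw [h] at this
    simp at this
    exact eq_one_or_of_re_sq (by linarith)
  · rintro (rfl | rfl) <;> simp

/-- If `q` is a nonzero quaternion with `q x = y q`, then its normalization conjugates `x` to `y`. -/
theorem exists_conj_of_mul (q : ℍ[ℝ]) (hq : q ≠ 0) :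
    ∃ g : UnitQuat, ∃ r : ℝ, (g : ℍ[ℝ]) = r • q ∧
      ∀ x y : UnitQuat, q * x = y * q → g * x * g⁻¹ = y := by
  have hn : 0 < q.re ^ 2 + q.imI ^ 2 + q.imJ ^ 2 + q.imK ^ 2 := by
    rw [← Quaternion.normSq_def']
    exact lt_of_le_of_ne Quaternion.normSq_nonneg (Ne.symm (by simpa using hq))
  set s := Real.sqrt (q.re ^ 2 + q.imI ^ 2 + q.imJ ^ 2 + q.imK ^ 2) with hs
  have hs0 : 0 < s := Real.sqrt_pos.2 hn
  have hs2 : s ^ 2 = q.re ^ 2 + q.imI ^ 2 + q.imJ ^ 2 + q.imK ^ 2 := Real.sq_sqrt hn.le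
  refine ⟨mk4 (q.re / s) (q.imI / s) (q.imJ / s) (q.imK / s) ?_, 1 / s, ?_, ?_⟩
  · field_simp; linarith
  · apply Quaternion.ext <;> simp <;> ring
  · intro x y h
    rw [mul_inv_eq_iff_eq_mul]
    apply Subtype.ext
    have e : ((mk4 (q.re / s) (q.imI / s) (q.imJ / s) (q.imK / s)
      (by field_simp; linarith) : UnitQuat) : ℍ[ℝ]) = (1 / s) • q := by
      apply Quaternion.ext <;> simp <;> ring
    simp only [Submonoid.coe_mul, e, smul_mul_assoc, mul_smul_comm, h]

/-- The standard maximal torus `{a + b i}`. -/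
noncomputable def torus : Subgroup UnitQuat where
  carrier := {x | (x : ℍ[ℝ]).imJ = 0 ∧ (x : ℍ[ℝ]).imK = 0}
  mul_mem' := by
    rintro x y ⟨h1, h2⟩ ⟨h3, h4⟩
    simp [h1, h2, h3, h4]
  one_mem' := by simp
  inv_mem' := by
    rintro x ⟨h1, h2⟩
    simp [coe_inv', h1, h2]

/-- The nontrivial coset of the torus in its normalizer. -/
def torusJ : Set UnitQuat := {x | (x : ℍ[ℝ]).re = 0 ∧ (x : ℍ[ℝ]).imI = 0}

theorem mem_torus {x : UnitQuat} : x ∈ torus ↔ (x : ℍ[ℝ]).imJ = 0 ∧ (x : ℍ[ℝ]).imK = 0 := Iff.rfl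
theorem mem_torusJ {x : UnitQuat} : x ∈ torusJ ↔ (x : ℍ[ℝ]).re = 0 ∧ (x : ℍ[ℝ]).imI = 0 := Iff.rfl

theorem exists_conj_std (x : UnitQuat) :
    ∃ g : UnitQuat, g * x * g⁻¹ ∈ torus ∧ 0 ≤ ((g * x * g⁻¹ : UnitQuat) : ℍ[ℝ]).imI := by
  set s := Real.sqrt (1 - (x : ℍ[ℝ]).re ^ 2) with hs
  have h1 := sq_sum x
  have hs2 : s ^ 2 = 1 - (x : ℍ[ℝ]).re ^ 2 := by
    apply Real.sq_sqrt
    nlinarith [sq_nonneg (x : ℍ[ℝ]).imI, sq_nonneg (x : ℍ[ℝ]).imJ, sq_nonneg (x : ℍ[ℝ]).imK]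
  have hs0 : 0 ≤ s := Real.sqrt_nonneg _
  have key : ∃ q : ℍ[ℝ], q ≠ 0 ∧
      q * x = (mk4 (x : ℍ[ℝ]).re s 0 0 (by rw [hs2]; ring) : UnitQuat) * q := by
    -- Let v be the imaginary part of x. Since v² = (s i)² = -s², the sum q = v + s i satisfies q v
    -- = (s i) q. It vanishes only for v = -s i, and then j does the job.
    by_cases hc : quat 0 ((x : ℍ[ℝ]).imI + s) (x : ℍ[ℝ]).imJ (x : ℍ[ℝ]).imK = 0
    · have c1 := congrArg (fun q : ℍ[ℝ] => q.imI) hc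
      have c2 := congrArg (fun q : ℍ[ℝ] => q.imJ) hc
      have c3 := congrArg (fun q : ℍ[ℝ] => q.imK) hc
      simp at c1 c2 c3
      have c4 : (x : ℍ[ℝ]).imI = -s := by linarith
      refine ⟨quat 0 0 1 0, ?_, ?_⟩
      · intro h; have := congrArg (fun q : ℍ[ℝ] => q.imJ) h; simp at this
      · apply Quaternion.ext <;> simp [c2, c3, c4]
    · refine ⟨_, hc, ?_⟩
      apply Quaternion.ext <;> simp <;> nlinarith
  obtain ⟨q, hq, h⟩ := key
  obtain ⟨g, r, -, hg⟩ := exists_conj_of_mul q hq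
  refine ⟨g, ?_⟩
  rw [hg _ _ h]
  exact ⟨by simp [mem_torus, mk4], by simpa [mk4] using hs0⟩

theorem exists_torus_conj_std (x : UnitQuat) :
    ∃ t ∈ torus, ((t * x * t⁻¹ : UnitQuat) : ℍ[ℝ]).imK = 0 ∧
      0 ≤ ((t * x * t⁻¹ : UnitQuat) : ℍ[ℝ]).imJ ∧
      ((t * x * t⁻¹ : UnitQuat) : ℍ[ℝ]).imI = (x : ℍ[ℝ]).imI := by
  set s := Real.sqrt ((x : ℍ[ℝ]).imJ ^ 2 + (x : ℍ[ℝ]).imK ^ 2) with hs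
  have h1 := sq_sum x
  have hs2 : s ^ 2 = (x : ℍ[ℝ]).imJ ^ 2 + (x : ℍ[ℝ]).imK ^ 2 := Real.sq_sqrt (by positivity)
  have hs0 : 0 ≤ s := Real.sqrt_nonneg _
  have key : ∃ q : ℍ[ℝ], q ≠ 0 ∧ q.imJ = 0 ∧ q.imK = 0 ∧
      q * x = (mk4 (x : ℍ[ℝ]).re (x : ℍ[ℝ]).imI s 0 (by rw [hs2]; linarith) : UnitQuat) * q := by
    -- Write the j, k part of x as z j with z = J + K i. Conjugation by a torus element t replaces z
    -- by t² z, so t must be proportional to a square root of the conjugate of z, namely to (J + s)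
    -- - K i. This degenerates when z = -s, where t = i.
    by_cases hc : quat ((x : ℍ[ℝ]).imJ + s) (-(x : ℍ[ℝ]).imK) 0 0 = 0
    · have c1 := congrArg (fun q : ℍ[ℝ] => q.re) hc
      have c2 := congrArg (fun q : ℍ[ℝ] => q.imI) hc
      simp at c1 c2
      have c4 : (x : ℍ[ℝ]).imJ = -s := by linarith
      refine ⟨quat 0 1 0 0, ?_, rfl, rfl, ?_⟩
      · intro h; have := congrArg (fun q : ℍ[ℝ] => q.imI) h; simp at this
      · apply Quaternion.ext <;> simp [c2, c4]
    · refine ⟨_, hc, rfl, rfl, ?_⟩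
      apply Quaternion.ext <;> simp <;> nlinarith
  obtain ⟨q, hq, hJ, hK, h⟩ := key
  obtain ⟨g, r, hr, hg⟩ := exists_conj_of_mul q hq
  refine ⟨g, ?_, ?_⟩
  · simp [mem_torus, hr, hJ, hK]
  rw [hg _ _ h]
  exact ⟨by simp [mk4], by simpa [mk4] using hs0, by simp [mk4]⟩

/-- Unit quaternions with the same real part are conjugate. -/
theorem exists_conj {x y : UnitQuat} (h : re x = re y) : ∃ g : UnitQuat, g * x * g⁻¹ = y := by
  obtain ⟨g, hg, hg'⟩ := exists_conj_std x
  obtain ⟨k, hk, hk'⟩ := exists_conj_std y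
  have e : g * x * g⁻¹ = k * y * k⁻¹ := by
    have h1 := sq_sum (g * x * g⁻¹)
    have h2 := sq_sum (k * y * k⁻¹)
    have r1 := re_conj g x
    have r2 := re_conj k y
    rw [re] at r1 r2
    apply ext'
    · rw [r1, r2, h]
    · rw [hg.1, hg.2, r1] at h1
      rw [hk.1, hk.2, r2, ← h] at h2
      exact (sq_eq_sq₀ hg' hk').1 (by linarith)
    · rw [hg.1, hk.1]
    · rw [hg.2, hk.2]
  refine ⟨k⁻¹ * g, ?_⟩
  have : k⁻¹ * g * x * (k⁻¹ * g)⁻¹ = k⁻¹ * (g * x * g⁻¹) * k := by group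
  rw [this, e]; group

theorem torus_comm {x y : UnitQuat} (hx : x ∈ torus) (hy : y ∈ torus) : x * y = y * x := by
  apply ext' <;> simp [hx.1, hx.2, hy.1, hy.2] <;> ring

/-- Two pairs of unit quaternions with the same invariants are simultaneously conjugate. -/
theorem exists_conj_pair {x y x' y' : UnitQuat} (h1 : re x = re x') (h2 : re y = re y')
    (h3 : re (x * y) = re (x' * y')) :
    ∃ g : UnitQuat, g * x * g⁻¹ = x' ∧ g * y * g⁻¹ = y' := by
  obtain ⟨k, rfl⟩ := exists_conj h1
  obtain ⟨m, hm, hm'⟩ := exists_conj_std x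
  -- A central x is fixed by every conjugation, so only y has to be moved.
  by_cases hx : re x ^ 2 = 1
  · obtain ⟨g, rfl⟩ := exists_conj h2
    rcases eq_one_or_of_re_sq hx with rfl | rfl
    · exact ⟨g, by simp, rfl⟩
    · exact ⟨g, by simp, rfl⟩
  set X := m * x * m⁻¹ with hX
  have hxX : x = m⁻¹ * X * m := by rw [hX]; group
  set Y := m * y * m⁻¹ with hY
  set Y' := m * (k⁻¹ * y' * k) * m⁻¹ with hY'
  obtain ⟨t, ht, t1, t2, t3⟩ := exists_torus_conj_std Y
  obtain ⟨u, hu, u1, u2, u3⟩ := exists_torus_conj_std Y'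
  have hXY : re (X * Y) = re (x * y) := by
    rw [hX, hY, ← re_conj m (x * y)]; congr 1; group
  have hXY' : re (X * Y') = re (x * y) := by
    rw [hX, hY', h3, ← re_conj (m * k⁻¹) (k * x * k⁻¹ * y')]; congr 1; group
  have hYY : re Y = re Y' := by
    rw [hY, hY', re_conj, re_conj, h2, ← re_conj k⁻¹ y']; congr 1; group
  have hX1 : (X : ℍ[ℝ]).imI ≠ 0 := by
    intro h0
    have := sq_sum X
    rw [h0, hm.1, hm.2] at this
    have r : re X = re x := by rw [hX, re_conj]
    rw [re] at r
    rw [r] at this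
    apply hx; linarith
  -- For X in the torus, re (X Y) = re X re Y - imI X imI Y, and imI X ≠ 0; so the third invariant
  -- fixes the i-coordinate of Y. The remaining j, k part is rotated into standard position by the
  -- torus, which centralizes X.
  have hI : (Y : ℍ[ℝ]).imI = (Y' : ℍ[ℝ]).imI := by
    have e := hXY.trans hXY'.symm
    have e2 := hYY
    simp only [re] at e e2
    simp only [Submonoid.coe_mul, Quaternion.re_mul, hm.1, hm.2, e2] at e
    apply mul_left_cancel₀ hX1
    linarith
  have e : t * Y * t⁻¹ = u * Y' * u⁻¹ := by
    have q1 := sq_sum (t * Y * t⁻¹)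
    have q2 := sq_sum (u * Y' * u⁻¹)
    have r1 := re_conj t Y
    have r2 := re_conj u Y'
    rw [re] at r1 r2
    apply ext'
    · rw [r1, r2, hYY]
    · rw [t3, u3, hI]
    · rw [t1, t3, r1] at q1
      rw [u1, u3, r2, ← hYY, ← hI] at q2
      exact (sq_eq_sq₀ t2 u2).1 (by linarith)
    · rw [t1, u1]
  have cX : (u⁻¹ * t) * X * (u⁻¹ * t)⁻¹ = X := by
    have hmem : u⁻¹ * t ∈ torus := torus.mul_mem (torus.inv_mem hu) ht
    rw [torus_comm hmem hm]; group
  refine ⟨k * m⁻¹ * (u⁻¹ * t) * m, ?_, ?_⟩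
  · have : k * m⁻¹ * (u⁻¹ * t) * m * x * (k * m⁻¹ * (u⁻¹ * t) * m)⁻¹
        = k * m⁻¹ * ((u⁻¹ * t) * X * (u⁻¹ * t)⁻¹) * m * k⁻¹ := by rw [hX]; group
    rw [this, cX, hX]; group
  · have : k * m⁻¹ * (u⁻¹ * t) * m * y * (k * m⁻¹ * (u⁻¹ * t) * m)⁻¹
        = k * m⁻¹ * u⁻¹ * (t * Y * t⁻¹) * u * m * k⁻¹ := by rw [hY]; group
    rw [this, e, hY']; group

end UnitQuat

/-! ### Conjugate subgroups and commutative subgroups of an arbitrary group. -/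

/-- All elements of the subgroup commute with each other. -/
def CommOn {G : Type*} [Group G] (A : Subgroup G) : Prop := ∀ x ∈ A, ∀ y ∈ A, x * y = y * x

/-- The conjugate subgroup `g A g⁻¹`. -/
abbrev Subgroup.cj {G : Type*} [Group G] (g : G) (A : Subgroup G) : Subgroup G :=
  A.map (MulAut.conj g).toMonoidHom

section General
variable {G : Type*} [Group G]

theorem Subgroup.mem_cj {g : G} {A : Subgroup G} {x : G} : x ∈ A.cj g ↔ g⁻¹ * x * g ∈ A := by
  rw [Subgroup.mem_map]
  constructor
  · rintro ⟨a, ha, rfl⟩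
    simpa [mul_assoc] using ha
  · intro h
    exact ⟨_, h, by simp [mul_assoc]⟩

theorem Subgroup.conj_mem_cj {g : G} {A : Subgroup G} {x : G} (hx : x ∈ A) :
    g * x * g⁻¹ ∈ A.cj g := by
  simpa [mul_assoc] using hx

theorem Subgroup.cj_cj (g h : G) (A : Subgroup G) : (A.cj h).cj g = A.cj (g * h) := by
  ext x
  simp only [Subgroup.mem_cj]
  rw [show (g * h)⁻¹ * x * (g * h) = h⁻¹ * (g⁻¹ * x * g) * h by group]

theorem Subgroup.cj_one (A : Subgroup G) : A.cj 1 = A := by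
  ext x; simp

theorem Subgroup.cj_inv_cj (g : G) (A : Subgroup G) : (A.cj g).cj g⁻¹ = A := by
  rw [Subgroup.cj_cj, inv_mul_cancel, Subgroup.cj_one]

theorem Subgroup.card_cj (g : G) (A : Subgroup G) : Nat.card (A.cj g) = Nat.card A :=
  (Nat.card_congr (A.equivMapOfInjective _ (MulAut.conj g).injective).toEquiv).symm

instance Subgroup.finite_cj (g : G) (A : Subgroup G) [Finite A] : Finite (A.cj g) :=
  Finite.of_equiv _ (A.equivMapOfInjective _ (MulAut.conj g).injective).toEquiv

theorem Subgroup.cj_mono {g : G} {A B : Subgroup G} (h : A ≤ B) : A.cj g ≤ B.cj g :=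
  Subgroup.map_mono h

theorem Subgroup.cj_zpowers (g z : G) :
    (Subgroup.zpowers z).cj g = Subgroup.zpowers (g * z * g⁻¹) := by
  rw [Subgroup.cj, MonoidHom.map_zpowers]; rfl

theorem CommOn.cj {A : Subgroup G} (h : CommOn A) (g : G) : CommOn (A.cj g) := by
  intro x hx y hy
  have := h _ (Subgroup.mem_cj.1 hx) _ (Subgroup.mem_cj.1 hy)
  have e : g⁻¹ * (x * y) * g = g⁻¹ * (y * x) * g := by
    calc g⁻¹ * (x * y) * g = g⁻¹ * x * g * (g⁻¹ * y * g) := by group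
      _ = g⁻¹ * (y * x) * g := by rw [this]; group
  exact mul_left_cancel (mul_right_cancel e)

theorem commOn_cj_iff {A : Subgroup G} (g : G) : CommOn (A.cj g) ↔ CommOn A :=
  ⟨fun h => by simpa only [Subgroup.cj_inv_cj] using h.cj g⁻¹, fun h => h.cj g⟩

theorem CommOn.mono {A B : Subgroup G} (h : CommOn B) (hAB : A ≤ B) : CommOn A :=
  fun x hx y hy => h x (hAB hx) y (hAB hy)

theorem ConjugateSubgroups.of_cj {A B : Subgroup G} {g h : G}
    (H : ConjugateSubgroups (A.cj g) (B.cj h)) : ConjugateSubgroups A B := by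
  obtain ⟨k, hk⟩ := H
  refine ⟨h⁻¹ * k * g, ?_⟩
  change A.cj _ = B
  change (A.cj g).cj k = _ at hk
  rw [← Subgroup.cj_cj, ← Subgroup.cj_cj, hk, Subgroup.cj_inv_cj]

theorem ConjugateSubgroups.symm {A B : Subgroup G}
    (H : ConjugateSubgroups A B) : ConjugateSubgroups B A := by
  obtain ⟨g, hg⟩ := H
  exact ⟨g⁻¹, by change A.cj g = B at hg; change B.cj _ = A; rw [← hg, Subgroup.cj_inv_cj]⟩

theorem ConjugateSubgroups.refl (A : Subgroup G) : ConjugateSubgroups A A := ⟨1, A.cj_one⟩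

theorem commOn_zpowers (z : G) : CommOn (Subgroup.zpowers z) := by
  rintro x ⟨m, rfl⟩ y ⟨n, rfl⟩
  simp only [← zpow_add, add_comm]

end General

/-! ### The center, the normalizer of the torus, and finite commutative groups. -/

namespace UnitQuat

/-- The central subgroup `{1, -1}`. -/
noncomputable def pm : Subgroup UnitQuat where
  carrier := {x | x = 1 ∨ x = -1}
  mul_mem' := by rintro x y (rfl | rfl) (rfl | rfl) <;> simp
  one_mem' := Or.inl rfl
  inv_mem' := by rintro x (rfl | rfl) <;> simp

theorem mem_pm {x : UnitQuat} : x ∈ pm ↔ x = 1 ∨ x = -1 := Iff.rfl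

theorem neg_one_mem_pm : (-1 : UnitQuat) ∈ pm := Or.inr rfl

theorem mem_pm_iff_re {x : UnitQuat} : x ∈ pm ↔ re x ^ 2 = 1 :=
  ⟨by rintro (rfl | rfl) <;> simp, eq_one_or_of_re_sq⟩

theorem pm_comm {x : UnitQuat} (hx : x ∈ pm) (y : UnitQuat) : x * y = y * x := by
  rcases hx with rfl | rfl <;> simp

theorem conj_mem_pm {x g : UnitQuat} : g * x * g⁻¹ ∈ pm ↔ x ∈ pm := by
  simp [mem_pm_iff_re]

theorem conj_of_mem_pm {x g : UnitQuat} (hx : x ∈ pm) : g * x * g⁻¹ = x := by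
  rw [← pm_comm hx]; simp

theorem cj_eq_of_le_pm {A : Subgroup UnitQuat} (h : A ≤ pm) (g : UnitQuat) : A.cj g = A := by
  ext x
  rw [Subgroup.mem_cj]
  constructor
  · intro hx
    have : x = g⁻¹ * x * g := by
      have := conj_of_mem_pm (g := g) (h hx)
      rw [← this]; group
    rwa [this]
  · intro hx
    have := conj_of_mem_pm (g := g⁻¹) (h hx)
    rw [inv_inv] at this
    rwa [this]

theorem mem_torus_of_comm {x y : UnitQuat} (hx : x ∈ torus) (hx' : x ∉ pm)
    (h : x * y = y * x) : y ∈ torus := by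
  have hI : (x : ℍ[ℝ]).imI ≠ 0 := by
    intro h0
    have := sq_sum x
    rw [h0, hx.1, hx.2] at this
    exact hx' (mem_pm_iff_re.2 (by rw [re]; linarith))
  have h2 : (x : ℍ[ℝ]) * y = y * x := congrArg Subtype.val h
  have hJ := congrArg (fun q : ℍ[ℝ] => q.imJ) h2
  have hK := congrArg (fun q : ℍ[ℝ] => q.imK) h2
  simp [hx.1, hx.2] at hJ hK
  constructor
  · apply mul_left_cancel₀ hI; linarith
  · apply mul_left_cancel₀ hI; linarith

theorem mem_torusJ_of_conj {x y : UnitQuat} (hx : x ∈ torus) (hx' : x ∉ pm)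
    (h : y * x * y⁻¹ = x⁻¹) : y ∈ torusJ := by
  have hI : (x : ℍ[ℝ]).imI ≠ 0 := by
    intro h0
    have := sq_sum x
    rw [h0, hx.1, hx.2] at this
    exact hx' (mem_pm_iff_re.2 (by rw [re]; linarith))
  rw [mul_inv_eq_iff_eq_mul] at h
  have h2 : (y : ℍ[ℝ]) * x = star (x : ℍ[ℝ]) * y := congrArg Subtype.val h
  have h0 := congrArg (fun q : ℍ[ℝ] => q.re) h2
  have h1 := congrArg (fun q : ℍ[ℝ] => q.imI) h2
  simp [hx.1, hx.2] at h0 h1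
  constructor
  · apply mul_left_cancel₀ hI; linarith
  · apply mul_left_cancel₀ hI; linarith

theorem torusJ_conj_torus {w t : UnitQuat} (hw : w ∈ torusJ) (ht : t ∈ torus) :
    w * t * w⁻¹ = t⁻¹ := by
  rw [mul_inv_eq_iff_eq_mul]
  apply ext' <;> simp [coe_inv', hw.1, hw.2, ht.1, ht.2] <;> ring

theorem torus_mul_torusJ {w t : UnitQuat} (ht : t ∈ torus) (hw : w ∈ torusJ) :
    t * w ∈ torusJ := by
  simp [mem_torusJ, hw.1, hw.2, ht.1, ht.2]

theorem torusJ_mul_torus {w t : UnitQuat} (hw : w ∈ torusJ) (ht : t ∈ torus) :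
    w * t ∈ torusJ := by
  simp [mem_torusJ, hw.1, hw.2, ht.1, ht.2]

theorem torusJ_mul_torusJ {w t : UnitQuat} (hw : w ∈ torusJ) (ht : t ∈ torusJ) :
    w * t ∈ torus := by
  simp [mem_torus, hw.1, hw.2, ht.1, ht.2]

theorem torusJ_inv {w : UnitQuat} (hw : w ∈ torusJ) : w⁻¹ ∈ torusJ := by
  simp [mem_torusJ, coe_inv', hw.1, hw.2]

theorem re_torusJ {w : UnitQuat} (hw : w ∈ torusJ) : re w = 0 := hw.1

theorem torus_eq_or_inv {x y : UnitQuat} (hx : x ∈ torus) (hy : y ∈ torus) (h : re x = re y) :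
    x = y ∨ x = y⁻¹ := by
  have h1 := sq_sum x
  have h2 := sq_sum y
  simp only [re] at h
  rw [hx.1, hx.2] at h1
  rw [hy.1, hy.2, ← h] at h2
  rcases sq_eq_sq_iff_eq_or_eq_neg.1 (show (x : ℍ[ℝ]).imI ^ 2 = (y : ℍ[ℝ]).imI ^ 2 by linarith)
    with h3 | h3
  · left; apply ext' <;> simp [hx.1, hx.2, hy.1, hy.2, h, h3]
  · right; apply ext' <;> simp [coe_inv', hx.1, hx.2, hy.1, hy.2, h, h3]

/-- Since w inverts the torus, t w t⁻¹ = t² w, and every torus element is a square; so the torus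
acts transitively on its nontrivial coset. Both elements are brought to j. -/
theorem exists_torus_conj_torusJ {w w' : UnitQuat} (hw : w ∈ torusJ) (hw' : w' ∈ torusJ) :
    ∃ t ∈ torus, t * w * t⁻¹ = w' := by
  have key : ∀ {w : UnitQuat}, w ∈ torusJ →
      ∃ t ∈ torus, t * w * t⁻¹ = mk4 0 0 1 0 (by norm_num) := by
    intro w hw
    obtain ⟨t, ht, h1, h2, h3⟩ := exists_torus_conj_std w
    refine ⟨t, ht, ?_⟩
    have h4 := sq_sum (t * w * t⁻¹)
    have h5 : ((t * w * t⁻¹ : UnitQuat) : ℍ[ℝ]).re = 0 := (re_conj t w).trans hw.1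
    rw [h5, h3, hw.2, h1] at h4
    apply ext'
    · rw [h5]; simp
    · rw [h3, hw.2]; simp
    · simp only [coe_mk4, quat_imJ]
      nlinarith
    · rw [h1]; simp
  obtain ⟨t, ht, h⟩ := key hw
  obtain ⟨u, hu, h'⟩ := key hw'
  refine ⟨u⁻¹ * t, torus.mul_mem (torus.inv_mem hu) ht, ?_⟩
  rw [show u⁻¹ * t * w * (u⁻¹ * t)⁻¹ = u⁻¹ * (t * w * t⁻¹) * u by group, h, ← h']
  group

/-- The standard unit quaternion `j`. -/
noncomputable def jj : UnitQuat := mk4 0 0 1 0 (by norm_num)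

theorem jj_mem : jj ∈ torusJ := by simp [mem_torusJ, jj]

/-- The centralizer of a noncentral element is a torus, hence commutative. -/
theorem comm_trans {x y z : UnitQuat} (hx : x ∉ pm) (hy : x * y = y * x) (hz : x * z = z * x) :
    y * z = z * y := by
  obtain ⟨g, hg, -⟩ := exists_conj_std x
  have hx' : g * x * g⁻¹ ∉ pm := by rwa [conj_mem_pm]
  have key : ∀ {y : UnitQuat}, x * y = y * x → g * y * g⁻¹ ∈ torus := by
    intro y hy
    apply mem_torus_of_comm hg hx'
    rw [show g * x * g⁻¹ * (g * y * g⁻¹) = g * (x * y) * g⁻¹ by group, hy]; group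
  have := torus_comm (key hy) (key hz)
  have e : g * (y * z) * g⁻¹ = g * (z * y) * g⁻¹ := by
    calc _ = g * y * g⁻¹ * (g * z * g⁻¹) := by group
      _ = _ := by rw [this]; group
  exact mul_left_cancel (mul_right_cancel e)

/-- Commuting elements lie in a common torus, where the real part determines an element up to
inversion. This is the main tool for recognizing conjugates inside commutative groups. -/
theorem eq_or_inv_of_comm {x y : UnitQuat} (h : x * y = y * x) (hre : re x = re y) :
    x = y ∨ x = y⁻¹ := by
  by_cases hx : x ∈ pm
  · rcases hx with rfl | rfl
    · rw [re_one] at hre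
      exact Or.inl (eq_one_of_re hre.symm).symm
    · rw [re_neg, re_one] at hre
      exact Or.inl (eq_neg_one_of_re hre.symm).symm
  obtain ⟨g, hg, -⟩ := exists_conj_std x
  have hx' : g * x * g⁻¹ ∉ pm := by rwa [conj_mem_pm]
  have hy : g * y * g⁻¹ ∈ torus := by
    apply mem_torus_of_comm hg hx'
    rw [show g * x * g⁻¹ * (g * y * g⁻¹) = g * (x * y) * g⁻¹ by group, h]; group
  rcases torus_eq_or_inv hg hy (by simpa using hre) with h | h
  · left; exact mul_left_cancel (mul_right_cancel h)
  · right
    have : g * x * g⁻¹ = g * y⁻¹ * g⁻¹ := by rw [h]; group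
    exact mul_left_cancel (mul_right_cancel this)

/-- A conjugation that moves one noncentral element into the torus moves its whole centralizer
there. -/
theorem CommOn.exists_le_torus {A : Subgroup UnitQuat} (h : CommOn A) :
    ∃ g, A.cj g ≤ torus := by
  by_cases hA : A ≤ pm
  · refine ⟨1, ?_⟩
    rw [Subgroup.cj_one]
    intro x hx
    rcases hA hx with rfl | rfl
    · exact torus.one_mem
    · constructor <;> simp [Unitary.coe_neg]
  · obtain ⟨x, hx, hx'⟩ := SetLike.not_le_iff_exists.1 hA
    obtain ⟨g, hg, -⟩ := exists_conj_std x
    refine ⟨g, fun y hy => ?_⟩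
    apply mem_torus_of_comm hg (by rwa [conj_mem_pm])
    exact h.cj g _ (Subgroup.conj_mem_cj hx) _ hy

theorem commOn_of_le_torus {A : Subgroup UnitQuat} (h : A ≤ torus) : CommOn A :=
  fun _ hx _ hy => torus_comm (h hx) (h hy)

/-- The torus as a subgroup of the complex numbers. -/
noncomputable def torusToComplex : torus →* ℂ where
  toFun x := ⟨(x : ℍ[ℝ]).re, (x : ℍ[ℝ]).imI⟩
  map_one' := by apply Complex.ext <;> simp
  map_mul' := by
    rintro ⟨x, hx⟩ ⟨y, hy⟩
    apply Complex.ext <;> simp [hx.1, hx.2, hy.1, hy.2]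

theorem torusToComplex_injective : Function.Injective torusToComplex := by
  rintro ⟨x, hx⟩ ⟨y, hy⟩ h
  have h1 := congrArg Complex.re h
  have h2 := congrArg Complex.im h
  simp [torusToComplex] at h1 h2
  apply Subtype.ext
  apply ext' h1 h2
  · rw [hx.1, hy.1]
  · rw [hx.2, hy.2]

/-- The torus embeds in the multiplicative monoid of ℂ, and finite groups of units in a field are
cyclic. -/
theorem CommOn.exists_zpowers {A : Subgroup UnitQuat} [Finite A] (h : CommOn A) :
    ∃ z, A = Subgroup.zpowers z := by
  have key : ∀ A : Subgroup UnitQuat, Finite A → A ≤ torus → ∃ z, A = Subgroup.zpowers z := by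
    intro A _ hA
    have hc : IsCyclic A := isCyclic_of_injective_ringHom
      (torusToComplex.comp (Subgroup.inclusion hA))
      (torusToComplex_injective.comp (Subgroup.inclusion_injective hA))
    obtain ⟨⟨z, hz⟩, hg⟩ := hc.exists_generator
    refine ⟨z, le_antisymm (fun x hx => ?_) ((Subgroup.zpowers_le).2 hz)⟩
    obtain ⟨n, hn⟩ := hg ⟨x, hx⟩
    exact ⟨n, by simpa using congrArg Subtype.val hn⟩
  obtain ⟨g, hg⟩ := CommOn.exists_le_torus h
  obtain ⟨z, hz⟩ := key _ inferInstance hg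
  refine ⟨g⁻¹ * z * g, ?_⟩
  rw [← Subgroup.cj_inv_cj g A, hz, Subgroup.cj_zpowers, inv_inv]

/-- A circle has only one subgroup of each finite order, the roots of unity of that order. Kernels
lying in a torus therefore agree as soon as their orders do. -/
theorem torus_eq_of_card {A B : Subgroup UnitQuat} [Finite A] [Finite B] (hA : A ≤ torus)
    (hB : B ≤ torus) (h : Nat.card A = Nat.card B) : A = B := by
  obtain ⟨z, rfl⟩ := CommOn.exists_zpowers (commOn_of_le_torus hA)
  obtain ⟨w, rfl⟩ := CommOn.exists_zpowers (commOn_of_le_torus hB)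
  rw [Nat.card_zpowers, Nat.card_zpowers] at h
  have hz : z ∈ torus := hA (Subgroup.mem_zpowers z)
  have hw : w ∈ torus := hB (Subgroup.mem_zpowers w)
  have hz0 : 0 < orderOf z := by
    rw [orderOf_pos_iff]
    exact isOfFinOrder_iff_pow_eq_one.2 (by
      have := Nat.card_zpowers z ▸ (Nat.card_pos (α := Subgroup.zpowers z))
      exact ⟨_, this, pow_orderOf_eq_one z⟩)
  have hp : IsPrimitiveRoot (torusToComplex ⟨z, hz⟩) (orderOf z) := by
    have := IsPrimitiveRoot.orderOf (torusToComplex ⟨z, hz⟩)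
    rwa [orderOf_injective _ torusToComplex_injective, Subgroup.orderOf_mk] at this
  have hw1 : torusToComplex ⟨w, hw⟩ ^ orderOf z = 1 := by
    rw [← map_pow, ← map_one torusToComplex]
    congr 1
    apply Subtype.ext
    simp [h, pow_orderOf_eq_one]
  have : NeZero (orderOf z) := ⟨hz0.ne'⟩
  obtain ⟨i, -, hi⟩ := hp.eq_pow_of_pow_eq_one hw1
  rw [← map_pow] at hi
  have hi' := congrArg Subtype.val (torusToComplex_injective hi)
  simp at hi'
  symm
  apply Subgroup.eq_of_le_of_card_ge
  · rw [Subgroup.zpowers_le, ← hi']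
    exact Subgroup.pow_mem _ (Subgroup.mem_zpowers z) i
  · rw [Nat.card_zpowers, Nat.card_zpowers, h]

/-! ### Dihedral groups: a commutative subgroup of index two. -/

/-- `L` is a commutative subgroup of index two in the noncommutative group `A`. -/
structure Dih (A L : Subgroup UnitQuat) : Prop where
  le : L ≤ A
  comm : CommOn L
  not_comm : ¬ CommOn A
  mul_mem : ∀ x ∈ A, ∀ y ∈ A, x ∉ L → y ∉ L → x * y ∈ L

theorem Dih.cj {A L : Subgroup UnitQuat} (h : Dih A L) (g : UnitQuat) : Dih (A.cj g) (L.cj g) where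
  le := Subgroup.cj_mono h.le
  comm := h.comm.cj g
  not_comm := by rw [commOn_cj_iff]; exact h.not_comm
  mul_mem := by
    intro x hx y hy hx' hy'
    rw [Subgroup.mem_cj] at *
    have := h.mul_mem _ hx _ hy hx' hy'
    rwa [show g⁻¹ * (x * y) * g = g⁻¹ * x * g * (g⁻¹ * y * g) by group]

theorem Dih.exists_notMem {A L : Subgroup UnitQuat} (h : Dih A L) : ∃ w ∈ A, w ∉ L := by
  by_contra! hc
  exact h.not_comm (h.comm.mono hc)

/-- If L were central, then for a fixed w outside L every x in A outside L would have x w central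
and so commute with w. With w noncentral, A would lie in one centralizer and be commutative; with w
central, all of A would be central. -/
theorem Dih.not_le_pm {A L : Subgroup UnitQuat} (h : Dih A L) : ¬ L ≤ pm := by
  intro hL
  obtain ⟨w, hw, hw'⟩ := h.exists_notMem
  apply h.not_comm
  have key : ∀ x ∈ A, x * w = w * x := by
    intro x hx
    by_cases hxL : x ∈ L
    · exact pm_comm (hL hxL) w
    · have h1 := pm_comm (hL (h.mul_mem x hx w hw hxL hw')) w
      have : x * w * w = w * x * w := by rw [h1]; group
      exact mul_right_cancel this
  have hwpm : w ∉ pm := by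
    rintro (rfl | rfl)
    · exact hw' L.one_mem
    · obtain ⟨x, hx, y, hy, hxy⟩ : ∃ x ∈ A, ∃ y ∈ A, x * y ≠ y * x := by
        by_contra! hc; exact h.not_comm hc
      have hx1 : x ∉ pm := fun h' => hxy (pm_comm h' y)
      have hx2 : x ∉ L := fun h' => hx1 (hL h')
      have := hL (h.mul_mem x hx _ hw hx2 hw')
      simp only [mul_neg, mul_one] at this
      apply hx1
      rcases this with h' | h'
      · right; rw [← h', neg_neg]
      · left; exact neg_inj.1 h'
  intro x hx y hy
  exact comm_trans hwpm (key x hx).symm (key y hy).symm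

/-- A group with a commutative subgroup of index two is conjugate into the normalizer of the
standard torus. -/
theorem Dih.exists_std {A L : Subgroup UnitQuat} (h : Dih A L) :
    ∃ g, L.cj g ≤ torus ∧ ∀ x ∈ A.cj g, x ∉ L.cj g → x ∈ torusJ := by
  obtain ⟨g, hg⟩ := CommOn.exists_le_torus h.comm
  refine ⟨g, hg, ?_⟩
  have h' := h.cj g
  generalize A.cj g = A at *
  generalize L.cj g = L at *
  obtain ⟨l, hl, hl'⟩ := SetLike.not_le_iff_exists.1 h'.not_le_pm
  intro x hx hxL
  have hxl : x * l * x⁻¹ ∈ L := by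
    have h1 : x * l ∉ L := fun hc => hxL ((L.mul_mem_cancel_right hl).1 hc)
    have h2 : x⁻¹ ∉ L := fun hc => hxL (L.inv_mem_iff.1 hc)
    exact h'.mul_mem _ (A.mul_mem hx (h'.le hl)) _ (A.inv_mem hx) h1 h2
  -- The conjugate x l x⁻¹ lies in the torus and has the trace of l, so it is l or l⁻¹. The first
  -- would put x, and then all of A, into the torus, contrary to noncommutativity.
  rcases torus_eq_or_inv (hg hxl) (hg hl) (by simp) with h1 | h1
  · exfalso
    have hxT : ∀ y ∈ A, y ∉ L → y ∈ torus := by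
      intro y hy hyL
      have hcx : x ∈ torus := mem_torus_of_comm (hg hl) hl' (by
        rw [mul_inv_eq_iff_eq_mul] at h1; exact h1.symm)
      have := hg (h'.mul_mem x hx y hy hxL hyL)
      exact (torus.mul_mem_cancel_left hcx).1 this
    apply h'.not_comm
    apply commOn_of_le_torus
    intro y hy
    by_cases hyL : y ∈ L
    · exact hg hyL
    · exact hxT y hy hyL
  · exact mem_torusJ_of_conj (hg hl) hl' h1

/-- In standard position x lies in the span of j and k. Hence an element of nonzero trace must
belong to the cyclic part; this is how traces detect L. -/
theorem Dih.re_eq_zero {A L : Subgroup UnitQuat} (h : Dih A L) {x : UnitQuat} (hx : x ∈ A)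
    (hx' : x ∉ L) : re x = 0 := by
  obtain ⟨g, -, h2⟩ := h.exists_std
  have := h2 (g * x * g⁻¹) (Subgroup.conj_mem_cj hx) (by
    rw [Subgroup.mem_cj]; simpa [mul_assoc] using hx')
  rw [← re_conj g x]
  exact re_torusJ this

theorem Dih.conj_eq_inv {A L : Subgroup UnitQuat} (h : Dih A L) {x l : UnitQuat} (hx : x ∈ A)
    (hx' : x ∉ L) (hl : l ∈ L) : x * l * x⁻¹ = l⁻¹ := by
  obtain ⟨g, h1, h2⟩ := h.exists_std
  have := h2 (g * x * g⁻¹) (Subgroup.conj_mem_cj hx) (by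
    rw [Subgroup.mem_cj]; simpa [mul_assoc] using hx')
  have h3 := torusJ_conj_torus this (h1 (Subgroup.conj_mem_cj hl))
  have e : g * (x * l * x⁻¹) * g⁻¹ = g * l⁻¹ * g⁻¹ := by
    calc _ = g * x * g⁻¹ * (g * l * g⁻¹) * (g * x * g⁻¹)⁻¹ := by group
      _ = _ := by rw [h3]; group
  exact mul_left_cancel (mul_right_cancel e)

end UnitQuat

section General
variable {G : Type*} [Group G]

theorem Subgroup.card_mul_relIndex_of_le {L A : Subgroup G} (h : L ≤ A) :
    Nat.card L * L.relIndex A = Nat.card A := by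
  have := Subgroup.card_mul_index (L.subgroupOf A)
  rwa [Nat.card_congr (Subgroup.subgroupOfEquivOfLe h).toEquiv] at this

theorem Subgroup.mul_mem_of_card_le {L A : Subgroup G} [Finite A] (h : L ≤ A)
    (hc : Nat.card A ≤ 2 * Nat.card L) {x y : G} (hx : x ∈ A) (hy : y ∈ A) (hx' : x ∉ L)
    (hy' : y ∉ L) : x * y ∈ L := by
  have h1 := Subgroup.card_mul_relIndex_of_le h
  have hpos : 0 < Nat.card A := Nat.card_pos
  have hL : 0 < Nat.card L := Nat.pos_of_ne_zero (by rintro h0; rw [h0] at h1; omega)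
  have h2 : L.relIndex A ≤ 2 := by
    by_contra! hcon
    nlinarith
  have h3 : L.relIndex A ≠ 0 := by rintro h0; rw [h0] at h1; omega
  have h4 : L.relIndex A ≠ 1 := by
    intro h0
    exact hx' (Subgroup.relIndex_eq_one.1 h0 hx)
  have h5 : (L.subgroupOf A).index = 2 := by
    change L.relIndex A = 2; omega
  have := (Subgroup.mul_mem_iff_of_index_two h5 (a := ⟨x, hx⟩) (b := ⟨y, hy⟩)).2
    (by simp [Subgroup.mem_subgroupOf, hx', hy'])
  simpa [Subgroup.mem_subgroupOf] using this

theorem Subgroup.card_eq_two_mul {L A : Subgroup G} (h : L ≤ A)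
    (hm : ∀ x ∈ A, ∀ y ∈ A, x ∉ L → y ∉ L → x * y ∈ L) {w : G} (hw : w ∈ A) (hw' : w ∉ L) :
    Nat.card A = 2 * Nat.card L := by
  have h5 : (L.subgroupOf A).index = 2 := by
    rw [Subgroup.index_eq_two_iff]
    refine ⟨⟨w, hw⟩, fun ⟨b, hb⟩ => ?_⟩
    simp only [Subgroup.mem_subgroupOf, Subgroup.coe_mul]
    by_cases hbL : b ∈ L
    · right
      exact ⟨hbL, fun hc => hw' ((L.mul_mem_cancel_left hbL).1 hc)⟩
    · left
      exact ⟨hm b hb w hw hbL hw', hbL⟩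
  rw [← Subgroup.card_mul_relIndex_of_le h, mul_comm]
  congr 1

end General

/-! ### Exceptional groups and the counting of poles. -/

namespace UnitQuat

theorem Dih.card {A L : Subgroup UnitQuat} (h : Dih A L) : Nat.card A = 2 * Nat.card L := by
  obtain ⟨w, hw, hw'⟩ := h.exists_notMem
  exact Subgroup.card_eq_two_mul h.le h.mul_mem hw hw'

/-- A finite group without commutative subgroups of index at most two. -/
def Exc (A : Subgroup UnitQuat) : Prop :=
  Finite A ∧ ∀ L ≤ A, CommOn L → 2 * Nat.card L < Nat.card A

/-- If A is not exceptional, some commutative L has at least half its order, hence index at most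
two. All later case distinctions rest on this trichotomy. -/
theorem commOn_or_dih_or_exc (A : Subgroup UnitQuat) [Finite A] :
    CommOn A ∨ (∃ L, Dih A L) ∨ Exc A := by
  by_cases hA : CommOn A
  · exact Or.inl hA
  by_cases hE : Exc A
  · exact Or.inr (Or.inr hE)
  right; left
  simp only [Exc, not_and, not_forall, not_lt] at hE
  obtain ⟨L, hL, hc, hcard⟩ := hE inferInstance
  exact ⟨L, hL, hc, hA, fun x hx y hy hx' hy' =>
    Subgroup.mul_mem_of_card_le hL hcard hx hy hx' hy'⟩

/-- The centralizer of `x` in `A`. -/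
noncomputable def cent (A : Subgroup UnitQuat) (x : UnitQuat) : Subgroup UnitQuat :=
  A ⊓ Subgroup.centralizer {x}

theorem mem_cent {A : Subgroup UnitQuat} {x y : UnitQuat} :
    y ∈ cent A x ↔ y ∈ A ∧ y * x = x * y := by
  rw [cent, Subgroup.mem_inf, Subgroup.mem_centralizer_singleton_iff]

theorem cent_le (A : Subgroup UnitQuat) (x : UnitQuat) : cent A x ≤ A := inf_le_left

theorem cent_comm (A : Subgroup UnitQuat) {x : UnitQuat} (hx : x ∉ pm) : CommOn (cent A x) :=
  fun _ hy _ hz => comm_trans hx (mem_cent.1 hy).2.symm (mem_cent.1 hz).2.symm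

theorem cent_eq_of_comm (A : Subgroup UnitQuat) {x y : UnitQuat} (hx : x ∉ pm) (hy : y ∉ pm)
    (h : x * y = y * x) : cent A x = cent A y := by
  ext z
  rw [mem_cent, mem_cent]
  exact and_congr_right fun _ =>
    ⟨fun hz => comm_trans hx hz.symm h, fun hz => comm_trans hy hz.symm h.symm⟩

/-- The poles of `A`: the pure imaginary units that commute with a noncentral element of `A`. -/
def poles (A : Subgroup UnitQuat) : Set UnitQuat :=
  {u | re u = 0 ∧ ∃ x ∈ A, x ∉ pm ∧ x * u = u * x}

theorem notMem_pm_of_re_eq_zero {u : UnitQuat} (h : re u = 0) : u ∉ pm := by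
  intro hu
  rw [mem_pm_iff_re, h] at hu
  norm_num at hu

theorem exists_imaginary_comm (x : UnitQuat) : ∃ u, re u = 0 ∧ x * u = u * x := by
  obtain ⟨g, hg, -⟩ := exists_conj_std x
  refine ⟨g⁻¹ * mk4 0 1 0 0 (by norm_num) * g, ?_, ?_⟩
  · have := re_conj g⁻¹ (mk4 0 1 0 0 (by norm_num))
    rw [inv_inv] at this
    rw [this]; simp [re]
  · have := torus_comm hg (y := mk4 0 1 0 0 (by norm_num)) (by simp [mem_torus])
    have e : g⁻¹ * (g * x * g⁻¹ * mk4 0 1 0 0 (by norm_num)) * g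
      = g⁻¹ * (mk4 0 1 0 0 (by norm_num) * (g * x * g⁻¹)) * g := by rw [this]
    calc _ = g⁻¹ * (g * x * g⁻¹ * mk4 0 1 0 0 (by norm_num)) * g := by group
      _ = _ := by rw [e]; group

theorem imaginary_comm_eq {x u v : UnitQuat} (hx : x ∉ pm) (hu : re u = 0) (hv : re v = 0)
    (hxu : x * u = u * x) (hxv : x * v = v * x) : v = u ∨ v = u⁻¹ :=
  eq_or_inv_of_comm (comm_trans hx hxv hxu) (by rw [hu, hv])

theorem ne_inv_of_re_eq_zero {u : UnitQuat} (hu : re u = 0) : u ≠ u⁻¹ := by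
  intro h
  have h1 : u ^ 2 = 1 := by
    rw [pow_two]; nth_rewrite 1 [h]; simp
  rw [sq_eq_neg_one_iff.2 hu] at h1
  exact neg_one_ne_one h1

theorem finite_poles (A : Subgroup UnitQuat) [Finite A] : (poles A).Finite := by
  have : poles A ⊆ ⋃ x : A, {u | re u = 0 ∧ (x : UnitQuat) ∉ pm ∧ (x : UnitQuat) * u = u * x} := by
    rintro u ⟨hu, x, hx, hx', h⟩
    exact Set.mem_iUnion.2 ⟨⟨x, hx⟩, hu, hx', h⟩
  refine Set.Finite.subset (Set.finite_iUnion fun x => ?_) this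
  obtain ⟨u, hu, hxu⟩ := exists_imaginary_comm x
  refine Set.Finite.subset (Set.toFinite {u, u⁻¹}) ?_
  rintro v ⟨hv, hx, hxv⟩
  exact imaginary_comm_eq hx hu hv hxu hxv

theorem conj_mem_poles {A : Subgroup UnitQuat} {u a : UnitQuat} (hu : u ∈ poles A) (ha : a ∈ A) :
    a * u * a⁻¹ ∈ poles A := by
  obtain ⟨hu, x, hx, hx', h⟩ := hu
  refine ⟨by simpa using hu, a * x * a⁻¹, A.mul_mem (A.mul_mem ha hx) (A.inv_mem ha),
    by rwa [conj_mem_pm], ?_⟩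
  calc _ = a * (x * u) * a⁻¹ := by group
    _ = _ := by rw [h]; group

/-- A finite group acts on its poles by conjugation. -/
@[reducible] noncomputable def polesAction (A : Subgroup UnitQuat) : MulAction A (poles A) where
  smul a u := ⟨a * u * (a : UnitQuat)⁻¹, conj_mem_poles u.2 a.2⟩
  one_smul u := Subtype.ext (by
    change (1 : UnitQuat) * u * (1 : UnitQuat)⁻¹ = u
    simp)
  mul_smul a b u := Subtype.ext (by
    change (a * b : UnitQuat) * u * (a * b : UnitQuat)⁻¹ = a * (b * u * (b : UnitQuat)⁻¹) *
      (a : UnitQuat)⁻¹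
    group)

theorem card_pm_inf (A : Subgroup UnitQuat) :
    Nat.card (A ⊓ pm : Subgroup UnitQuat) = 1 ∧ -1 ∉ A ∨
      Nat.card (A ⊓ pm : Subgroup UnitQuat) = 2 ∧ -1 ∈ A := by
  by_cases h : (-1 : UnitQuat) ∈ A
  · right
    refine ⟨?_, h⟩
    have : ((A ⊓ pm : Subgroup UnitQuat) : Set UnitQuat) = {1, -1} := by
      ext x
      simp only [SetLike.mem_coe, Subgroup.mem_inf, Set.mem_insert_iff, Set.mem_singleton_iff,
        mem_pm]
      constructor
      · exact fun h => h.2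
      · rintro (rfl | rfl)
        · exact ⟨A.one_mem, Or.inl rfl⟩
        · exact ⟨h, Or.inr rfl⟩
    have h2 := Set.ncard_pair neg_one_ne_one.symm
    rw [← this] at h2
    exact h2
  · left
    refine ⟨?_, h⟩
    rw [Subgroup.card_eq_one, eq_bot_iff]
    rintro x ⟨hx, rfl | rfl⟩
    · simp
    · exact absurd hx h

/-- The counting formula for the orbits of poles. -/
theorem exists_orbit_data {A : Subgroup UnitQuat} (hA : Exc A) :
    ∃ (k : ℕ) (s : Fin k → ℕ),
      (∀ x ∈ A, x ∉ pm → ∃ ω, Nat.card (cent A x) = s ω) ∧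
      (∀ ω, ∃ x ∈ A, x ∉ pm ∧ Nat.card (cent A x) = s ω) ∧
      ∑ ω, (1 - (Nat.card (A ⊓ pm : Subgroup UnitQuat) : ℚ) / s ω) =
        2 - 2 * (Nat.card (A ⊓ pm : Subgroup UnitQuat) : ℚ) / Nat.card A := by
  classical
  have : Finite A := hA.1
  have := (finite_poles A).to_subtype
  let := polesAction A
  have hsm : ∀ (a : A) (u : poles A), ((a • u : poles A) : UnitQuat) = a * u * (a : UnitQuat)⁻¹ :=
    fun _ _ => rfl
  let : Fintype A := Fintype.ofFinite _
  let : Fintype (poles A) := Fintype.ofFinite _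
  let : Fintype (Quotient (MulAction.orbitRel A (poles A))) := Fintype.ofFinite _
  have hfix : ∀ (a : A) (u : poles A), a • u = u ↔ (a : UnitQuat) * u = u * a := by
    intro a u
    rw [Subtype.ext_iff, hsm, mul_inv_eq_iff_eq_mul]
  have hstab : ∀ u : poles A, ∃ x ∈ A, x ∉ pm ∧ x * (u : UnitQuat) = u * x ∧
      -- The stabilizer of a pole u is the centralizer of any noncentral element of A commuting with
      -- u, because all of these lie in one torus.
      Nat.card (MulAction.stabilizer A u) = Nat.card (cent A x) := by
    rintro ⟨u, hu, x, hx, hx', h⟩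
    refine ⟨x, hx, hx', h, ?_⟩
    have hup := notMem_pm_of_re_eq_zero hu
    rw [cent_eq_of_comm A hx' hup h]
    refine Nat.card_congr ⟨fun a => ⟨a.1, mem_cent.2 ⟨a.1.2, (hfix a.1 _).1 a.2⟩⟩,
      fun b => ⟨⟨b.1, (mem_cent.1 b.2).1⟩, (hfix _ _).2 (mem_cent.1 b.2).2⟩,
      fun _ => rfl, fun _ => rfl⟩
  set e := Nat.card (A ⊓ pm : Subgroup UnitQuat) with he
  have hburn := MulAction.sum_card_fixedBy_eq_card_orbits_mul_card_group A (poles A)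
  have horb := MulAction.card_eq_sum_card_group_div_card_stabilizer A (poles A)
  -- A central element fixes all poles. Any other element fixes exactly the two imaginary units u
  -- and u⁻¹ of its own torus.
  have hF : ∀ a : A, Fintype.card (MulAction.fixedBy (poles A) a) =
      if (a : UnitQuat) ∈ pm then Fintype.card (poles A) else 2 := by
    intro a
    split_ifs with ha
    · apply Fintype.card_congr
      refine ⟨fun u => u.1, fun u => ⟨u, (hfix a u).2 (pm_comm ha _)⟩, fun _ => rfl, fun _ => rfl⟩
    · obtain ⟨u, hu, hau⟩ := exists_imaginary_comm (a : UnitQuat)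
      have hau' : (a : UnitQuat) * u⁻¹ = u⁻¹ * a := by
        rw [eq_inv_mul_iff_mul_eq, ← mul_assoc, ← hau]; group
      have hu1 : u ∈ poles A := ⟨hu, a, a.2, ha, hau⟩
      have hu2 : u⁻¹ ∈ poles A := ⟨by simpa using hu, a, a.2, ha, hau'⟩
      have : MulAction.fixedBy (poles A) a = {⟨u, hu1⟩, ⟨u⁻¹, hu2⟩} := by
        ext v
        rw [MulAction.mem_fixedBy, hfix]
        rw [Set.mem_insert_iff, Set.mem_singleton_iff]
        constructor
        · exact fun hv => (imaginary_comm_eq ha hu v.2.1 hau hv).imp Subtype.ext Subtype.ext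
        · rintro (rfl | rfl)
          · exact hau
          · exact hau'
      have h2 := Set.ncard_pair (a := (⟨u, hu1⟩ : poles A)) (b := ⟨u⁻¹, hu2⟩)
        (fun h => ne_inv_of_re_eq_zero hu (congrArg Subtype.val h))
      rw [← this] at h2
      rw [← Nat.card_eq_fintype_card]
      exact h2
  have hcardA : Fintype.card A = Nat.card A := Nat.card_eq_fintype_card.symm
  have hfil : (Finset.univ.filter (fun a : A => (a : UnitQuat) ∈ pm)).card = e := by
    rw [← Fintype.card_subtype, ← Nat.card_eq_fintype_card, he]
    exact Nat.card_congr ⟨fun a => ⟨a.1, a.1.2, a.2⟩, fun b => ⟨⟨b.1, b.2.1⟩, b.2.2⟩,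
      fun _ => rfl, fun _ => rfl⟩
  have hfil2 := Finset.card_filter_add_card_filter_not (s := (Finset.univ : Finset A))
    (fun a : A => (a : UnitQuat) ∈ pm)
  rw [hfil, Finset.card_univ, hcardA] at hfil2
  simp only [hF, Finset.sum_ite, Finset.sum_const, hfil, smul_eq_mul] at hburn
  rw [hcardA] at hburn
  have hApos : (0 : ℚ) < Nat.card A := by exact_mod_cast Nat.card_pos
  refine ⟨Fintype.card (Quotient (MulAction.orbitRel A (poles A))),
    fun i => Nat.card (MulAction.stabilizer A
      (((Fintype.equivFin (Quotient (MulAction.orbitRel A (poles A)))).symm i).out)), ?_, ?_, ?_⟩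
  · intro x hx hx'
    obtain ⟨u, hu, hxu⟩ := exists_imaginary_comm x
    have hu1 : u ∈ poles A := ⟨hu, x, hx, hx', hxu⟩
    refine ⟨Fintype.equivFin _ (Quotient.mk'' ⟨u, hu1⟩), ?_⟩
    simp only [Equiv.symm_apply_apply]
    obtain ⟨a, ha⟩ : ∃ a : A, a • (⟨u, hu1⟩ : poles A) =
        (Quotient.mk'' ⟨u, hu1⟩ : Quotient (MulAction.orbitRel A (poles A))).out := by
      have := Quotient.mk_out (s := MulAction.orbitRel A (poles A)) ⟨u, hu1⟩
      rw [MulAction.orbitRel_apply, MulAction.mem_orbit_iff] at this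
      exact this
    rw [← ha, Nat.card_congr (MulAction.stabilizerEquivStabilizer (g := a) rfl).symm.toEquiv]
    obtain ⟨y, hy, hy', hyu, h⟩ := hstab ⟨u, hu1⟩
    have hup := notMem_pm_of_re_eq_zero hu
    rw [h, cent_eq_of_comm A hx' hup hxu, cent_eq_of_comm A hy' hup hyu]
  · intro i
    obtain ⟨y, hy, hy', hyu, h⟩ := hstab
      (((Fintype.equivFin (Quotient (MulAction.orbitRel A (poles A)))).symm i).out)
    exact ⟨y, hy, hy', h.symm⟩
  · rw [Equiv.sum_comp (Fintype.equivFin (Quotient (MulAction.orbitRel A (poles A)))).symm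
      (fun ω => (1 - (e : ℚ) / Nat.card (MulAction.stabilizer A ω.out)))]
    rw [Finset.sum_sub_distrib, Finset.sum_const, nsmul_eq_mul, mul_one, Finset.card_univ]
    have h1 : (Fintype.card (poles A) : ℚ) =
        ∑ ω : Quotient (MulAction.orbitRel A (poles A)),
          (Nat.card A : ℚ) / Nat.card (MulAction.stabilizer A ω.out) := by
      rw [horb, Nat.cast_sum]
      apply Finset.sum_congr rfl
      intro ω _
      rw [← Nat.card_eq_fintype_card, ← Nat.card_eq_fintype_card,
        Nat.cast_div (Subgroup.card_subgroup_dvd_card _)]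
      exact_mod_cast Nat.card_pos.ne'
    have h2 : ∑ ω : Quotient (MulAction.orbitRel A (poles A)),
          (e : ℚ) / Nat.card (MulAction.stabilizer A ω.out) =
        e * Fintype.card (poles A) / Nat.card A := by
      rw [h1, Finset.mul_sum, Finset.sum_div]
      apply Finset.sum_congr rfl
      intro ω _
      field_simp
    rw [h2]
    -- Burnside's lemma: the e central elements contribute all poles each, the remaining ones two
    -- each. Dividing by the order of A and inserting the orbit sum `h2` yields the formula.
    have h3 : (e * Fintype.card (poles A) + (Nat.card A - e) * 2 : ℚ) =
        Fintype.card (Quotient (MulAction.orbitRel A (poles A))) * Nat.card A := by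
      rw [← Nat.cast_mul, ← Nat.cast_mul, ← hburn, ← hfil2]
      push_cast; ring
    field_simp
    linarith

end UnitQuat

/-! ### The Diophantine equation of the Platonic solids. -/

/-- The possible orders and pole orders of an exceptional group. -/
def ExcData {ι : Type*} (n : ℕ) (m : ι → ℕ) : Prop :=
  (n = 12 ∧ (∀ i, m i = 2 ∨ m i = 3) ∧ ∃ i, m i = 3) ∨
  (n = 24 ∧ (∀ i, m i = 2 ∨ m i = 3 ∨ m i = 4) ∧ ∃ i, m i = 4) ∨
  (n = 60 ∧ (∀ i, m i = 2 ∨ m i = 3 ∨ m i = 5) ∧ ∃ i, m i = 5)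

/-- The three reciprocals add up to more than 1. So a = 2, since otherwise the sum is at most 1; b =
2 would give n = 2c, which the strict bound `hc` excludes, and b ≥ 4 again gives at most 1; finally
c < 6 for the same reason. -/
theorem platonic_sorted {a b c n : ℕ} (ha : 2 ≤ a) (hab : a ≤ b) (hbc : b ≤ c) (hc : 2 * c < n)
    (h : (1 : ℚ) / a + 1 / b + 1 / c = 1 + 2 / n) :
    a = 2 ∧ b = 3 ∧ ((c = 3 ∧ n = 12) ∨ (c = 4 ∧ n = 24) ∨ (c = 5 ∧ n = 60)) := by
  have hn : (0 : ℚ) < n := by exact_mod_cast (by omega : 0 < n)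
  have h0 : (0 : ℚ) < 2 / n := by positivity
  have inv : ∀ {p q : ℕ}, 0 < p → p ≤ q → (1 : ℚ) / q ≤ 1 / p := by
    intro p q hp hpq
    exact one_div_le_one_div_of_le (by exact_mod_cast hp) (by exact_mod_cast hpq)
  have ha2 : a = 2 := by
    by_contra hne
    have h1 := inv (p := 3) (q := a) (by norm_num) (by omega)
    have h2 := inv (p := 3) (q := b) (by norm_num) (by omega)
    have h3 := inv (p := 3) (q := c) (by norm_num) (by omega)
    norm_num at h1 h2 h3 h
    linarith
  subst ha2
  have hb3 : b = 3 := by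
    by_contra hne
    rcases (by omega : b = 2 ∨ 4 ≤ b) with rfl | hb
    · have hc0 : (0 : ℚ) < c := by exact_mod_cast (by omega : 0 < c)
      have h4 : (n : ℚ) = 2 * c := by field_simp at h; push_cast at h; linarith
      have : n = 2 * c := by exact_mod_cast h4
      omega
    · have h2 := inv (p := 4) (q := b) (by norm_num) (by omega)
      have h3 := inv (p := 4) (q := c) (by norm_num) (by omega)
      norm_num at h2 h3 h
      linarith
  subst hb3
  have hc5 : c ≤ 5 := by
    by_contra hne
    have h3 := inv (p := 6) (q := c) (by norm_num) (by omega)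
    norm_num at h3 h
    linarith
  refine ⟨rfl, rfl, ?_⟩
  interval_cases c
  · left
    refine ⟨rfl, ?_⟩
    have : (n : ℚ) = 12 := by field_simp at h; push_cast at h; linarith
    exact_mod_cast this
  · right; left
    refine ⟨rfl, ?_⟩
    have : (n : ℚ) = 24 := by field_simp at h; push_cast at h; linarith
    exact_mod_cast this
  · right; right
    refine ⟨rfl, ?_⟩
    have : (n : ℚ) = 60 := by field_simp at h; push_cast at h; linarith
    exact_mod_cast this

/-- Each summand is at least 1/2 and the total is below 2, so there are at most three. Since 1 / m i
> 2 / n, two or fewer summands cannot reach 2 - 2 / n. Three summands reduce to `platonic_sorted`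
after sorting. -/
theorem platonic {k : ℕ} {m : Fin k → ℕ} {n : ℕ} (hn : 2 ≤ n) (h2 : ∀ i, 2 ≤ m i)
    (hm : ∀ i, 2 * m i < n) (h : ∑ i, (1 - (1 : ℚ) / m i) = 2 - 2 / n) : ExcData n m := by
  have hn0 : (0 : ℚ) < n := by exact_mod_cast (by omega : 0 < n)
  have h0 : (0 : ℚ) < 2 / n := by positivity
  have hge : ∀ i, (1 : ℚ) / 2 ≤ 1 - 1 / m i := by
    intro i
    have : (1 : ℚ) / m i ≤ 1 / 2 :=
      one_div_le_one_div_of_le (by norm_num) (by exact_mod_cast h2 i)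
    linarith
  have hk : k < 4 := by
    by_contra! hk
    have h1 := Finset.sum_le_sum (fun i (_ : i ∈ Finset.univ) => hge i)
    rw [h] at h1
    simp at h1
    have : (4 : ℚ) ≤ k := by exact_mod_cast hk
    linarith
  have hlt : ∀ i, (2 : ℚ) / n < 1 / m i := by
    intro i
    have hi : (0 : ℚ) < m i := by exact_mod_cast (by linarith [h2 i] : 0 < m i)
    rw [div_lt_div_iff₀ hn0 hi]
    have : (2 * m i : ℚ) < n := by exact_mod_cast hm i
    linarith
  have hn1 : (2 : ℚ) / n ≤ 1 := by
    rw [div_le_one hn0]; exact_mod_cast hn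
  interval_cases k
  · simp at h
    linarith
  · simp at h
    have h3 : (0 : ℚ) < (m 0 : ℚ)⁻¹ := by
      have := h2 0
      positivity
    linarith
  · simp [Fin.sum_univ_succ] at h
    have h3 := hlt 0
    have h4 := hlt 1
    simp at h3 h4
    linarith
  · simp only [Fin.sum_univ_three] at h
    have key : (1 : ℚ) / m 0 + 1 / m 1 + 1 / m 2 = 1 + 2 / n := by linarith
    have hall : ∀ p : ℕ → Prop, (∀ i, p (m i)) ↔ p (m 0) ∧ p (m 1) ∧ p (m 2) := by
      intro p; simp [Fin.forall_fin_succ]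
    have hex : ∀ p : ℕ → Prop, (∃ i, p (m i)) ↔ p (m 0) ∨ p (m 1) ∨ p (m 2) := by
      intro p; simp [Fin.exists_fin_succ]
    have d0 := h2 0
    have d1 := h2 1
    have d2 := h2 2
    have e0 := hm 0
    have e1 := hm 1
    have e2 := hm 2
    rw [ExcData, hall (fun x => x = 2 ∨ x = 3), hall (fun x => x = 2 ∨ x = 3 ∨ x = 4),
      hall (fun x => x = 2 ∨ x = 3 ∨ x = 5), hex (fun x => x = 3), hex (fun x => x = 4),
      hex (fun x => x = 5)]
    generalize m 0 = a at *
    generalize m 1 = b at *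
    generalize m 2 = c at *
    rcases le_total a b with p | p <;> rcases le_total b c with q | q <;>
      rcases le_total a c with r | r
    · have := platonic_sorted d0 p q e2 key; omega
    · have := platonic_sorted d0 p q e2 key; omega
    · have := platonic_sorted d0 r q e1 (by linarith); omega
    · have := platonic_sorted d2 r p e1 (by linarith); omega
    · have := platonic_sorted d1 p r e2 (by linarith); omega
    · have := platonic_sorted d1 q r e0 (by linarith); omega
    · have := platonic_sorted d2 q p e0 (by linarith); omega
    · have := platonic_sorted d2 q p e0 (by linarith); omega

/-! ### Orders and centralizers in exceptional groups. -/

namespace UnitQuat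

theorem pow_mem_pm_of_card {A : Subgroup UnitQuat} [Finite A] {x : UnitQuat} {m : ℕ} (hx : x ∈ A)
    (h : Nat.card (cent A x) = 2 * m) : x ^ m ∈ pm := by
  have hx1 : x ∈ cent A x := mem_cent.2 ⟨hx, rfl⟩
  have := pow_card_eq_one' (G := cent A x) (x := ⟨x, hx1⟩)
  have h2 := congrArg Subtype.val this
  simp only [SubmonoidClass.mk_pow, OneMemClass.coe_one, h] at h2
  rw [mul_comm, pow_mul] at h2
  exact sq_eq_one_iff.1 h2

theorem finite_cent {A : Subgroup UnitQuat} [Finite A] (x : UnitQuat) : Finite (cent A x) :=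
  Finite.of_injective _ (Subgroup.inclusion_injective (cent_le A x))

/-- The classification of the exceptional finite groups of unit quaternions. -/
theorem Exc.classify {A : Subgroup UnitQuat} (hA : Exc A) :
    -1 ∈ A ∧ ∃ n, ∃ m : {x // x ∈ A ∧ x ∉ pm} → ℕ, Nat.card A = 2 * n ∧ ExcData n m ∧
      ∀ x : {x // x ∈ A ∧ x ∉ pm}, Nat.card (cent A x.1) = 2 * m x := by
  have : Finite A := hA.1
  obtain ⟨k, s, hs1, hs2, hsum⟩ := exists_orbit_data hA
  set e := Nat.card (A ⊓ pm : Subgroup UnitQuat) with he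
  have he0 : 0 < e := by rcases card_pm_inf A with h | h <;> omega
  have he0' : (0 : ℚ) < e := by exact_mod_cast he0
  have hnc : ¬ CommOn A := fun hc => by have := hA.2 A le_rfl hc; omega
  obtain ⟨n, hn⟩ : e ∣ Nat.card A := Subgroup.card_dvd_of_le inf_le_left
  have hpos : 0 < Nat.card A := Nat.card_pos
  have hn2 : 2 ≤ n := by
    by_contra! hcon
    have : A ⊓ pm = A := by
      apply Subgroup.eq_of_le_of_card_ge inf_le_left
      have : n = 0 ∨ n = 1 := by omega
      rcases this with rfl | rfl
      · omega
      · omega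
    apply hnc
    intro x hx y _
    rw [← this] at hx
    exact pm_comm hx.2 y
  -- The centralizer of x contains the central elements of A and also the noncentral x, so m ≥ 2. It
  -- is commutative, so exceptionality makes its order less than half of that of A.
  have hmex : ∀ i, ∃ m, s i = e * m ∧ 2 ≤ m ∧ 2 * m < n := by
    intro i
    obtain ⟨x, hx, hx', hxs⟩ := hs2 i
    have := finite_cent (A := A) x
    have hle : A ⊓ pm ≤ cent A x := fun y hy => mem_cent.2 ⟨hy.1, pm_comm hy.2 x⟩
    obtain ⟨m, hm⟩ : e ∣ Nat.card (cent A x) := Subgroup.card_dvd_of_le hle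
    have hlt := hA.2 _ (cent_le A x) (cent_comm A hx')
    have hcpos : 0 < Nat.card (cent A x) := Nat.card_pos
    refine ⟨m, by rw [← hxs, hm], ?_, ?_⟩
    · by_contra! hcon
      have : A ⊓ pm = cent A x := by
        apply Subgroup.eq_of_le_of_card_ge hle
        have : m = 0 ∨ m = 1 := by omega
        rcases this with rfl | rfl <;> omega
      apply hx'
      have hx2 : x ∈ cent A x := mem_cent.2 ⟨hx, rfl⟩
      rw [← this] at hx2
      exact hx2.2
    · rw [hm, hn] at hlt
      nlinarith
  choose m hm using hmex
  have hdata : ExcData n m := by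
    apply platonic hn2 (fun i => (hm i).2.1) (fun i => (hm i).2.2)
    have hn0 : (n : ℚ) ≠ 0 := by exact_mod_cast (by omega : n ≠ 0)
    rw [hn] at hsum
    have : ∀ i, (1 - (1 : ℚ) / m i) = 1 - (e : ℚ) / s i := by
      intro i
      rw [(hm i).1]
      have : (m i : ℚ) ≠ 0 := by exact_mod_cast (by linarith [(hm i).2.1] : m i ≠ 0)
      push_cast
      field_simp
    simp only [this]
    rw [hsum]
    push_cast
    field_simp
  -- 12, 24 and 60 are even, so Cauchy's theorem provides an involution in A. The only involution
  -- among unit quaternions is -1; hence -1 ∈ A and e = 2.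
  have heven : 2 ∣ n := by rcases hdata with h | h | h <;> omega
  have hneg : (-1 : UnitQuat) ∈ A := by
    obtain ⟨x, hx⟩ := exists_prime_orderOf_dvd_card' (G := A) 2 (by rw [hn]; exact heven.mul_left e)
    have h1 : (x : UnitQuat) ^ 2 = 1 := by
      rw [← hx]; exact_mod_cast congrArg Subtype.val (pow_orderOf_eq_one x)
    rcases sq_eq_one_iff.1 h1 with h2 | h2
    · have : x = 1 := Subtype.ext h2
      rw [this] at hx; simp at hx
    · rw [← h2]; exact x.2
  have he2 : e = 2 := by
    rcases card_pm_inf A with h | h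
    · exact absurd hneg h.2
    · exact h.1
  refine ⟨hneg, n, ?_⟩
  choose f hf using hs1
  refine ⟨fun x => m (f x.1 x.2.1 x.2.2), by rw [hn, he2], ?_, fun x => ?_⟩
  · have hex : ∀ c, (∃ i, m i = c) → ∃ x : {x // x ∈ A ∧ x ∉ pm}, m (f x.1 x.2.1 x.2.2) = c := by
      rintro c ⟨i, rfl⟩
      obtain ⟨x, hx, hx', hxs⟩ := hs2 i
      refine ⟨⟨x, hx, hx'⟩, ?_⟩
      have := hf x hx hx'
      rw [hxs, (hm _).1, (hm _).1] at this
      exact (Nat.eq_of_mul_eq_mul_left he0 this).symm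
    rcases hdata with h | h | h
    · exact Or.inl ⟨h.1, fun i => h.2.1 _, hex _ h.2.2⟩
    · exact Or.inr (Or.inl ⟨h.1, fun i => h.2.1 _, hex _ h.2.2⟩)
    · exact Or.inr (Or.inr ⟨h.1, fun i => h.2.1 _, hex _ h.2.2⟩)
  · rw [hf x.1 x.2.1 x.2.2, (hm _).1, he2]

end UnitQuat

/-! ### Traces in exceptional groups, generating pairs and normal subgroups. -/

namespace UnitQuat

theorem re_pow_two (x : UnitQuat) : re (x ^ 2) = 2 * re x ^ 2 - 1 := sq_coords x

theorem re_pow_succ_succ (x : UnitQuat) (n : ℕ) :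
    re (x ^ (n + 2)) = 2 * re x * re (x ^ (n + 1)) - re (x ^ n) := by
  have := re_mul_add_re_mul_inv (x ^ (n + 1)) x
  rw [show x ^ (n + 1) * x = x ^ (n + 2) by group, show x ^ (n + 1) * x⁻¹ = x ^ n by group] at this
  linarith

theorem re_pow_three (x : UnitQuat) : re (x ^ 3) = 4 * re x ^ 3 - 3 * re x := by
  rw [re_pow_succ_succ, re_pow_two, pow_one]; ring

theorem re_pow_four (x : UnitQuat) : re (x ^ 4) = 8 * re x ^ 4 - 8 * re x ^ 2 + 1 := by
  rw [re_pow_succ_succ, re_pow_two, re_pow_three]; ring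

theorem re_pow_five (x : UnitQuat) : re (x ^ 5) = 16 * re x ^ 5 - 20 * re x ^ 3 + 5 * re x := by
  rw [re_pow_succ_succ, re_pow_three, re_pow_four]; ring

/-- With c = re x, the real part of xⁿ is the Chebyshev polynomial Tₙ(c), and Tₙ² - 1 = (c² - 1)
Uₙ₋₁². So if xⁿ but not x is central, c is a root of Uₙ₋₁. The same factorization serves n = 3, 4, 5
below. -/
theorem re_of_pow_two_mem {x : UnitQuat} (h : x ^ 2 ∈ pm) (hx : x ∉ pm) : re x = 0 := by
  rw [mem_pm_iff_re] at *
  rw [re_pow_two] at h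
  have : re x ^ 2 * (re x ^ 2 - 1) = 0 := by linear_combination h / 4
  rcases mul_eq_zero.1 this with h | h
  · exact pow_eq_zero_iff (two_ne_zero) |>.1 h
  · exact absurd (by linarith) hx

theorem re_of_pow_three_mem {x : UnitQuat} (h : x ^ 3 ∈ pm) (hx : x ∉ pm) :
    4 * re x ^ 2 = 1 := by
  rw [mem_pm_iff_re] at *
  rw [re_pow_three] at h
  have : (4 * re x ^ 2 - 1) ^ 2 * (re x ^ 2 - 1) = 0 := by linear_combination h
  rcases mul_eq_zero.1 this with h | h
  · have := pow_eq_zero_iff (two_ne_zero) |>.1 h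
    linarith
  · exact absurd (by linarith) hx

theorem re_of_pow_four_mem {x : UnitQuat} (h : x ^ 4 ∈ pm) (hx : x ∉ pm) :
    re x = 0 ∨ 2 * re x ^ 2 = 1 := by
  rw [mem_pm_iff_re] at *
  rw [re_pow_four] at h
  have : ((2 * re x ^ 2 - 1) * re x) ^ 2 * (re x ^ 2 - 1) = 0 := by linear_combination h / 16
  rcases mul_eq_zero.1 this with h | h
  · rcases mul_eq_zero.1 (pow_eq_zero_iff (two_ne_zero) |>.1 h) with h | h
    · right; linarith
    · left; exact h
  · exact absurd (by linarith) hx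

theorem re_of_pow_five_mem {x : UnitQuat} (h : x ^ 5 ∈ pm) (hx : x ∉ pm) :
    16 * re x ^ 4 - 12 * re x ^ 2 + 1 = 0 := by
  rw [mem_pm_iff_re] at *
  rw [re_pow_five] at h
  have : (16 * re x ^ 4 - 12 * re x ^ 2 + 1) ^ 2 * (re x ^ 2 - 1) = 0 := by linear_combination h
  rcases mul_eq_zero.1 this with h | h
  · exact pow_eq_zero_iff (two_ne_zero) |>.1 h
  · exact absurd (by linarith) hx

theorem Exc.not_commOn {A : Subgroup UnitQuat} (hA : Exc A) : ¬ CommOn A := fun hc => by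
  have := hA.2 A le_rfl hc; omega

theorem Exc.neg_one_mem {A : Subgroup UnitQuat} (hA : Exc A) : -1 ∈ A := hA.classify.1

theorem Exc.card_cases {A : Subgroup UnitQuat} (hA : Exc A) :
    (Nat.card A = 24 ∧ (∀ x ∈ A, x ∉ pm → Nat.card (cent A x) = 4 ∨ Nat.card (cent A x) = 6) ∧
      ∃ x ∈ A, x ∉ pm ∧ Nat.card (cent A x) = 6) ∨
    (Nat.card A = 48 ∧ (∀ x ∈ A, x ∉ pm → Nat.card (cent A x) = 4 ∨ Nat.card (cent A x) = 6 ∨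
      Nat.card (cent A x) = 8) ∧ ∃ x ∈ A, x ∉ pm ∧ Nat.card (cent A x) = 8) ∨
    (Nat.card A = 120 ∧ (∀ x ∈ A, x ∉ pm → Nat.card (cent A x) = 4 ∨ Nat.card (cent A x) = 6 ∨
      Nat.card (cent A x) = 10) ∧ ∃ x ∈ A, x ∉ pm ∧ Nat.card (cent A x) = 10) := by
  obtain ⟨-, n, m, hn, hd, hm⟩ := hA.classify
  rcases hd with ⟨h1, h2, ⟨x, hx, hx'⟩, h3⟩ | ⟨h1, h2, ⟨x, hx, hx'⟩, h3⟩ |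
    ⟨h1, h2, ⟨x, hx, hx'⟩, h3⟩
  · refine Or.inl ⟨by omega, fun y hy hy' => ?_, x, hx, hx', by rw [hm ⟨x, hx, hx'⟩, h3]⟩
    have : Nat.card (cent A y) = 2 * m ⟨y, hy, hy'⟩ := hm ⟨y, hy, hy'⟩
    have := h2 ⟨y, hy, hy'⟩
    omega
  · refine Or.inr (Or.inl ⟨by omega, fun y hy hy' => ?_, x, hx, hx', by rw [hm ⟨x, hx, hx'⟩, h3]⟩)
    have : Nat.card (cent A y) = 2 * m ⟨y, hy, hy'⟩ := hm ⟨y, hy, hy'⟩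
    have := h2 ⟨y, hy, hy'⟩
    omega
  · refine Or.inr (Or.inr ⟨by omega, fun y hy hy' => ?_, x, hx, hx', by rw [hm ⟨x, hx, hx'⟩, h3]⟩)
    have : Nat.card (cent A y) = 2 * m ⟨y, hy, hy'⟩ := hm ⟨y, hy, hy'⟩
    have := h2 ⟨y, hy, hy'⟩
    omega

theorem Exc.card {A : Subgroup UnitQuat} (hA : Exc A) :
    Nat.card A = 24 ∨ Nat.card A = 48 ∨ Nat.card A = 120 := by
  rcases hA.card_cases with h | h | h
  · exact Or.inl h.1
  · exact Or.inr (Or.inl h.1)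
  · exact Or.inr (Or.inr h.1)

/-- The elements of order 3, 4, 5 modulo the center, in groups of order 24, 48, 120. -/
def Prim (n : ℕ) (x : UnitQuat) : Prop :=
  (n = 24 ∧ x ^ 3 ∈ pm ∧ x ∉ pm) ∨ (n = 48 ∧ x ^ 4 ∈ pm ∧ x ^ 2 ∉ pm) ∨
    (n = 120 ∧ x ^ 5 ∈ pm ∧ x ∉ pm)

theorem Prim.notMem_pm {n : ℕ} {x : UnitQuat} (h : Prim n x) : x ∉ pm := by
  rcases h with h | h | h
  · exact h.2.2
  · exact fun hx => h.2.2 (pm.pow_mem hx 2)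
  · exact h.2.2

theorem Exc.pow_mem {A : Subgroup UnitQuat} (hA : Exc A) {x : UnitQuat} (hx : x ∈ A) :
    x ^ 2 ∈ pm ∨ x ^ 3 ∈ pm ∨ (Nat.card A = 48 ∧ x ^ 4 ∈ pm) ∨ (Nat.card A = 120 ∧ x ^ 5 ∈ pm) := by
  have := hA.1
  by_cases hx' : x ∈ pm
  · exact Or.inl (pm.pow_mem hx' 2)
  rcases hA.card_cases with ⟨h1, h, -⟩ | ⟨h1, h, -⟩ | ⟨h1, h, -⟩
  · rcases h x hx hx' with h | h
    · exact Or.inl (pow_mem_pm_of_card hx (m := 2) h)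
    · exact Or.inr (Or.inl (pow_mem_pm_of_card hx (m := 3) h))
  · rcases h x hx hx' with h | h | h
    · exact Or.inl (pow_mem_pm_of_card hx (m := 2) h)
    · exact Or.inr (Or.inl (pow_mem_pm_of_card hx (m := 3) h))
    · exact Or.inr (Or.inr (Or.inl ⟨h1, pow_mem_pm_of_card hx (m := 4) h⟩))
  · rcases h x hx hx' with h | h | h
    · exact Or.inl (pow_mem_pm_of_card hx (m := 2) h)
    · exact Or.inr (Or.inl (pow_mem_pm_of_card hx (m := 3) h))
    · exact Or.inr (Or.inr (Or.inr ⟨h1, pow_mem_pm_of_card hx (m := 5) h⟩))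

theorem Exc.exists_prim {A : Subgroup UnitQuat} (hA : Exc A) : ∃ x ∈ A, Prim (Nat.card A) x := by
  have := hA.1
  rcases hA.card_cases with ⟨h1, -, x, hx, hx', h⟩ | ⟨h1, -, x, hx, hx', h⟩ |
    ⟨h1, -, x, hx, hx', h⟩
  · exact ⟨x, hx, Or.inl ⟨h1, pow_mem_pm_of_card hx (m := 3) h, hx'⟩⟩
  · have := finite_cent (A := A) x
    -- An element x with centralizer of order 8 may itself be a square of an element of order 8; a
    -- generator of the cyclic centralizer is taken instead.
    obtain ⟨z, hz⟩ := CommOn.exists_zpowers (cent_comm A hx')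
    have hzc : z ∈ cent A x := by rw [hz]; exact Subgroup.mem_zpowers z
    rw [hz, Nat.card_zpowers] at h
    refine ⟨z, cent_le A x hzc, Or.inr (Or.inl ⟨h1, ?_, ?_⟩)⟩
    · apply sq_eq_one_iff.1
      rw [← pow_mul, ← pow_orderOf_eq_one z, h]
    · intro h2
      have h3 := sq_eq_one_iff.2 h2
      rw [← pow_mul] at h3
      have := orderOf_le_of_pow_eq_one (by norm_num) h3
      omega
  · exact ⟨x, hx, Or.inr (Or.inr ⟨h1, pow_mem_pm_of_card hx (m := 5) h, hx'⟩)⟩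

theorem Prim.re_ne_zero {n : ℕ} {x : UnitQuat} (h : Prim n x) : re x ≠ 0 := by
  intro h0
  rcases h with ⟨-, h1, h2⟩ | ⟨-, -, h2⟩ | ⟨-, h1, h2⟩
  · have := re_of_pow_three_mem h1 h2
    rw [h0] at this; norm_num at this
  · rw [sq_eq_neg_one_iff.2 h0] at h2
    exact h2 neg_one_mem_pm
  · have := re_of_pow_five_mem h1 h2
    rw [h0] at this; norm_num at this

theorem golden_cases {v : ℝ} (h : 16 * v ^ 4 - 12 * v ^ 2 + 1 = 0) :
    4 * v = 1 + √5 ∨ 4 * v = 1 - √5 ∨ 4 * v = -1 + √5 ∨ 4 * v = -1 - √5 := by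
  have h5 : √5 ^ 2 = 5 := Real.sq_sqrt (by norm_num)
  have : (4 * v - 1 - √5) * (4 * v - 1 + √5) * ((4 * v + 1 - √5) * (4 * v + 1 + √5)) = 0 := by
    have e1 : (4 * v - 1 - √5) * (4 * v - 1 + √5) = 16 * v ^ 2 - 8 * v - 4 := by
      linear_combination -h5
    have e2 : (4 * v + 1 - √5) * (4 * v + 1 + √5) = 16 * v ^ 2 + 8 * v - 4 := by
      linear_combination -h5
    rw [e1, e2]; linear_combination 16 * h
  rcases mul_eq_zero.1 this with h | h <;> rcases mul_eq_zero.1 h with h | h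
  · left; linarith
  · right; left; linarith
  · right; right; left; linarith
  · right; right; right; linarith

/-- The trace of the product of two suitably chosen elements. -/
noncomputable def pairRe (n : ℕ) : ℝ := if n = 24 then 0 else 1 / 2

/-- The order modulo the center of the product of two suitably chosen elements. -/
def pairExp (n : ℕ) : ℕ := if n = 24 then 2 else 3

theorem pow_pairExp_mem {n : ℕ} {x : UnitQuat} (h : re x = pairRe n) : x ^ pairExp n ∈ pm := by
  rw [pairRe] at h
  rw [pairExp]
  split_ifs at * with hn
  · rw [sq_eq_neg_one_iff.2 h]; exact neg_one_mem_pm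
  · rw [mem_pm_iff_re, re_pow_three, h]; norm_num

/-- With c the common trace, re (xy) + re (xy⁻¹) = 2c², and both summands belong to the short list
of traces of noncentral elements of A. For order 24 this forces {0, 1/2}; for order 48 it forces 1/2
twice; for order 120, where 2c² = (3 ± √5)/4, one of the two is 1/2. So up to replacing y by y⁻¹ the
trace of xy is prescribed. -/
theorem Exc.pair {A : Subgroup UnitQuat} (hA : Exc A) {x y : UnitQuat} (hx : x ∈ A) (hy : y ∈ A)
    (hp : Prim (Nat.card A) x) (hre : re y = re x) (hxy : x * y ≠ y * x) :
    (re (x * y) = pairRe (Nat.card A) ∨ re (x * y⁻¹) = pairRe (Nat.card A)) ∧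
      ((x * y) ^ pairExp (Nat.card A) ∈ pm → re (x * y) = pairRe (Nat.card A)) ∧
      (Nat.card A = 24 → re (x * y) ≠ 0 → re (x * y) = 1 / 2) := by
  have hsum := re_mul_add_re_mul_inv x y
  rw [hre] at hsum
  have h1 : x * y ∉ pm := by
    intro h
    have := pm_comm h y
    exact hxy (mul_right_cancel (by rw [this]; group))
  have h2 : x * y⁻¹ ∉ pm := by
    intro h
    have := pm_comm h y
    apply hxy
    rw [inv_mul_cancel_right] at this
    nth_rewrite 1 [this]; group
  have p1 := hA.pow_mem (A.mul_mem hx hy)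
  have p2 := hA.pow_mem (A.mul_mem hx (A.inv_mem hy))
  have q2 := fun h => re_of_pow_two_mem h h1
  have q3 := fun h => re_of_pow_three_mem h h1
  generalize re (x * y⁻¹) = w at *
  have half : ∀ {t : ℝ}, 4 * t ^ 2 = 1 → t = 1 / 2 ∨ t = -1 / 2 := by
    intro t ht
    have : (t - 1 / 2) * (t + 1 / 2) = 0 := by linarith
    rcases mul_eq_zero.1 this with h | h
    · left; linarith
    · right; linarith
  rcases hp with ⟨hn, hx3, hx0⟩ | ⟨hn, hx3, hx0⟩ | ⟨hn, hx3, hx0⟩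
  · have hc := re_of_pow_three_mem hx3 hx0
    simp only [hn, pairRe, pairExp, if_true]
    have r1 : re (x * y) = 0 ∨ re (x * y) = 1 / 2 ∨ re (x * y) = -1 / 2 := by
      rcases p1 with h | h | h | h
      · exact Or.inl (q2 h)
      · exact Or.inr (half (q3 h))
      · omega
      · omega
    have r2 : re (x * y) + w = 1 / 2 := by linarith
    have r3 : re (x * y⁻¹) = 0 ∨ re (x * y⁻¹) = 1 / 2 ∨ re (x * y⁻¹) = -1 / 2 := by
      rcases p2 with h | h | h | h
      · exact Or.inl (re_of_pow_two_mem h h2)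
      · exact Or.inr (half (re_of_pow_three_mem h h2))
      · omega
      · omega
    have hw : re (x * y⁻¹) = w := by
      have := re_mul_add_re_mul_inv x y
      rw [hre] at this; linarith
    rw [hw] at r3
    refine ⟨?_, q2, fun _ h0 => ?_⟩
    · rcases r1 with h | h | h <;> rcases r3 with h' | h' | h' <;>
        first | (left; linarith) | (right; linarith)
    · rcases r1 with h | h | h <;> rcases r3 with h' | h' | h' <;>
        first | linarith | exact absurd h h0
  · have hc : 2 * re x ^ 2 = 1 := by
      rcases re_of_pow_four_mem hx3 (fun h => hx0 (pm.pow_mem h 2)) with h | h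
      · exact absurd (by rw [sq_eq_neg_one_iff.2 h]; exact neg_one_mem_pm) hx0
      · exact h
    simp only [hn, pairRe, pairExp, show (48 : ℕ) ≠ 24 by norm_num, if_false]
    have r1 : re (x * y) = 0 ∨ 4 * re (x * y) ^ 2 = 1 ∨ 2 * re (x * y) ^ 2 = 1 := by
      rcases p1 with h | h | h | h
      · exact Or.inl (q2 h)
      · exact Or.inr (Or.inl (q3 h))
      · rcases re_of_pow_four_mem h.2 h1 with h | h
        · exact Or.inl h
        · exact Or.inr (Or.inr h)
      · omega
    have r2 : re (x * y) + w = 1 := by linarith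
    have hw : re (x * y⁻¹) = w := by
      have := re_mul_add_re_mul_inv x y
      rw [hre] at this; linarith
    have r3 : w = 0 ∨ 4 * w ^ 2 = 1 ∨ 2 * w ^ 2 = 1 := by
      rw [← hw]
      rcases p2 with h | h | h | h
      · exact Or.inl (re_of_pow_two_mem h h2)
      · exact Or.inr (Or.inl (re_of_pow_three_mem h h2))
      · rcases re_of_pow_four_mem h.2 h2 with h | h
        · exact Or.inl h
        · exact Or.inr (Or.inr h)
      · omega
    have key : re (x * y) = 1 / 2 := by
      have e : w = 1 - re (x * y) := by linarith
      subst e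
      rcases r1 with h | h | h
      · rw [h] at r3; norm_num at r3
      · rcases half h with h | h
        · exact h
        · rw [h] at r3; norm_num at r3
      · rcases r3 with h' | h' | h' <;> nlinarith
    exact ⟨Or.inl key, fun _ => key, fun h => absurd h (by norm_num)⟩
  · have hc := re_of_pow_five_mem hx3 hx0
    simp only [hn, pairRe, pairExp, show (120 : ℕ) ≠ 24 by norm_num, if_false]
    have hg : ∀ {z : UnitQuat}, z ∈ A → z ∉ pm → re z = 0 ∨ re z = 1 / 2 ∨ re z = -1 / 2 ∨
        4 * re z = 1 + √5 ∨ 4 * re z = 1 - √5 ∨ 4 * re z = -1 + √5 ∨ 4 * re z = -1 - √5 := by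
      intro z hz hz'
      rcases hA.pow_mem hz with h | h | h | h
      · exact Or.inl (re_of_pow_two_mem h hz')
      · rcases half (re_of_pow_three_mem h hz') with h | h
        · exact Or.inr (Or.inl h)
        · exact Or.inr (Or.inr (Or.inl h))
      · omega
      · exact Or.inr (Or.inr (Or.inr (golden_cases (re_of_pow_five_mem h.2 hz'))))
    have r1 := hg (A.mul_mem hx hy) h1
    have r3 := hg (A.mul_mem hx (A.inv_mem hy)) h2
    have hw : re (x * y⁻¹) = w := by
      have := re_mul_add_re_mul_inv x y
      rw [hre] at this; linarith
    rw [hw] at r3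
    -- These two bounds on √5 are sharp enough for linear arithmetic to reject every incompatible
    -- combination of traces.
    have s1 : √5 < 2.24 := by rw [Real.sqrt_lt' (by norm_num)]; norm_num
    have s2 : 2.23 < √5 := by apply Real.lt_sqrt_of_sq_lt; norm_num
    have h5 : √5 ^ 2 = 5 := Real.sq_sqrt (by norm_num)
    have hs : 4 * (re (x * y) + w) = 3 + √5 ∨ 4 * (re (x * y) + w) = 3 - √5 := by
      have hc2 : (4 * (re (x * y) + w) - 3 - √5) * (4 * (re (x * y) + w) - 3 + √5) = 0 := by
        have : (4 * (re (x * y) + w) - 3 - √5) * (4 * (re (x * y) + w) - 3 + √5) =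
          16 * (re (x * y) + w) ^ 2 - 24 * (re (x * y) + w) + 4 := by linear_combination -h5
        rw [this, hsum]; linear_combination 4 * hc
      rcases mul_eq_zero.1 hc2 with h | h
      · left; linarith
      · right; linarith
    refine ⟨?_, ?_, fun h => absurd h (by norm_num)⟩
    · rcases hs with hs | hs <;> rcases r1 with h | h | h | h | h | h | h <;>
        rcases r3 with h' | h' | h' | h' | h' | h' | h' <;>
        first | (exfalso; linarith) | (left; linarith) | (right; linarith)
    · intro h3
      rcases half (q3 h3) with h | h
      · exact h
      · exfalso
        rcases hs with hs | hs <;> rcases r3 with h' | h' | h' | h' | h' | h' | h' <;> linarith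

/-- The generated group K is noncommutative. It is not dihedral, because x and y have nonzero trace
and would both lie in the cyclic part. So K is exceptional and its order divides that of A; the
remaining proper case, order 24, has no element of order 4 or 5 modulo the center. -/
theorem Exc.closure_pair {A : Subgroup UnitQuat} (hA : Exc A) {x y : UnitQuat} (hx : x ∈ A)
    (hy : y ∈ A) (hp : Prim (Nat.card A) x) (hre : re y = re x) (hxy : x * y ≠ y * x) :
    Subgroup.closure {x, y} = A := by
  have := hA.1
  have hle : Subgroup.closure {x, y} ≤ A := by
    rw [Subgroup.closure_le]; rintro z (rfl | rfl) <;> assumption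
  have hxK : x ∈ Subgroup.closure {x, y} := Subgroup.subset_closure (by simp)
  have hyK : y ∈ Subgroup.closure {x, y} := Subgroup.subset_closure (by simp)
  generalize Subgroup.closure {x, y} = K at *
  have : Finite K := Finite.of_injective _ (Subgroup.inclusion_injective hle)
  have hK : Exc K := by
    rcases commOn_or_dih_or_exc K with h | ⟨L, h⟩ | h
    · exact absurd (h x hxK y hyK) hxy
    · exfalso
      have hxL : x ∈ L := by
        by_contra hc
        exact hp.re_ne_zero (h.re_eq_zero hxK hc)
      have hyL : y ∈ L := by
        by_contra hc
        exact hp.re_ne_zero (hre ▸ h.re_eq_zero hyK hc)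
      exact hxy (h.comm x hxL y hyL)
    · exact h
  apply Subgroup.eq_of_le_of_card_ge hle
  have hdvd := Subgroup.card_dvd_of_le hle
  have hKA := Nat.le_of_dvd Nat.card_pos hdvd
  have hpow := hK.pow_mem hxK
  have h1 : x ^ 3 ∈ pm → x ^ 4 ∈ pm → x ∈ pm := by
    intro h h'
    have := pm.mul_mem (pm.inv_mem h) h'
    rwa [show (x ^ 3)⁻¹ * x ^ 4 = x by group] at this
  have h2 : x ^ 3 ∈ pm → x ^ 5 ∈ pm → x ∈ pm := by
    intro h h'
    have := pm.mul_mem (pm.pow_mem h 2) (pm.inv_mem h')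
    rwa [show (x ^ 3) ^ 2 * (x ^ 5)⁻¹ = x by group] at this
  have h3 : x ^ 2 ∈ pm → x ^ 5 ∈ pm → x ∈ pm := by
    intro h h'
    have := pm.mul_mem (pm.inv_mem (pm.pow_mem h 2)) h'
    rwa [show ((x ^ 2) ^ 2)⁻¹ * x ^ 5 = x by group] at this
  rcases hK.card with hk | hk | hk <;> rcases hp with ⟨hn, hp1, hp2⟩ | ⟨hn, hp1, hp2⟩ | ⟨hn, hp1, hp2⟩
    <;> rw [hk, hn] at hdvd <;> try omega
  · exfalso
    rcases hpow with h | h | h | h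
    · exact hp2 h
    · exact hp2 (pm.pow_mem (h1 h hp1) 2)
    · omega
    · omega
  · exfalso
    rcases hpow with h | h | h | h
    · exact hp2 (h3 h hp1)
    · exact hp2 (h2 h hp1)
    · omega
    · omega

/-- Otherwise the centralizer of p in A has index at most two, and it is commutative, which
contradicts exceptionality. -/
theorem Exc.not_normalizes {A : Subgroup UnitQuat} (hA : Exc A) {p : UnitQuat} (hp : p ∉ pm)
    (h : ∀ a ∈ A, a * p * a⁻¹ = p ∨ a * p * a⁻¹ = p⁻¹) : False := by
  have := hA.1
  have hm : ∀ a ∈ A, ∀ b ∈ A, a ∉ cent A p → b ∉ cent A p → a * b ∈ cent A p := by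
    intro a ha b hb ha' hb'
    have key : ∀ {a}, a ∈ A → a ∉ cent A p → a * p * a⁻¹ = p⁻¹ := by
      intro a ha ha'
      rcases h a ha with h | h
      · exact absurd (mem_cent.2 ⟨ha, mul_inv_eq_iff_eq_mul.1 h⟩) ha'
      · exact h
    refine mem_cent.2 ⟨A.mul_mem ha hb, ?_⟩
    rw [← mul_inv_eq_iff_eq_mul]
    calc a * b * p * (a * b)⁻¹ = a * (b * p * b⁻¹) * a⁻¹ := by group
      _ = (a * p * a⁻¹)⁻¹ := by rw [key hb hb']; group
      _ = p := by rw [key ha ha', inv_inv]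
  have hlt := hA.2 _ (cent_le A p) (cent_comm A hp)
  by_cases hc : ∃ w ∈ A, w ∉ cent A p
  · obtain ⟨w, hw, hw'⟩ := hc
    have := Subgroup.card_eq_two_mul (cent_le A p) hm hw hw'
    omega
  · push Not at hc
    exact hA.not_commOn ((cent_comm A hp).mono hc)

/-- Orbit and stabilizer: the A-conjugates of p lie in N, and each fibre of a ↦ a p a⁻¹ has at most
as many elements as the centralizer. -/
theorem card_le_cent_mul {A : Subgroup UnitQuat} [Finite A] {N : Set UnitQuat} (hN : N.Finite)
    {p : UnitQuat} (h : ∀ a ∈ A, a * p * a⁻¹ ∈ N) :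
    Nat.card A ≤ Nat.card (cent A p) * N.ncard := by
  classical
  have := finite_cent (A := A) p
  let : Fintype A := Fintype.ofFinite _
  let : Fintype N := hN.fintype
  have key := Finset.card_le_mul_card_image (f := fun a : A => (a : UnitQuat) * p * (a : UnitQuat)⁻¹)
    Finset.univ (Nat.card (cent A p)) (by
      intro b hb
      obtain ⟨a, -, rfl⟩ := Finset.mem_image.1 hb
      rw [← Fintype.card_subtype, ← Nat.card_eq_fintype_card]
      refine Nat.card_le_card_of_injective
        (fun x => (⟨(a : UnitQuat)⁻¹ * x.1, mem_cent.2 ⟨A.mul_mem (A.inv_mem a.2) x.1.2, ?_⟩⟩ :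
          cent A p)) ?_
      · have h2 : (x.1 : UnitQuat) * p * (x.1 : UnitQuat)⁻¹ = a * p * (a : UnitQuat)⁻¹ := x.2
        rw [mul_inv_eq_iff_eq_mul] at h2
        rw [mul_assoc, h2]; group
      · intro x y hxy
        have := congrArg Subtype.val hxy
        exact Subtype.ext (Subtype.ext (mul_left_cancel this)))
  rw [Finset.card_univ, ← Nat.card_eq_fintype_card] at key
  refine key.trans (Nat.mul_le_mul_left _ ?_)
  rw [← Set.ncard_coe_finset]
  apply Set.ncard_le_ncard _ hN
  intro b hb
  obtain ⟨a, -, rfl⟩ := Finset.mem_image.1 (Finset.mem_coe.1 hb)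
  exact h a a.2

/-- The normal subgroups of exceptional groups. -/
theorem Exc.normal_cases {A N : Subgroup UnitQuat} (hA : Exc A) (hNA : N ≤ A)
    (hn : ∀ a ∈ A, ∀ x ∈ N, a * x * a⁻¹ ∈ N) :
    N ≤ pm ∨ (Nat.card N = 8 ∧ Nat.card A ≠ 120) ∨
      (Exc N ∧ (N = A ∨ (Nat.card A = 48 ∧ Nat.card N = 24))) := by
  have := hA.1
  have : Finite N := Finite.of_injective _ (Subgroup.inclusion_injective hNA)
  have hNfin : (N : Set UnitQuat).Finite := Set.toFinite _
  have hncard : (N : Set UnitQuat).ncard = Nat.card N := rfl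
  rcases commOn_or_dih_or_exc N with h | ⟨L, h⟩ | h
  · left
    by_contra hc
    obtain ⟨p, hp, hp'⟩ := SetLike.not_le_iff_exists.1 hc
    refine hA.not_normalizes hp' fun a ha => ?_
    exact eq_or_inv_of_comm (h _ (hn a ha p hp) _ hp) (re_conj a p)
  · right; left
    -- Conjugates of an element of nonzero trace stay in L, as N has only trace 0 outside L; inside
    -- L they can only be z or z⁻¹, which is impossible in A. So a generator of L squares to -1 and
    -- N has order 8.
    have hL : ∀ z ∈ L, z ∉ pm → re z = 0 := by
      intro z hz hz'
      by_contra h0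
      refine hA.not_normalizes hz' fun a ha => ?_
      have h1 : a * z * a⁻¹ ∈ L := by
        by_contra hc
        have := h.re_eq_zero (hn a ha z (h.le hz)) hc
        rw [re_conj] at this
        exact h0 this
      exact eq_or_inv_of_comm (h.comm _ h1 _ hz) (re_conj a z)
    have : Finite L := Finite.of_injective _ (Subgroup.inclusion_injective h.le)
    have hcard : Nat.card N = 8 := by
      rw [h.card]
      obtain ⟨z, hz⟩ := CommOn.exists_zpowers h.comm
      have hzL : z ∈ L := by rw [hz]; exact Subgroup.mem_zpowers z
      have hzp : z ∉ pm := by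
        intro hc
        apply h.not_le_pm
        rw [hz, Subgroup.zpowers_le]; exact hc
      have h2 := sq_eq_neg_one_iff.2 (hL z hzL hzp)
      have : orderOf z = 2 ^ (1 + 1) := by
        apply orderOf_eq_prime_pow
        · rw [pow_one, h2]; exact neg_one_ne_one
        · rw [show 2 ^ (1 + 1) = 2 * 2 by norm_num, pow_mul, h2]; simp
      rw [hz, Nat.card_zpowers, this]
      norm_num
    refine ⟨hcard, fun h120 => ?_⟩
    obtain ⟨p, hp, hp'⟩ := SetLike.not_le_iff_exists.1 h.not_le_pm
    -- For A of order 120 the centralizers have order at most 10, so the class of p has at least 12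
    -- elements, too many for N.
    have h1 := card_le_cent_mul hNfin (fun a ha => hn a ha p (h.le hp))
    rw [hncard, hcard] at h1
    rcases hA.card_cases with ⟨h2, h3, -⟩ | ⟨h2, h3, -⟩ | ⟨h2, h3, -⟩
    · omega
    · omega
    · have := h3 p (hNA (h.le hp)) hp'
      omega
  · right; right
    refine ⟨h, ?_⟩
    have hdvd := Subgroup.card_dvd_of_le hNA
    have heq : Nat.card N = Nat.card A → N = A :=
      fun he => Subgroup.eq_of_le_of_card_ge hNA he.ge
    have hle := Nat.le_of_dvd Nat.card_pos hdvd
    rcases h.card with h1 | h1 | h1 <;> rcases hA.card with h2 | h2 | h2 <;>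
      first
      | exact Or.inl (heq (by omega))
      | exact Or.inr ⟨h2, h1⟩
      | (exfalso; rw [h1, h2] at hdvd; omega)
      | skip
    -- What is left is N of order 24 in A of order 120. An element p of order 3 modulo the center
    -- has a centralizer of order 6 in A, so p and -p have 20 conjugates each. Their traces differ,
    -- and N would contain 40 elements.
    exfalso
    rcases h.card_cases with ⟨-, -, p, hp, hp', hp6⟩ | ⟨h3, -⟩ | ⟨h3, -⟩ <;> try omega
    have hp3 := pow_mem_pm_of_card hp (m := 3) hp6
    have hre := re_of_pow_three_mem hp3 hp'
    have hre0 : re p ≠ 0 := by intro h0; rw [h0] at hre; norm_num at hre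
    have hdc : 6 ∣ Nat.card (cent A p) := by
      rw [← hp6]
      exact Subgroup.card_dvd_of_le fun y hy => mem_cent.2 ⟨hNA (mem_cent.1 hy).1, (mem_cent.1 hy).2⟩
    have hcA : Nat.card (cent A p) = 6 := by
      rcases hA.card_cases with ⟨h2, h3, -⟩ | ⟨h2, h3, -⟩ | ⟨h2, h3, -⟩
      · omega
      · omega
      · have := h3 p (hNA hp) hp'
        omega
    have hS : ∀ c : ℝ, ({v | v ∈ N ∧ re v = c} : Set UnitQuat).Finite :=
      fun c => hNfin.subset fun v hv => hv.1
    have k1 := card_le_cent_mul (hS (re p)) (p := p) (A := A)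
      (fun a ha => ⟨hn a ha p hp, re_conj a p⟩)
    have k2 := card_le_cent_mul (hS (re (-p))) (p := -p) (A := A)
      (fun a ha => ⟨hn a ha (-p) (by
        have := N.mul_mem h.neg_one_mem hp
        rwa [neg_one_mul] at this), re_conj a (-p)⟩)
    have hcn : cent A (-p) = cent A p := by
      ext y; rw [mem_cent, mem_cent]; simp
    rw [hcn, hcA] at k2
    rw [hcA] at k1
    have hdis : Disjoint ({v | v ∈ N ∧ re v = re p} : Set UnitQuat)
        {v | v ∈ N ∧ re v = re (-p)} := by
      rw [Set.disjoint_left]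
      rintro v ⟨-, hv⟩ ⟨-, hv'⟩
      rw [hv, re_neg] at hv'
      exact hre0 (by linarith)
    have hun := Set.ncard_union_eq hdis (hS _) (hS _)
    have hsub : ({v | v ∈ N ∧ re v = re p} ∪ {v | v ∈ N ∧ re v = re (-p)} : Set UnitQuat) ⊆ N := by
      rintro v (hv | hv) <;> exact hv.1
    have := Set.ncard_le_ncard hsub hNfin
    rw [hncard] at this
    omega

end UnitQuat

/-! ### Almost conjugacy as equality of traces; projections and kernels in the product. -/

theorem AlmostConjugate.symm {G : Type*} [Group G] {A B : Subgroup G} (h : AlmostConjugate A B) :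
    AlmostConjugate B A := by
  obtain ⟨h1, h2, φ, hφ⟩ := h
  refine ⟨h2, h1, φ.symm, fun b => ?_⟩
  obtain ⟨x, hx⟩ := hφ (φ.symm b)
  rw [Equiv.apply_symm_apply] at hx
  exact ⟨x⁻¹, by rw [← hx]; group⟩

theorem AlmostConjugate.card_eq {G : Type*} [Group G] {A B : Subgroup G}
    (h : AlmostConjugate A B) : Nat.card A = Nat.card B := by
  obtain ⟨-, -, φ, -⟩ := h
  exact Nat.card_congr φ

/-- Conjugation as a bijection between a subgroup and its conjugate. -/
def Subgroup.cjEquiv {G : Type*} [Group G] (g : G) (A : Subgroup G) : A ≃ A.cj g where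
  toFun a := ⟨g * a * g⁻¹, Subgroup.conj_mem_cj a.2⟩
  invFun b := ⟨g⁻¹ * b * g, Subgroup.mem_cj.1 b.2⟩
  left_inv a := Subtype.ext (by simp [mul_assoc])
  right_inv b := Subtype.ext (by simp [mul_assoc])

theorem AlmostConjugate.cj_right {G : Type*} [Group G] {A B : Subgroup G}
    (h : AlmostConjugate A B) (g : G) : AlmostConjugate A (B.cj g) := by
  obtain ⟨h1, h2, φ, hφ⟩ := h
  refine ⟨h1, inferInstance, φ.trans (Subgroup.cjEquiv g B), fun a => ?_⟩
  obtain ⟨x, hx⟩ := hφ a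
  refine ⟨g * x, ?_⟩
  change _ = g * (φ a : G) * g⁻¹
  rw [← hx]
  group

namespace UnitQuat

/-- Conjugacy classes of unit quaternions are the level sets of the real part, so the conjugating
elements can be forgotten. -/
theorem almostConjugate_iff {A B : Subgroup UnitQuat} : AlmostConjugate A B ↔
    Finite A ∧ Finite B ∧ ∃ φ : A ≃ B, ∀ a, re (φ a : UnitQuat) = re (a : UnitQuat) := by
  refine and_congr_right fun _ => and_congr_right fun _ => exists_congr fun φ =>
    forall_congr' fun a => ?_
  constructor
  · rintro ⟨x, hx⟩
    rw [← hx, re_conj]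
  · exact fun h => exists_conj h.symm

theorem almostConjugate_prod_iff {Γ Γ' : Subgroup (UnitQuat × UnitQuat)} :
    AlmostConjugate Γ Γ' ↔ Finite Γ ∧ Finite Γ' ∧ ∃ φ : Γ ≃ Γ', ∀ γ,
      re (φ γ).1.1 = re γ.1.1 ∧ re (φ γ).1.2 = re γ.1.2 := by
  refine and_congr_right fun _ => and_congr_right fun _ => exists_congr fun φ =>
    forall_congr' fun a => ?_
  constructor
  · rintro ⟨x, hx⟩
    rw [← hx]
    exact ⟨re_conj _ _, re_conj _ _⟩
  · rintro ⟨h1, h2⟩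
    obtain ⟨x, hx⟩ := exists_conj h1.symm
    obtain ⟨y, hy⟩ := exists_conj h2.symm
    exact ⟨(x, y), Prod.ext hx hy⟩

theorem almostConjugate_of_card {A B : Subgroup UnitQuat} [Finite A] [Finite B]
    (h : ∀ c : ℝ, Nat.card {a : A // re a.1 = c} = Nat.card {b : B // re b.1 = c}) :
    AlmostConjugate A B := by
  rw [almostConjugate_iff]
  refine ⟨inferInstance, inferInstance, Equiv.ofFiberEquiv (f := fun a : A => re a.1)
    (g := fun b : B => re b.1) (fun c => (Finite.card_eq.1 (h c)).some),
    fun a => Equiv.ofFiberEquiv_map (f := fun a : A => re a.1) (g := fun b : B => re b.1) _ a⟩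

/-- The first projection of a subgroup of the product. -/
noncomputable abbrev pr1 (Γ : Subgroup (UnitQuat × UnitQuat)) : Subgroup UnitQuat := Γ.map (MonoidHom.fst _ _)
/-- The second projection of a subgroup of the product. -/
noncomputable abbrev pr2 (Γ : Subgroup (UnitQuat × UnitQuat)) : Subgroup UnitQuat := Γ.map (MonoidHom.snd _ _)
/-- The intersection of a subgroup of the product with the first factor. -/
noncomputable abbrev k1 (Γ : Subgroup (UnitQuat × UnitQuat)) : Subgroup UnitQuat := Γ.comap (MonoidHom.inl _ _)
/-- The intersection of a subgroup of the product with the second factor. -/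
noncomputable abbrev k2 (Γ : Subgroup (UnitQuat × UnitQuat)) : Subgroup UnitQuat := Γ.comap (MonoidHom.inr _ _)
/-- The image of a subgroup of the product under exchanging the factors. -/
noncomputable abbrev swap (Γ : Subgroup (UnitQuat × UnitQuat)) : Subgroup (UnitQuat × UnitQuat) :=
  Γ.comap (MulEquiv.prodComm : UnitQuat × UnitQuat ≃* UnitQuat × UnitQuat).toMonoidHom

variable {Γ Γ' : Subgroup (UnitQuat × UnitQuat)} {a b : UnitQuat}

theorem mem_pr1 : a ∈ pr1 Γ ↔ ∃ b, (a, b) ∈ Γ := by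
  simp [Subgroup.mem_map]

theorem mem_pr2 : b ∈ pr2 Γ ↔ ∃ a, (a, b) ∈ Γ := by
  simp [Subgroup.mem_map]

theorem mem_k1 : a ∈ k1 Γ ↔ (a, 1) ∈ Γ := Iff.rfl
theorem mem_k2 : b ∈ k2 Γ ↔ (1, b) ∈ Γ := Iff.rfl
theorem mem_swap : (a, b) ∈ swap Γ ↔ (b, a) ∈ Γ := Iff.rfl

theorem pr1_swap (Γ : Subgroup (UnitQuat × UnitQuat)) : pr1 (swap Γ) = pr2 Γ := by
  ext x; rw [mem_pr1, mem_pr2]; rfl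

theorem pr2_swap (Γ : Subgroup (UnitQuat × UnitQuat)) : pr2 (swap Γ) = pr1 Γ := by
  ext x; rw [mem_pr1, mem_pr2]; rfl

theorem k1_swap (Γ : Subgroup (UnitQuat × UnitQuat)) : k1 (swap Γ) = k2 Γ := rfl
theorem k2_swap (Γ : Subgroup (UnitQuat × UnitQuat)) : k2 (swap Γ) = k1 Γ := rfl

/-- The elements of `Γ` and of its exchanged group. -/
def swapEquiv (Γ : Subgroup (UnitQuat × UnitQuat)) : Γ ≃ swap Γ where
  toFun γ := ⟨γ.1.swap, γ.2⟩
  invFun γ := ⟨γ.1.swap, γ.2⟩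
  left_inv _ := rfl
  right_inv _ := rfl

instance finite_swap [Finite Γ] : Finite (swap Γ) := Finite.of_equiv _ (swapEquiv Γ)

theorem almostConjugate_swap (h : AlmostConjugate Γ Γ') :
    AlmostConjugate (swap Γ) (swap Γ') := by
  rw [almostConjugate_prod_iff] at *
  obtain ⟨h1, h2, φ, hφ⟩ := h
  exact ⟨inferInstance, inferInstance, (swapEquiv Γ).symm.trans (φ.trans (swapEquiv Γ')),
    fun γ => ⟨(hφ ((swapEquiv Γ).symm γ)).2, (hφ ((swapEquiv Γ).symm γ)).1⟩⟩

theorem mem_cj_prod {g : UnitQuat × UnitQuat} : (a, b) ∈ Γ.cj g ↔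
    (g.1⁻¹ * a * g.1, g.2⁻¹ * b * g.2) ∈ Γ := Subgroup.mem_cj

theorem conj_mem_cj_prod {g h : UnitQuat} (hab : (a, b) ∈ Γ) :
    (g * a * g⁻¹, h * b * h⁻¹) ∈ Γ.cj (g, h) := by
  rw [mem_cj_prod]
  simpa [mul_assoc] using hab

theorem swap_cj (g : UnitQuat × UnitQuat) : (swap Γ).cj g = swap (Γ.cj g.swap) := by
  ext ⟨x, y⟩
  rw [mem_swap, mem_cj_prod, mem_cj_prod, mem_swap]; rfl

theorem conjugate_of_swap (h : ConjugateSubgroups (swap Γ) (swap Γ')) :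
    ConjugateSubgroups Γ Γ' := by
  obtain ⟨g, hg⟩ := h
  refine ⟨g.swap, ?_⟩
  change (swap Γ).cj g = _ at hg
  rw [swap_cj] at hg
  exact congrArg swap hg

theorem pr1_cj (g : UnitQuat × UnitQuat) : pr1 (Γ.cj g) = (pr1 Γ).cj g.1 := by
  ext x
  rw [mem_pr1, Subgroup.mem_cj, mem_pr1]
  constructor
  · rintro ⟨b, hb⟩
    exact ⟨_, mem_cj_prod.1 hb⟩
  · rintro ⟨b, hb⟩
    refine ⟨g.2 * b * g.2⁻¹, ?_⟩
    rw [mem_cj_prod]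
    simpa [mul_assoc] using hb

theorem pr2_cj (g : UnitQuat × UnitQuat) : pr2 (Γ.cj g) = (pr2 Γ).cj g.2 := by
  rw [← pr1_swap, ← pr1_swap]
  have := swap_cj (Γ := Γ) g.swap
  rw [Prod.swap_swap] at this
  rw [← this, pr1_cj]; rfl

theorem k1_cj (g : UnitQuat × UnitQuat) : k1 (Γ.cj g) = (k1 Γ).cj g.1 := by
  ext x
  rw [mem_k1, mem_cj_prod, Subgroup.mem_cj, mem_k1]
  simp

theorem k2_cj (g : UnitQuat × UnitQuat) : k2 (Γ.cj g) = (k2 Γ).cj g.2 := by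
  ext x
  rw [mem_k2, mem_cj_prod, Subgroup.mem_cj, mem_k2]
  simp

instance finite_k1 [Finite Γ] : Finite (k1 Γ) :=
  Finite.of_injective (fun x : k1 Γ => (⟨(x.1, 1), x.2⟩ : Γ)) (by
    intro x y h
    exact Subtype.ext (congrArg (fun γ : Γ => γ.1.1) h))

instance finite_k2 [Finite Γ] : Finite (k2 Γ) := finite_k1 (Γ := swap Γ)

instance finite_pr1 [Finite Γ] : Finite (pr1 Γ) :=
  Set.Finite.image _ (Set.toFinite (Γ : Set (UnitQuat × UnitQuat)))

instance finite_pr2 [Finite Γ] : Finite (pr2 Γ) :=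
  Set.Finite.image _ (Set.toFinite (Γ : Set (UnitQuat × UnitQuat)))

theorem k1_le_pr1 (Γ : Subgroup (UnitQuat × UnitQuat)) : k1 Γ ≤ pr1 Γ :=
  fun _ hx => mem_pr1.2 ⟨1, hx⟩

theorem k2_le_pr2 (Γ : Subgroup (UnitQuat × UnitQuat)) : k2 Γ ≤ pr2 Γ :=
  fun _ hx => mem_pr2.2 ⟨1, hx⟩

theorem k1_normal {x : UnitQuat} (ha : a ∈ pr1 Γ) (hx : x ∈ k1 Γ) : a * x * a⁻¹ ∈ k1 Γ := by
  obtain ⟨b, hb⟩ := mem_pr1.1 ha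
  have := Γ.mul_mem (Γ.mul_mem hb hx) (Γ.inv_mem hb)
  simpa [mem_k1] using this

theorem k2_normal {x : UnitQuat} (ha : a ∈ pr2 Γ) (hx : x ∈ k2 Γ) : a * x * a⁻¹ ∈ k2 Γ := by
  obtain ⟨b, hb⟩ := mem_pr2.1 ha
  have := Γ.mul_mem (Γ.mul_mem hb hx) (Γ.inv_mem hb)
  simpa [mem_k2] using this

theorem div_mem_k2 {b' : UnitQuat} (h : (a, b) ∈ Γ) (h' : (a, b') ∈ Γ) : b⁻¹ * b' ∈ k2 Γ := by
  have := Γ.mul_mem (Γ.inv_mem h) h'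
  simpa [mem_k2] using this

theorem div_mem_k1 {a' : UnitQuat} (h : (a, b) ∈ Γ) (h' : (a', b) ∈ Γ) : a⁻¹ * a' ∈ k1 Γ := by
  have := Γ.mul_mem (Γ.inv_mem h) h'
  simpa [mem_k1] using this

/-- Splitting of a subgroup of the product into its first projection and its second kernel. -/
noncomputable def splitEquiv (Γ : Subgroup (UnitQuat × UnitQuat)) : Γ ≃ pr1 Γ × k2 Γ where
  toFun γ := ⟨⟨γ.1.1, mem_pr1.2 ⟨γ.1.2, γ.2⟩⟩,
    ⟨(mem_pr1.1 (mem_pr1.2 ⟨γ.1.2, γ.2⟩ : γ.1.1 ∈ pr1 Γ)).choose⁻¹ * γ.1.2,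
      div_mem_k2 (mem_pr1.1 (mem_pr1.2 ⟨γ.1.2, γ.2⟩ : γ.1.1 ∈ pr1 Γ)).choose_spec γ.2⟩⟩
  invFun p := ⟨(p.1.1, (mem_pr1.1 p.1.2).choose * p.2.1), by
    have := Γ.mul_mem (mem_pr1.1 p.1.2).choose_spec p.2.2
    simpa using this⟩
  left_inv γ := by simp
  right_inv p := by simp

theorem card_eq_pr1_mul_k2 (Γ : Subgroup (UnitQuat × UnitQuat)) :
    Nat.card Γ = Nat.card (pr1 Γ) * Nat.card (k2 Γ) := by
  rw [← Nat.card_prod]; exact Nat.card_congr (splitEquiv Γ)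

theorem card_eq_pr2_mul_k1 (Γ : Subgroup (UnitQuat × UnitQuat)) :
    Nat.card Γ = Nat.card (pr2 Γ) * Nat.card (k1 Γ) := by
  rw [Nat.card_congr (swapEquiv Γ), card_eq_pr1_mul_k2, pr1_swap, k2_swap]

/-- Real part 1 characterizes the identity, so the kernel is visible in the joint distribution of
traces. -/
theorem almostConjugate_k1 (h : AlmostConjugate Γ Γ') : AlmostConjugate (k1 Γ) (k1 Γ') := by
  obtain ⟨h1, h2, φ, hφ⟩ := almostConjugate_prod_iff.1 h
  apply almostConjugate_of_card
  intro c
  have key : ∀ Γ : Subgroup (UnitQuat × UnitQuat), Nat.card {a : k1 Γ // re a.1 = c} =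
      Nat.card {γ : Γ // re γ.1.1 = c ∧ re γ.1.2 = 1} := by
    intro Γ
    refine Nat.card_congr ⟨fun a => ⟨⟨(a.1.1, 1), a.1.2⟩, a.2, re_one⟩, fun γ => ⟨⟨γ.1.1.1, ?_⟩, γ.2.1⟩,
      fun _ => rfl, fun γ => ?_⟩
    · have := γ.1.2
      rw [mem_k1, ← eq_one_of_re γ.2.2]
      exact this
    · obtain ⟨⟨⟨x, y⟩, h⟩, h2, h3⟩ := γ
      obtain rfl := eq_one_of_re h3
      rfl
  rw [key, key]
  exact Nat.card_congr (φ.subtypeEquiv fun γ => by rw [(hφ γ).1, (hφ γ).2])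

theorem almostConjugate_k2 (h : AlmostConjugate Γ Γ') : AlmostConjugate (k2 Γ) (k2 Γ') :=
  almostConjugate_k1 (almostConjugate_swap h)

/-- Every element of the projection has as many lifts as `k2` has elements. The trace counts of the
projection are those of Γ divided by the order of `k2`, which is common to both groups. -/
theorem almostConjugate_pr1 (h : AlmostConjugate Γ Γ') : AlmostConjugate (pr1 Γ) (pr1 Γ') := by
  have hk := (almostConjugate_k2 h).card_eq
  obtain ⟨h1, h2, φ, hφ⟩ := almostConjugate_prod_iff.1 h
  apply almostConjugate_of_card
  intro c
  have key : ∀ Γ : Subgroup (UnitQuat × UnitQuat), Nat.card {a : pr1 Γ // re a.1 = c} *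
      Nat.card (k2 Γ) = Nat.card {γ : Γ // re γ.1.1 = c} := by
    intro Γ
    rw [← Nat.card_prod]
    symm
    refine Nat.card_congr (((splitEquiv Γ).subtypeEquiv (q := fun p => re p.1.1 = c)
      fun γ => Iff.rfl).trans ?_)
    exact ⟨fun p => ⟨⟨p.1.1, p.2⟩, p.1.2⟩, fun p => ⟨⟨p.1.1, p.2⟩, p.1.2⟩, fun _ => rfl, fun _ => rfl⟩
  have hpos : 0 < Nat.card (k2 Γ) := Nat.card_pos
  apply Nat.eq_of_mul_eq_mul_right hpos
  rw [key]
  rw [hk, key]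
  exact Nat.card_congr (φ.subtypeEquiv fun γ => by rw [(hφ γ).1])

theorem almostConjugate_pr2 (h : AlmostConjugate Γ Γ') : AlmostConjugate (pr2 Γ) (pr2 Γ') := by
  have := almostConjugate_pr1 (almostConjugate_swap h)
  rwa [pr1_swap, pr1_swap] at this

theorem exists_same_re (h : AlmostConjugate Γ Γ') (hab : (a, b) ∈ Γ) :
    ∃ a' b', (a', b') ∈ Γ' ∧ re a' = re a ∧ re b' = re b := by
  obtain ⟨-, -, φ, hφ⟩ := almostConjugate_prod_iff.1 h
  exact ⟨_, _, (φ ⟨_, hab⟩).2, (hφ ⟨_, hab⟩).1, (hφ ⟨_, hab⟩).2⟩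

/-- This is the endgame of most cases: common elements that cover the first projection, together
with an inclusion of second kernels, give Γ ≤ Γ', and the orders do the rest. -/
theorem eq_of_lifts [Finite Γ'] (hc : Nat.card Γ = Nat.card Γ') (h1 : pr1 Γ ≤ pr1 (Γ ⊓ Γ'))
    (h2 : k2 Γ ≤ k2 Γ') : Γ = Γ' := by
  apply Subgroup.eq_of_le_of_card_ge _ hc.ge
  rintro ⟨x, y⟩ hxy
  obtain ⟨z, hz, hz'⟩ := mem_pr1.1 (h1 (mem_pr1.2 ⟨y, hxy⟩))
  have := Γ'.mul_mem hz' (h2 (div_mem_k2 hz hxy))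
  simpa using this

/-! ### Almost conjugate commutative and dihedral groups. -/

theorem orderOf_eq_of_re {x y : UnitQuat} (h : re x = re y) : orderOf x = orderOf y := by
  obtain ⟨g, rfl⟩ := exists_conj h
  exact (orderOf_injective (MulAut.conj g).toMonoidHom (MulAut.conj g).injective x).symm

theorem Dih.eq_of_mem {A A' L : Subgroup UnitQuat} (h : Dih A L) (h' : Dih A' L) {w : UnitQuat}
    (hw : w ∈ A) (hw' : w ∈ A') (hL : w ∉ L) : A = A' := by
  have key : ∀ {A A' : Subgroup UnitQuat}, Dih A L → Dih A' L → w ∈ A → w ∈ A' → A ≤ A' := by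
    intro A A' h h' hw hw' x hx
    by_cases hxL : x ∈ L
    · exact h'.le hxL
    · exact (A'.mul_mem_cancel_right hw').1 (h'.le (h.mul_mem x hx w hw hxL hL))
  exact le_antisymm (key h h' hw hw') (key h' h hw' hw)

/-- A is cyclic. The partner of a generator is conjugate to it, so the conjugated group lies in B
and has the order of B. -/
theorem commOn_conjugate {A B : Subgroup UnitQuat} (hA : CommOn A) (h : AlmostConjugate A B) :
    ConjugateSubgroups A B := by
  obtain ⟨h1, h2, φ, hφ⟩ := almostConjugate_iff.1 h
  obtain ⟨z, rfl⟩ := CommOn.exists_zpowers hA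
  obtain ⟨g, hg⟩ := exists_conj (hφ ⟨z, Subgroup.mem_zpowers z⟩).symm
  refine ⟨g, ?_⟩
  change Subgroup.cj g _ = B
  apply Subgroup.eq_of_le_of_card_ge
  · rw [Subgroup.cj_zpowers, hg, Subgroup.zpowers_le]
    exact (φ _).2
  · rw [Subgroup.card_cj, h.card_eq]

theorem commOn_of_conjugate {A B : Subgroup UnitQuat} (hA : CommOn A)
    (h : ConjugateSubgroups A B) : CommOn B := by
  obtain ⟨g, rfl⟩ := h
  exact hA.cj g

/-- Two dihedral groups of the same order are conjugate. -/
theorem Dih.conjugate {A L A' L' : Subgroup UnitQuat} [Finite A] [Finite A'] (h : Dih A L)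
    (h' : Dih A' L') (hc : Nat.card L = Nat.card L') :
    ∃ g, A.cj g = A' ∧ L.cj g = L' := by
  have : Finite L := Finite.of_injective _ (Subgroup.inclusion_injective h.le)
  have : Finite L' := Finite.of_injective _ (Subgroup.inclusion_injective h'.le)
  obtain ⟨g, hg1, hg2⟩ := h.exists_std
  obtain ⟨k, hk1, hk2⟩ := h'.exists_std
  have hL : L.cj g = L'.cj k := by
    apply torus_eq_of_card hg1 hk1
    rw [Subgroup.card_cj, Subgroup.card_cj, hc]
  obtain ⟨w, hw, hwL⟩ := (h.cj g).exists_notMem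
  obtain ⟨v, hv, hvL⟩ := (h'.cj k).exists_notMem
  -- The cyclic parts already agree. A torus element moves one element of the outer coset onto
  -- another without disturbing them, and one such element determines the group.
  obtain ⟨t, ht, htw⟩ := exists_torus_conj_torusJ (hg2 w hw hwL) (hk2 v hv hvL)
  have hLt : (L.cj g).cj t = L'.cj k := by
    rw [hL]
    apply torus_eq_of_card
    · intro x hx
      rw [Subgroup.mem_cj] at hx
      have := torus.mul_mem (torus.mul_mem ht (hk1 hx)) (torus.inv_mem ht)
      rwa [show t * (t⁻¹ * x * t) * t⁻¹ = x by group] at this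
    · exact hk1
    · rw [Subgroup.card_cj]
  have hD := (h.cj g).cj t
  rw [hLt] at hD
  have hAA := hD.eq_of_mem (h'.cj k) (w := v) (by rw [← htw]; exact Subgroup.conj_mem_cj hw) hv hvL
  refine ⟨k⁻¹ * t * g, ?_, ?_⟩
  · rw [← Subgroup.cj_cj, ← Subgroup.cj_cj, Subgroup.cj_cj k⁻¹ t, ← Subgroup.cj_cj, hAA,
      Subgroup.cj_inv_cj]
  · rw [← Subgroup.cj_cj, ← Subgroup.cj_cj, Subgroup.cj_cj k⁻¹ t, ← Subgroup.cj_cj, hLt,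
      Subgroup.cj_inv_cj]

/-- The partner of a generator of L has the same order, so it generates a subgroup of half the order
of B; and B is noncommutative because commutativity is transported by `commOn_conjugate`. -/
theorem exists_dih_of_almostConjugate {A L B : Subgroup UnitQuat} (hA : Dih A L)
    (h : AlmostConjugate A B) : ∃ M, Dih B M ∧ Nat.card M = Nat.card L := by
  obtain ⟨h1, h2, φ, hφ⟩ := almostConjugate_iff.1 h
  have : Finite L := Finite.of_injective _ (Subgroup.inclusion_injective hA.le)
  obtain ⟨z, hz⟩ := CommOn.exists_zpowers hA.comm
  have hzA : z ∈ A := hA.le (by rw [hz]; exact Subgroup.mem_zpowers z)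
  set u : UnitQuat := (φ ⟨z, hzA⟩).1 with hu
  have huB : u ∈ B := (φ ⟨z, hzA⟩).2
  have hc : Nat.card (Subgroup.zpowers u) = Nat.card L := by
    rw [hz, Nat.card_zpowers, Nat.card_zpowers]
    exact orderOf_eq_of_re (hφ ⟨z, hzA⟩)
  refine ⟨Subgroup.zpowers u, ⟨Subgroup.zpowers_le.2 huB, commOn_zpowers u, fun hB => ?_,
    fun x hx y hy hx' hy' => ?_⟩, hc⟩
  · exact hA.not_comm (commOn_of_conjugate hB (commOn_conjugate hB h.symm))
  · exact Subgroup.mul_mem_of_card_le (Subgroup.zpowers_le.2 huB)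
      (by rw [hc, ← h.card_eq, hA.card]) hx hy hx' hy'

theorem conjugate_of_not_exc {A B : Subgroup UnitQuat} (hA : ¬ Exc A)
    (h : AlmostConjugate A B) : ConjugateSubgroups A B := by
  have := h.1
  have := h.2.1
  rcases commOn_or_dih_or_exc A with hc | ⟨L, hL⟩ | he
  · exact commOn_conjugate hc h
  · obtain ⟨M, hM, hcard⟩ := exists_dih_of_almostConjugate hL h
    obtain ⟨g, hg, -⟩ := hL.conjugate hM hcard.symm
    exact ⟨g, hg⟩
  · exact absurd he hA

/-! ### Exceptional projections with central kernels, and the theorem for a single copy. -/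

theorem Exc.cj {A : Subgroup UnitQuat} (h : Exc A) (g : UnitQuat) : Exc (A.cj g) := by
  have := h.1
  refine ⟨inferInstance, fun L hL hc => ?_⟩
  rw [Subgroup.card_cj]
  have h2 := h.2 (L.cj g⁻¹) (by rw [← Subgroup.cj_inv_cj g A]; exact Subgroup.cj_mono hL)
    (hc.cj g⁻¹)
  rwa [Subgroup.card_cj] at h2

theorem conj_mem_pm_pow {x g : UnitQuat} (n : ℕ) : (g * x * g⁻¹) ^ n ∈ pm ↔ x ^ n ∈ pm := by
  rw [conj_pow, conj_mem_pm]

theorem Prim.of_re {n : ℕ} {x y : UnitQuat} (h : Prim n x) (hre : re x = re y) : Prim n y := by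
  obtain ⟨g, rfl⟩ := exists_conj hre
  simpa only [Prim, conj_mem_pm_pow, conj_mem_pm] using h

/-- Conjugating (a, b) inside Γ leaves the central a unchanged and so changes b only by an element
of `k2`, that is, by a sign. The sign -1 forces re b = 0, hence -b = b⁻¹. So `pr2` sends b to b or
b⁻¹, which `Exc.not_normalizes` forbids for noncentral b. -/
theorem mem_pm_of_mem_pm (hB : Exc (pr2 Γ)) (hk : k2 Γ ≤ pm) (hab : (a, b) ∈ Γ) (ha : a ∈ pm) :
    b ∈ pm := by
  by_contra hb
  refine hB.not_normalizes hb fun c hc => ?_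
  obtain ⟨d, hd⟩ := mem_pr2.1 hc
  have h1 := Γ.mul_mem (Γ.mul_mem hd hab) (Γ.inv_mem hd)
  have h2 : (a, c * b * c⁻¹) ∈ Γ := by
    have : d * a * d⁻¹ = a := conj_of_mem_pm ha
    rw [← this]; exact h1
  rcases hk (div_mem_k2 hab h2) with h3 | h3
  · left; exact (inv_mul_eq_one.1 h3).symm
  · right
    have h4 : c * b * c⁻¹ = -b := by
      rw [inv_mul_eq_iff_eq_mul] at h3
      rw [h3]; simp
    have h5 := re_conj c b
    rw [h4, re_neg] at h5
    have h6 := sq_eq_neg_one_iff.2 (show re b = 0 by linarith)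
    rw [h4, eq_comm, inv_eq_iff_mul_eq_one, mul_neg, ← pow_two, h6, neg_neg]

theorem le_pm_cases {K : Subgroup UnitQuat} (h : K ≤ pm) :
    Nat.card K = 1 ∧ -1 ∉ K ∨ Nat.card K = 2 ∧ -1 ∈ K := by
  have := card_pm_inf K
  rwa [inf_eq_left.2 h] at this

theorem eq_of_le_pm {K K' : Subgroup UnitQuat} (h : K ≤ pm) (h' : K' ≤ pm)
    (hc : Nat.card K = Nat.card K') : K = K' := by
  have key : ∀ {K K' : Subgroup UnitQuat}, K ≤ pm → K' ≤ pm → Nat.card K = Nat.card K' →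
      K ≤ K' := by
    intro K K' h h' hc x hx
    rcases h hx with rfl | rfl
    · exact K'.one_mem
    · rcases le_pm_cases h with h1 | h1 <;> rcases le_pm_cases h' with h2 | h2
      · exact absurd hx h1.2
      · omega
      · omega
      · exact h2.2
  exact le_antisymm (key h h' hc) (key h' h hc.symm)

/-- An element of Γ over -1 has second coordinate 1 or -1. Hence -1 lies in one kernel exactly when
it lies in the other. -/
theorem card_k_eq (hA : Exc (pr1 Γ)) (hB : Exc (pr2 Γ)) (h1 : k1 Γ ≤ pm) (h2 : k2 Γ ≤ pm) :
    Nat.card (k1 Γ) = Nat.card (k2 Γ) := by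
  have key : ∀ Γ : Subgroup (UnitQuat × UnitQuat), Exc (pr1 Γ) → Exc (pr2 Γ) → k1 Γ ≤ pm →
      k2 Γ ≤ pm → -1 ∈ k2 Γ → -1 ∈ k1 Γ := by
    intro Γ hA hB h1 h2 hk
    obtain ⟨b, hb⟩ := mem_pr1.1 hA.neg_one_mem
    rcases mem_pm_of_mem_pm hB h2 hb neg_one_mem_pm with rfl | rfl
    · exact hb
    · have := Γ.mul_mem hb hk
      simpa [mem_k1] using this
  have h3 := key Γ hA hB h1 h2
  have h4 := key (swap Γ) (by rwa [pr1_swap]) (by rwa [pr2_swap]) h2 h1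
  rcases le_pm_cases h1 with p | p <;> rcases le_pm_cases h2 with q | q
  · omega
  · exact absurd (h3 q.2) p.2
  · exact absurd (h4 p.2) q.2
  · omega

theorem card_pr_eq [Finite Γ] (hA : Exc (pr1 Γ)) (hB : Exc (pr2 Γ)) (h1 : k1 Γ ≤ pm)
    (h2 : k2 Γ ≤ pm) : Nat.card (pr1 Γ) = Nat.card (pr2 Γ) := by
  have e := card_k_eq hA hB h1 h2
  have h3 := card_eq_pr1_mul_k2 Γ
  rw [card_eq_pr2_mul_k1, e] at h3
  exact (Nat.eq_of_mul_eq_mul_right Nat.card_pos h3).symm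

/-- In an exceptional subgroup of the product, an element of maximal order extends to a pair with
known invariants. -/
theorem exists_pair [Finite Γ] (hA : Exc (pr1 Γ)) (hB : Exc (pr2 Γ)) (h1 : k1 Γ ≤ pm)
    (h2 : k2 Γ ≤ pm) {x b : UnitQuat} (hx : (x, b) ∈ Γ) (hp : Prim (Nat.card (pr1 Γ)) x) :
    ∃ y c, (y, c) ∈ Γ ∧ x * y ≠ y * x ∧ re y = re x ∧ re c = re b ∧
      re (x * y) = pairRe (Nat.card (pr1 Γ)) ∧ re (b * c) = pairRe (Nat.card (pr1 Γ)) := by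
  have hcard := card_pr_eq hA hB h1 h2
  have htrans : ∀ {u v : UnitQuat} (n : ℕ), (u, v) ∈ Γ → u ^ n ∈ pm → v ^ n ∈ pm :=
    fun n huv hu => mem_pm_of_mem_pm hB h2 (Γ.pow_mem huv n) hu
  have htrans' : ∀ {u v : UnitQuat} (n : ℕ), (u, v) ∈ Γ → v ^ n ∈ pm → u ^ n ∈ pm :=
    fun n huv hv => mem_pm_of_mem_pm (Γ := swap Γ) (by rwa [pr2_swap]) h1
      ((swap Γ).pow_mem (show (_, _) ∈ swap Γ from huv) n) hv
  -- Powers are central in one coordinate exactly when they are central in the other, so b has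
  -- maximal order along with x.
  have hpb : Prim (Nat.card (pr2 Γ)) b := by
    rw [← hcard]
    have e1 : x ∉ pm → b ∉ pm := fun hx' hb => hx' (by simpa using htrans' 1 hx (by simpa using hb))
    rcases hp with h | h | h
    · exact Or.inl ⟨h.1, htrans 3 hx h.2.1, e1 h.2.2⟩
    · exact Or.inr (Or.inl ⟨h.1, htrans 4 hx h.2.1, fun hb => h.2.2 (htrans' 2 hx hb)⟩)
    · exact Or.inr (Or.inr ⟨h.1, htrans 5 hx h.2.1, e1 h.2.2⟩)
  -- The pair (y, c) is a Γ-conjugate of (x, b), so the traces agree. If every such y commuted with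
  -- x, it would be x or x⁻¹, contrary to `Exc.not_normalizes`.
  obtain ⟨y, c, hy, hxy, hre, hre'⟩ : ∃ y c, (y, c) ∈ Γ ∧ x * y ≠ y * x ∧ re y = re x ∧
      re c = re b := by
    by_contra! hcon
    refine hA.not_normalizes hp.notMem_pm fun u hu => ?_
    obtain ⟨v, hv⟩ := mem_pr1.1 hu
    have hmem := Γ.mul_mem (Γ.mul_mem hv hx) (Γ.inv_mem hv)
    by_cases hcomm : x * (u * x * u⁻¹) = u * x * u⁻¹ * x
    · exact eq_or_inv_of_comm hcomm.symm (re_conj u x)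
    · exact absurd (re_conj v b) (hcon _ _ hmem hcomm (re_conj u x))
  -- If b and c commuted, the commutator of x and y would lie in `k1`, so it would be 1 or -1; the
  -- value -1 means x y x⁻¹ = -y and makes the trace vanish.
  have hbc : ∀ {y c}, (y, c) ∈ Γ → x * y ≠ y * x → re y = re x → b * c ≠ c * b := by
    intro y c hy hxy hre hbc
    have hk : x * y * x⁻¹ * y⁻¹ ∈ k1 Γ := by
      have := Γ.mul_mem (Γ.mul_mem (Γ.mul_mem hx hy) (Γ.inv_mem hx)) (Γ.inv_mem hy)
      have e : b * c * b⁻¹ * c⁻¹ = 1 := by rw [hbc]; group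
      simpa [mem_k1, e] using this
    rcases h1 hk with h3 | h3
    · apply hxy
      rw [mul_inv_eq_one, mul_inv_eq_iff_eq_mul] at h3
      exact h3
    · rw [mul_inv_eq_iff_eq_mul, neg_one_mul] at h3
      have := re_conj x y
      rw [h3, re_neg] at this
      exact hp.re_ne_zero (by linarith)
  -- The prescribed trace of xy is encoded in a power of xy being central. That condition passes to
  -- bc, where `Exc.pair` turns it back into the prescribed trace. The choice between y and y⁻¹ thus
  -- works in both coordinates at once.
  have fin : ∀ {y c}, (y, c) ∈ Γ → x * y ≠ y * x → re y = re x → re c = re b →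
      re (x * y) = pairRe (Nat.card (pr1 Γ)) → re (b * c) = pairRe (Nat.card (pr1 Γ)) := by
    intro y c hy hxy hre hre' hr
    have hb : b ∈ pr2 Γ := mem_pr2.2 ⟨_, hx⟩
    have hc : c ∈ pr2 Γ := mem_pr2.2 ⟨_, hy⟩
    rw [hcard]
    apply (hB.pair hb hc hpb hre' (hbc hy hxy hre)).2.1
    rw [← hcard]
    exact htrans _ (Γ.mul_mem hx hy) (pow_pairExp_mem hr)
  have hxA : x ∈ pr1 Γ := mem_pr1.2 ⟨_, hx⟩
  have hyA : y ∈ pr1 Γ := mem_pr1.2 ⟨_, hy⟩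
  rcases (hA.pair hxA hyA hp hre hxy).1 with hr | hr
  · exact ⟨y, c, hy, hxy, hre, hre', hr, fin hy hxy hre hre' hr⟩
  · have hxy' : x * y⁻¹ ≠ y⁻¹ * x := by
      intro h
      apply hxy
      rw [mul_inv_eq_iff_eq_mul, mul_assoc, eq_inv_mul_iff_mul_eq] at h
      exact h.symm
    exact ⟨y⁻¹, c⁻¹, Γ.inv_mem hy, hxy', by simpa using hre, by simpa using hre', hr,
      fin (Γ.inv_mem hy) hxy' (by simpa using hre) (by simpa using hre') hr⟩

/-- Take (x, b) with x of maximal order and a partner (x', b') with the same traces, and extend each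
by `exists_pair`. In both coordinates the three invariants of the two pairs agree, so one
conjugation matches x, y and another matches b, c. Since x and y generate `pr1` and the kernels are
central of equal order, the groups coincide. -/
theorem conjugate_of_exc (h : AlmostConjugate Γ Γ') (hA : Exc (pr1 Γ)) (hB : Exc (pr2 Γ))
    (hA' : Exc (pr1 Γ')) (hB' : Exc (pr2 Γ')) (h1 : k1 Γ ≤ pm) (h2 : k2 Γ ≤ pm)
    (h1' : k1 Γ' ≤ pm) (h2' : k2 Γ' ≤ pm) : ConjugateSubgroups Γ Γ' := by
  have := h.1
  have := h.2.1
  obtain ⟨x, hx, hp⟩ := hA.exists_prim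
  obtain ⟨b, hxb⟩ := mem_pr1.1 hx
  obtain ⟨x', b', hxb', hrx, hrb⟩ := exists_same_re h hxb
  have hcA := (almostConjugate_pr1 h).card_eq
  have hp' : Prim (Nat.card (pr1 Γ')) x' := by
    rw [← hcA]; exact hp.of_re hrx.symm
  obtain ⟨y, c, hyc, hne, r1, r2, r3, r4⟩ := exists_pair hA hB h1 h2 hxb hp
  obtain ⟨y', c', hyc', hne', r1', r2', r3', r4'⟩ := exists_pair hA' hB' h1' h2' hxb' hp'
  rw [← hcA] at r3' r4'
  obtain ⟨g, hg1, hg2⟩ := exists_conj_pair hrx (by rw [r1', r1, hrx] : re y' = re y)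
    (by rw [r3', r3])
  obtain ⟨k, hk1, hk2⟩ := exists_conj_pair hrb (by rw [r2', r2, hrb] : re c' = re c)
    (by rw [r4', r4])
  have hxb2 : (x, b) ∈ Γ'.cj (g, k) := by rw [← hg1, ← hk1]; exact conj_mem_cj_prod hxb'
  have hyc2 : (y, c) ∈ Γ'.cj (g, k) := by rw [← hg2, ← hk2]; exact conj_mem_cj_prod hyc'
  have hE := hA'.cj g
  suffices hs : Γ = Γ'.cj (g, k) from ConjugateSubgroups.symm ⟨(g, k), hs.symm⟩
  apply eq_of_lifts (by rw [Subgroup.card_cj, h.card_eq])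
  · rw [← hA.closure_pair hx (mem_pr1.2 ⟨c, hyc⟩) hp r1 hne, Subgroup.closure_le]
    rintro z (rfl | rfl)
    · exact mem_pr1.2 ⟨b, hxb, hxb2⟩
    · exact mem_pr1.2 ⟨c, hyc, hyc2⟩
  · rw [k2_cj, cj_eq_of_le_pm h2']
    exact (eq_of_le_pm h2 h2' (almostConjugate_k2 h).card_eq).le

/-- The diagonal subgroup of the product. -/
noncomputable def diag (A : Subgroup UnitQuat) : Subgroup (UnitQuat × UnitQuat) :=
  A.map ((MonoidHom.id _).prod (MonoidHom.id _))

theorem mem_diag {A : Subgroup UnitQuat} : (a, b) ∈ diag A ↔ a ∈ A ∧ a = b := by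
  simp only [diag, Subgroup.mem_map, MonoidHom.prod_apply, MonoidHom.id_apply, Prod.mk.injEq]
  constructor
  · rintro ⟨x, hx, rfl, rfl⟩
    exact ⟨hx, rfl⟩
  · rintro ⟨ha, rfl⟩
    exact ⟨a, ha, rfl, rfl⟩

/-- A group is in bijection with its diagonal. -/
def diagEquiv (A : Subgroup UnitQuat) : A ≃ diag A where
  toFun a := ⟨(a.1, a.1), mem_diag.2 ⟨a.2, rfl⟩⟩
  invFun γ := ⟨γ.1.1, (mem_diag.1 γ.2).1⟩
  left_inv _ := rfl
  right_inv γ := Subtype.ext (Prod.ext rfl (mem_diag.1 γ.2).2)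

theorem pr1_diag (A : Subgroup UnitQuat) : pr1 (diag A) = A := by
  ext x; rw [mem_pr1]; simp [mem_diag]

theorem pr2_diag (A : Subgroup UnitQuat) : pr2 (diag A) = A := by
  ext x; rw [mem_pr2]; simp [mem_diag]

theorem k1_diag (A : Subgroup UnitQuat) : k1 (diag A) ≤ pm := by
  intro x hx
  rw [mem_k1, mem_diag] at hx
  exact Or.inl hx.2

theorem k2_diag (A : Subgroup UnitQuat) : k2 (diag A) ≤ pm := by
  intro x hx
  rw [mem_k2, mem_diag] at hx
  exact Or.inl hx.2.symm

/-- Almost conjugate finite groups of unit quaternions are conjugate. -/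
theorem conjugate_of_almostConjugate {A B : Subgroup UnitQuat} (h : AlmostConjugate A B) :
    ConjugateSubgroups A B := by
  by_cases hA : Exc A
  swap
  · exact conjugate_of_not_exc hA h
  by_cases hB : Exc B
  swap
  · exact (conjugate_of_not_exc hB h.symm).symm
  -- The exceptional case is read off from the diagonals, whose kernels are trivial and whose
  -- projections are the given groups.
  have hD : AlmostConjugate (diag A) (diag B) := by
    obtain ⟨h1, h2, φ, hφ⟩ := h
    refine ⟨Finite.of_equiv _ (diagEquiv A), Finite.of_equiv _ (diagEquiv B),
      (diagEquiv A).symm.trans (φ.trans (diagEquiv B)), fun γ => ?_⟩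
    obtain ⟨a, rfl⟩ := (diagEquiv A).surjective γ
    obtain ⟨x, hx⟩ := hφ a
    refine ⟨(x, x), ?_⟩
    rw [Equiv.trans_apply, Equiv.symm_apply_apply]
    change (x * (a : UnitQuat) * x⁻¹, x * (a : UnitQuat) * x⁻¹) = ((φ a : UnitQuat), (φ a : UnitQuat))
    rw [hx]
  obtain ⟨g, hg⟩ := conjugate_of_exc hD (by rwa [pr1_diag]) (by rwa [pr2_diag]) (by rwa [pr1_diag])
    (by rwa [pr2_diag]) (k1_diag A) (k2_diag A) (k1_diag B) (k2_diag B)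
  refine ⟨g.1, ?_⟩
  change (diag A).cj g = diag B at hg
  have := pr1_cj (Γ := diag A) g
  rw [hg, pr1_diag, pr1_diag] at this
  exact this.symm

end UnitQuat

/-! ### Projections in tori, and dihedral projections with corresponding cyclic parts. -/

section General
variable {G : Type*} [Group G]

theorem Subgroup.eq_of_index_two {Λ Γ Γ' : Subgroup G} (h : Λ ≤ Γ) (h' : Λ ≤ Γ') {w : G}
    (hw : w ∈ Γ) (hw' : w ∈ Γ') (hΛ : w ∉ Λ)
    (hm : ∀ x ∈ Γ, ∀ y ∈ Γ, x ∉ Λ → y ∉ Λ → x * y ∈ Λ)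
    (hm' : ∀ x ∈ Γ', ∀ y ∈ Γ', x ∉ Λ → y ∉ Λ → x * y ∈ Λ) : Γ = Γ' := by
  have key : ∀ {A A' : Subgroup G}, Λ ≤ A' → (∀ x ∈ A, ∀ y ∈ A, x ∉ Λ → y ∉ Λ → x * y ∈ Λ) →
      w ∈ A → w ∈ A' → A ≤ A' := by
    intro A A' h' hm hw hw' x hx
    by_cases hxL : x ∈ Λ
    · exact h' hxL
    · exact (A'.mul_mem_cancel_right hw').1 (h' (hm x hx w hw hxL hΛ))
  exact le_antisymm (key h' hm hw hw') (key h hm' hw' hw)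

theorem ConjugateSubgroups.of_cj_right {A B : Subgroup G} {g : G}
    (h : ConjugateSubgroups A (B.cj g)) : ConjugateSubgroups A B := by
  apply ConjugateSubgroups.of_cj (g := 1) (h := g)
  rwa [Subgroup.cj_one]

theorem AlmostConjugate.cj_cj {A B : Subgroup G} (h : AlmostConjugate A B) (g k : G) :
    AlmostConjugate (A.cj g) (B.cj k) := ((h.symm.cj_right g).symm).cj_right k

/-- K contains all even powers of the generator of L, hence has index at most two. -/
theorem Subgroup.card_le_of_sq_mem {K L : Subgroup G} [Finite L] {z : G}
    (hL : L = Subgroup.zpowers z) (hK : K ≤ L) (hz : z ^ 2 ∈ K) :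
    Nat.card L ≤ 2 * Nat.card K := by
  have heven : ∀ {m : ℤ}, Even m → z ^ m ∈ K := by
    rintro m ⟨k, rfl⟩
    have := K.zpow_mem hz k
    rwa [← zpow_natCast, ← zpow_mul, show ((2 : ℕ) : ℤ) * k = k + k by push_cast; ring] at this
  by_cases hex : ∃ w ∈ L, w ∉ K
  · obtain ⟨w, hw, hw'⟩ := hex
    refine (Subgroup.card_eq_two_mul hK ?_ hw hw').le
    intro x hx y hy hx' hy'
    rw [hL] at hx hy
    obtain ⟨m, rfl⟩ := hx
    obtain ⟨n, rfl⟩ := hy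
    have h1 : ¬ Even m := fun h => hx' (heven h)
    have h2 : ¬ Even n := fun h => hy' (heven h)
    have : Even (m + n) := (Int.not_even_iff_odd.1 h1).add_odd (Int.not_even_iff_odd.1 h2)
    change z ^ m * z ^ n ∈ K
    rw [← zpow_add]
    exact heven this
  · push Not at hex
    have : K = L := le_antisymm hK hex
    rw [this]; omega

end General

namespace UnitQuat

variable {Γ Γ' Λ Λ' : Subgroup (UnitQuat × UnitQuat)}

theorem eq_of_lifts' [Finite Γ'] (hc : Nat.card Γ = Nat.card Γ') (h1 : pr2 Γ ≤ pr2 (Γ ⊓ Γ'))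
    (h2 : k1 Γ ≤ k1 Γ') : Γ = Γ' := by
  have h3 : Nat.card (swap Γ) = Nat.card (swap Γ') := by
    rw [← Nat.card_congr (swapEquiv Γ), ← Nat.card_congr (swapEquiv Γ'), hc]
  have := eq_of_lifts (Γ := swap Γ) (Γ' := swap Γ') h3
    (by rw [pr1_swap]; exact h1.trans (le_of_eq (pr1_swap (Γ ⊓ Γ')).symm)) h2
  exact congrArg swap this

theorem CommOn.eq_of_card {L K K' : Subgroup UnitQuat} [Finite L] (hL : CommOn L) (hK : K ≤ L)
    (hK' : K' ≤ L) (hc : Nat.card K = Nat.card K') : K = K' := by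
  have : Finite K := Finite.of_injective _ (Subgroup.inclusion_injective hK)
  have : Finite K' := Finite.of_injective _ (Subgroup.inclusion_injective hK')
  obtain ⟨g, hg⟩ := CommOn.exists_le_torus hL
  have := torus_eq_of_card ((Subgroup.cj_mono hK).trans hg) ((Subgroup.cj_mono hK').trans hg)
    (by rw [Subgroup.card_cj, Subgroup.card_cj, hc])
  rw [← Subgroup.cj_inv_cj g K, this, Subgroup.cj_inv_cj]

/-- The normalizer of the standard torus. -/
def InNormalizer (n : UnitQuat) : Prop := n ∈ torus ∨ n ∈ torusJ

theorem InNormalizer.conj_mem {n x : UnitQuat} (hn : InNormalizer n) (hx : x ∈ torus) :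
    n * x * n⁻¹ ∈ torus := by
  rcases hn with hn | hn
  · exact torus.mul_mem (torus.mul_mem hn hx) (torus.inv_mem hn)
  · rw [torusJ_conj_torus hn hx]; exact torus.inv_mem hx

theorem InNormalizer.conj_memJ {n x : UnitQuat} (hn : InNormalizer n) (hx : x ∈ torusJ) :
    n * x * n⁻¹ ∈ torusJ := by
  rcases hn with hn | hn
  · exact torusJ_mul_torus (torus_mul_torusJ hn hx) (torus.inv_mem hn)
  · exact torus_mul_torusJ (torusJ_mul_torusJ hn hx) (torusJ_inv hn)

theorem InNormalizer.cj_le {n : UnitQuat} (hn : InNormalizer n) {A : Subgroup UnitQuat}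
    (hA : A ≤ torus) : A.cj n ≤ torus := by
  intro x hx
  have := hn.conj_mem (hA (Subgroup.mem_cj.1 hx))
  rwa [show n * (n⁻¹ * x * n) * n⁻¹ = x by group] at this

theorem InNormalizer.cj_eq {n : UnitQuat} (hn : InNormalizer n) {A : Subgroup UnitQuat} [Finite A]
    (hA : A ≤ torus) : A.cj n = A :=
  torus_eq_of_card (hn.cj_le hA) hA (Subgroup.card_cj n A)

theorem exists_normalizer_conj {x y : UnitQuat} (hx : x ∈ torus) (hy : y ∈ torus)
    (h : re x = re y) : ∃ n, InNormalizer n ∧ n * x * n⁻¹ = y := by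
  rcases torus_eq_or_inv hx hy h with rfl | rfl
  · exact ⟨1, Or.inl torus.one_mem, by simp⟩
  · exact ⟨jj, Or.inr jj_mem, by rw [torusJ_conj_torus jj_mem hx, inv_inv]⟩

/-- Subgroups of the torus of the product with corresponding elements. -/
theorem torus_conjugate [Finite Γ] [Finite Γ'] (h1 : pr1 Γ ≤ torus) (h2 : pr2 Γ ≤ torus)
    (h1' : pr1 Γ' ≤ torus) (h2' : pr2 Γ' ≤ torus) (hc : Nat.card Γ = Nat.card Γ')
    (hk : Nat.card (k2 Γ) = Nat.card (k2 Γ'))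
    (hex : ∀ a b, (a, b) ∈ Γ → ∃ a' b', (a', b') ∈ Γ' ∧ re a' = re a ∧ re b' = re b) :
    ∃ n m, InNormalizer n ∧ InNormalizer m ∧ Γ'.cj (n, m) = Γ := by
  obtain ⟨z, hz⟩ := CommOn.exists_zpowers (commOn_of_le_torus h1)
  have hzA : z ∈ pr1 Γ := by rw [hz]; exact Subgroup.mem_zpowers z
  obtain ⟨b, hb⟩ := mem_pr1.1 hzA
  obtain ⟨z', b', hzb, r1, r2⟩ := hex z b hb
  -- A lift of a generator of `pr1` and its partner agree up to inversion in each coordinate;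
  -- elements of the normalizer correct this. The normalizer preserves every finite subgroup of the
  -- torus, so the kernels stay in place.
  obtain ⟨n, hn, hnz⟩ := exists_normalizer_conj (h1' (mem_pr1.2 ⟨_, hzb⟩)) (h1 hzA) r1
  obtain ⟨m, hm, hmb⟩ := exists_normalizer_conj (h2' (mem_pr2.2 ⟨_, hzb⟩))
    (h2 (mem_pr2.2 ⟨_, hb⟩)) r2
  refine ⟨n, m, hn, hm, ?_⟩
  symm
  apply eq_of_lifts (by rw [Subgroup.card_cj, hc])
  · rw [hz, Subgroup.zpowers_le]
    refine mem_pr1.2 ⟨b, hb, ?_⟩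
    have := conj_mem_cj_prod (g := n) (h := m) hzb
    rwa [hnz, hmb] at this
  · rw [k2_cj, hm.cj_eq ((k2_le_pr2 Γ').trans h2')]
    exact (torus_eq_of_card ((k2_le_pr2 Γ).trans h2) ((k2_le_pr2 Γ').trans h2') hk).le

theorem conjugate_of_commOn (h : AlmostConjugate Γ Γ') (hA : CommOn (pr1 Γ))
    (hB : CommOn (pr2 Γ)) : ConjugateSubgroups Γ Γ' := by
  have hA' := commOn_of_conjugate hA (commOn_conjugate hA (almostConjugate_pr1 h))
  have hB' := commOn_of_conjugate hB (commOn_conjugate hB (almostConjugate_pr2 h))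
  obtain ⟨g1, hg1⟩ := CommOn.exists_le_torus hA
  obtain ⟨g2, hg2⟩ := CommOn.exists_le_torus hB
  obtain ⟨g1', hg1'⟩ := CommOn.exists_le_torus hA'
  obtain ⟨g2', hg2'⟩ := CommOn.exists_le_torus hB'
  have hC := h.cj_cj (g1, g2) (g1', g2')
  have := hC.1
  have := hC.2.1
  obtain ⟨n, m, -, -, hnm⟩ := torus_conjugate (by rwa [pr1_cj]) (by rwa [pr2_cj]) (by rwa [pr1_cj])
    (by rwa [pr2_cj]) hC.card_eq (almostConjugate_k2 hC).card_eq (fun a b => exists_same_re hC)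
  apply ConjugateSubgroups.of_cj (g := (g1, g2)) (h := (g1', g2'))
  exact ConjugateSubgroups.symm ⟨_, hnm⟩

/-- `Λ` is a commutative subgroup of index two in `Γ`, and the projections of `Γ` are not
commutative. -/
structure Aligned (Γ Λ : Subgroup (UnitQuat × UnitQuat)) : Prop where
  le : Λ ≤ Γ
  comm1 : CommOn (pr1 Λ)
  comm2 : CommOn (pr2 Λ)
  not_comm1 : ¬ CommOn (pr1 Γ)
  not_comm2 : ¬ CommOn (pr2 Γ)
  mul_mem : ∀ x ∈ Γ, ∀ y ∈ Γ, x ∉ Λ → y ∉ Λ → x * y ∈ Λ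

theorem Aligned.swap (h : Aligned Γ Λ) : Aligned (swap Γ) (swap Λ) where
  le := fun _ hx => h.le hx
  comm1 := by rw [pr1_swap]; exact h.comm2
  comm2 := by rw [pr2_swap]; exact h.comm1
  not_comm1 := by rw [pr1_swap]; exact h.not_comm2
  not_comm2 := by rw [pr2_swap]; exact h.not_comm1
  mul_mem := fun x hx y hy hx' hy' => h.mul_mem x.swap hx y.swap hy hx' hy'

/-- If a were in `pr1 Λ`, multiplying elements outside Λ by (a, b) would put all of `pr1 Γ` into the
commutative group `pr1 Λ`. -/
theorem Aligned.notMem1 (h : Aligned Γ Λ) {a b : UnitQuat} (hab : (a, b) ∈ Γ)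
    (hab' : (a, b) ∉ Λ) : a ∉ pr1 Λ := by
  intro ha
  apply h.not_comm1
  refine h.comm1.mono fun c hc => ?_
  obtain ⟨d, hd⟩ := mem_pr1.1 hc
  by_cases hd' : (c, d) ∈ Λ
  · exact mem_pr1.2 ⟨d, hd'⟩
  · have := h.mul_mem _ hd _ hab hd' hab'
    exact ((pr1 Λ).mul_mem_cancel_right ha).1 (mem_pr1.2 ⟨_, this⟩)

theorem Aligned.notMem2 (h : Aligned Γ Λ) {a b : UnitQuat} (hab : (a, b) ∈ Γ)
    (hab' : (a, b) ∉ Λ) : b ∉ pr2 Λ := by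
  rw [← pr1_swap]
  exact h.swap.notMem1 (a := b) (b := a) hab hab'

theorem Aligned.dih1 (h : Aligned Γ Λ) : Dih (pr1 Γ) (pr1 Λ) where
  le := Subgroup.map_mono h.le
  comm := h.comm1
  not_comm := h.not_comm1
  mul_mem := by
    intro x hx y hy hx' hy'
    obtain ⟨u, hu⟩ := mem_pr1.1 hx
    obtain ⟨v, hv⟩ := mem_pr1.1 hy
    exact mem_pr1.2 ⟨u * v, h.mul_mem _ hu _ hv (fun hc => hx' (mem_pr1.2 ⟨u, hc⟩))
      (fun hc => hy' (mem_pr1.2 ⟨v, hc⟩))⟩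

theorem Aligned.dih2 (h : Aligned Γ Λ) : Dih (pr2 Γ) (pr2 Λ) := by
  rw [← pr1_swap, ← pr1_swap]; exact h.swap.dih1

theorem Aligned.cj (h : Aligned Γ Λ) (g : UnitQuat × UnitQuat) : Aligned (Γ.cj g) (Λ.cj g) where
  le := Subgroup.cj_mono h.le
  comm1 := by rw [pr1_cj]; exact h.comm1.cj _
  comm2 := by rw [pr2_cj]; exact h.comm2.cj _
  not_comm1 := by rw [pr1_cj, commOn_cj_iff]; exact h.not_comm1
  not_comm2 := by rw [pr2_cj, commOn_cj_iff]; exact h.not_comm2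
  mul_mem := by
    intro x hx y hy hx' hy'
    rw [Subgroup.mem_cj] at *
    have := h.mul_mem _ hx _ hy hx' hy'
    rwa [show g⁻¹ * (x * y) * g = g⁻¹ * x * g * (g⁻¹ * y * g) by group]

theorem Aligned.exists_notMem (h : Aligned Γ Λ) : ∃ a b, (a, b) ∈ Γ ∧ (a, b) ∉ Λ := by
  obtain ⟨w, hw, hw'⟩ := h.dih1.exists_notMem
  obtain ⟨v, hv⟩ := mem_pr1.1 hw
  exact ⟨w, v, hv, fun hc => hw' (mem_pr1.2 ⟨v, hc⟩)⟩

theorem Aligned.card (h : Aligned Γ Λ) : Nat.card Γ = 2 * Nat.card Λ := by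
  obtain ⟨a, b, h1, h2⟩ := h.exists_notMem
  exact Subgroup.card_eq_two_mul h.le h.mul_mem h1 h2

theorem Aligned.re_eq_zero (h : Aligned Γ Λ) {a b : UnitQuat} (hab : (a, b) ∈ Γ)
    (hab' : (a, b) ∉ Λ) : re a = 0 ∧ re b = 0 :=
  ⟨h.dih1.re_eq_zero (mem_pr1.2 ⟨b, hab⟩) (h.notMem1 hab hab'),
    h.dih2.re_eq_zero (mem_pr2.2 ⟨a, hab⟩) (h.notMem2 hab hab')⟩

theorem Aligned.k2_eq (h : Aligned Γ Λ) : k2 Λ = k2 Γ := by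
  apply le_antisymm (fun x hx => h.le hx)
  intro x hx
  by_contra hc
  have := (h.re_eq_zero (a := 1) (b := x) hx hc).1
  simp at this

/-- Outside Λ and Λ' both traces vanish, so a partner of an element with some nonzero trace lies in
Λ'. For the traces (0, 0) a count is needed: if Λ' had no such element, the inverse bijection would
embed Λ' into Λ without hitting (a, b), although the orders are equal. -/
theorem Aligned.exists_same_re (h : Aligned Γ Λ) (h' : Aligned Γ' Λ') (hc : AlmostConjugate Γ Γ')
    {a b : UnitQuat} (hab : (a, b) ∈ Λ) : ∃ a' b', (a', b') ∈ Λ' ∧ re a' = re a ∧ re b' = re b := by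
  have := hc.1
  have := hc.2.1
  have : Finite Λ := Finite.of_injective _ (Subgroup.inclusion_injective h.le)
  by_cases h0 : re a = 0 ∧ re b = 0
  · by_contra! hcon
    obtain ⟨-, -, φ, hφ⟩ := almostConjugate_prod_iff.1 hc
    have hmem : ∀ γ : Λ', (φ.symm ⟨γ.1, h'.le γ.2⟩).1 ∈ Λ ∧
        (φ.symm ⟨γ.1, h'.le γ.2⟩).1 ≠ (a, b) := by
      rintro ⟨⟨c, d⟩, hγ⟩
      set δ := φ.symm ⟨(c, d), h'.le hγ⟩ with hδ
      have e : φ δ = ⟨(c, d), h'.le hγ⟩ := by rw [hδ, Equiv.apply_symm_apply]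
      have r := hφ δ
      rw [e] at r
      have key : ¬ (re δ.1.1 = 0 ∧ re δ.1.2 = 0) := by
        rintro ⟨p, q⟩
        exact hcon c d hγ (by rw [h0.1, ← p]; exact r.1) (by rw [h0.2, ← q]; exact r.2)
      constructor
      · by_contra hn
        exact key (h.re_eq_zero δ.2 hn)
      · intro hn
        rw [hn] at key
        exact key h0
    have hlt : Nat.card Λ' < Nat.card Λ := by
      have hss : {x : UnitQuat × UnitQuat | x ∈ Λ ∧ x ≠ (a, b)}.ncard <
          (Λ : Set (UnitQuat × UnitQuat)).ncard := by
        apply Set.ncard_lt_ncard _ (Set.toFinite _)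
        refine ⟨fun x hx => hx.1, fun hsub => ?_⟩
        exact (hsub hab).2 rfl
      refine lt_of_le_of_lt ?_ hss
      have : Finite {x : UnitQuat × UnitQuat | x ∈ Λ ∧ x ≠ (a, b)} :=
        Set.Finite.subset (Set.toFinite (Λ : Set (UnitQuat × UnitQuat))) fun x hx => hx.1
      refine Nat.card_le_card_of_injective (fun γ : Λ' =>
        (⟨_, hmem γ⟩ : {x : UnitQuat × UnitQuat | x ∈ Λ ∧ x ≠ (a, b)})) ?_
      intro x y hxy
      have := congrArg Subtype.val hxy
      have h9 := φ.symm.injective (Subtype.ext this)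
      exact Subtype.ext (Subtype.mk.inj h9)
    have e1 := h.card
    have e2 := h'.card
    have e3 := hc.card_eq
    omega
  · obtain ⟨a', b', h1, h2, h3⟩ := UnitQuat.exists_same_re hc (h.le hab)
    refine ⟨a', b', ?_, h2, h3⟩
    by_contra hn
    have := h'.re_eq_zero h1 hn
    rw [h2, h3] at this
    exact h0 this

/-- With everything in standard position, `torus_conjugate` makes Λ' equal to Λ. A pair of torus
elements, which centralizes Λ, then matches one element outside Λ' with one outside Λ; index two
leaves no further freedom. -/
theorem Aligned.conjugate (h : Aligned Γ Λ) (h' : Aligned Γ' Λ') (hc : AlmostConjugate Γ Γ') :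
    ConjugateSubgroups Γ Γ' := by
  obtain ⟨g1, p1, q1⟩ := h.dih1.exists_std
  obtain ⟨g2, p2, q2⟩ := h.dih2.exists_std
  obtain ⟨g1', p1', q1'⟩ := h'.dih1.exists_std
  obtain ⟨g2', p2', q2'⟩ := h'.dih2.exists_std
  apply ConjugateSubgroups.of_cj (g := (g1, g2)) (h := (g1', g2'))
  replace hc := hc.cj_cj (g1, g2) (g1', g2')
  replace h := h.cj (g1, g2)
  replace h' := h'.cj (g1', g2')
  rw [← pr1_cj (g1, g2), ← pr1_cj (g1, g2)] at q1
  rw [← pr2_cj (g1, g2), ← pr2_cj (g1, g2)] at q2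
  rw [← pr1_cj (g1', g2'), ← pr1_cj (g1', g2')] at q1'
  rw [← pr2_cj (g1', g2'), ← pr2_cj (g1', g2')] at q2'
  rw [← pr1_cj (g1, g2)] at p1
  rw [← pr2_cj (g1, g2)] at p2
  rw [← pr1_cj (g1', g2')] at p1'
  rw [← pr2_cj (g1', g2')] at p2'
  generalize Γ.cj (g1, g2) = Γ at *
  generalize Λ.cj (g1, g2) = Λ at *
  generalize Γ'.cj (g1', g2') = Γ' at *
  generalize Λ'.cj (g1', g2') = Λ' at *
  have := hc.1
  have := hc.2.1
  have : Finite Λ := Finite.of_injective _ (Subgroup.inclusion_injective h.le)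
  have : Finite Λ' := Finite.of_injective _ (Subgroup.inclusion_injective h'.le)
  obtain ⟨n, m, hn, hm, hnm⟩ := torus_conjugate p1 p2 p1' p2'
    (by have := h.card; have := h'.card; have := hc.card_eq; omega)
    (by rw [h.k2_eq, h'.k2_eq]; exact (almostConjugate_k2 hc).card_eq)
    (fun a b => h.exists_same_re h' hc)
  obtain ⟨a, b, hab, hab'⟩ := h.exists_notMem
  obtain ⟨c, d, hcd, hcd'⟩ := h'.exists_notMem
  have haJ := q1 a (mem_pr1.2 ⟨b, hab⟩) (h.notMem1 hab hab')
  have hbJ := q2 b (mem_pr2.2 ⟨a, hab⟩) (h.notMem2 hab hab')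
  have hcJ := q1' c (mem_pr1.2 ⟨d, hcd⟩) (h'.notMem1 hcd hcd')
  have hdJ := q2' d (mem_pr2.2 ⟨c, hcd⟩) (h'.notMem2 hcd hcd')
  obtain ⟨t, ht, htc⟩ := exists_torus_conj_torusJ (hn.conj_memJ hcJ) haJ
  obtain ⟨u, hu, hud⟩ := exists_torus_conj_torusJ (hm.conj_memJ hdJ) hbJ
  have hΛ : Λ.cj (t, u) = Λ := by
    have key : ∀ x ∈ Λ, (t, u) * x = x * (t, u) := by
      rintro ⟨x, y⟩ hxy
      exact Prod.ext (torus_comm ht (p1 (mem_pr1.2 ⟨y, hxy⟩)))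
        (torus_comm hu (p2 (mem_pr2.2 ⟨x, hxy⟩)))
    ext x
    rw [Subgroup.mem_cj]
    constructor
    · intro hx
      have := key _ hx
      rw [← mul_assoc, ← mul_assoc, mul_inv_cancel, one_mul] at this
      rw [mul_right_cancel this]
      exact hx
    · intro hx
      rwa [mul_assoc, ← key x hx, inv_mul_cancel_left]
  have h2 : Aligned ((Γ'.cj (n, m)).cj (t, u)) Λ := by
    have := (h'.cj (n, m)).cj (t, u)
    rwa [hnm, hΛ] at this
  have hab2 : (a, b) ∈ (Γ'.cj (n, m)).cj (t, u) := by
    have := conj_mem_cj_prod (g := t) (h := u) (conj_mem_cj_prod (g := n) (h := m) hcd)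
    rwa [htc, hud] at this
  have := Subgroup.eq_of_index_two h.le h2.le hab hab2 hab' h.mul_mem h2.mul_mem
  apply ConjugateSubgroups.of_cj_right (g := (n, m))
  apply ConjugateSubgroups.of_cj_right (g := (t, u))
  rw [← this]
  exact ConjugateSubgroups.refl _

end UnitQuat

/-! ### Kernels of index at most two in the projections. -/

section General
variable {G : Type*} [Group G]

theorem Subgroup.cj_eq_of_comm {L : Subgroup G} {t : G} (h : ∀ x ∈ L, t * x = x * t) : L.cj t = L := by
  ext x
  rw [Subgroup.mem_cj]
  constructor
  · intro hx
    have := h _ hx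
    rw [← mul_assoc, ← mul_assoc, mul_inv_cancel, one_mul] at this
    rw [mul_right_cancel this]
    exact hx
  · intro hx
    rwa [mul_assoc, ← h x hx, inv_mul_cancel_left]

/-- `K` is normalized by `A`. -/
def NormalIn (K A : Subgroup G) : Prop := ∀ a ∈ A, ∀ x ∈ K, a * x * a⁻¹ ∈ K

theorem NormalIn.cj {K A : Subgroup G} (h : NormalIn K A) (g : G) : NormalIn (K.cj g) (A.cj g) := by
  intro a ha x hx
  rw [Subgroup.mem_cj] at *
  have := h _ ha _ hx
  rwa [show g⁻¹ * (a * x * a⁻¹) * g = g⁻¹ * a * g * (g⁻¹ * x * g) * (g⁻¹ * a * g)⁻¹ by group]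

theorem NormalIn.inf {K K' A : Subgroup G} (h : NormalIn K A) (h' : NormalIn K' A) :
    NormalIn (K ⊓ K') A := fun a ha x hx => ⟨h a ha x hx.1, h' a ha x hx.2⟩

end General

namespace UnitQuat

/-- Both w and w' invert a noncentral element of L, so they lie in the same nontrivial coset of the
torus containing L. That torus commutes with L and acts transitively on the coset. -/
theorem Dih.exists_comm_conj {A A' L : Subgroup UnitQuat} (h : Dih A L) (h' : Dih A' L)
    {w w' : UnitQuat} (hw : w ∈ A) (hwL : w ∉ L) (hw' : w' ∈ A') (hwL' : w' ∉ L) :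
    ∃ t, (∀ x ∈ L, t * x = x * t) ∧ t * w * t⁻¹ = w' := by
  obtain ⟨g, hg1, hg2⟩ := h.exists_std
  obtain ⟨x, hx, hxp⟩ := SetLike.not_le_iff_exists.1 h.not_le_pm
  have hxt := hg1 (Subgroup.conj_mem_cj (g := g) hx)
  have hxp' : g * x * g⁻¹ ∉ pm := fun hc => hxp (conj_mem_pm.1 hc)
  have key : ∀ {B : Subgroup UnitQuat} {v : UnitQuat}, Dih B L → v ∈ B → v ∉ L →
      g * v * g⁻¹ ∈ torusJ := by
    intro B v hB hv hvL
    apply mem_torusJ_of_conj hxt hxp'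
    have := hB.conj_eq_inv hv hvL hx
    calc g * v * g⁻¹ * (g * x * g⁻¹) * (g * v * g⁻¹)⁻¹ = g * (v * x * v⁻¹) * g⁻¹ := by group
      _ = _ := by rw [this]; group
  obtain ⟨t, ht, htw⟩ := exists_torus_conj_torusJ (key h hw hwL) (key h' hw' hwL')
  refine ⟨g⁻¹ * t * g, fun y hy => ?_, ?_⟩
  · have := torus_comm ht (hg1 (Subgroup.conj_mem_cj (g := g) hy))
    calc g⁻¹ * t * g * y = g⁻¹ * (t * (g * y * g⁻¹)) * g := by group
      _ = _ := by rw [this]; group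
  · calc g⁻¹ * t * g * w * (g⁻¹ * t * g)⁻¹ = g⁻¹ * (t * (g * w * g⁻¹) * t⁻¹) * g := by group
      _ = _ := by rw [htw]; group

theorem Dih.inf {A L B : Subgroup UnitQuat} (h : Dih A L) (hB : B ≤ A) (hc : ¬ CommOn B) :
    Dih B (B ⊓ L) where
  le := inf_le_left
  comm := h.comm.mono inf_le_right
  not_comm := hc
  mul_mem := fun x hx y hy hx' hy' => ⟨B.mul_mem hx hy, h.mul_mem x (hB hx) y (hB hy)
    (fun hl => hx' ⟨hx, hl⟩) (fun hl => hy' ⟨hy, hl⟩)⟩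

/-- In a cyclic B the order determines the subgroup. In a dihedral B, commutative K and K' are both
cyclic parts of B, so dihedral conjugacy applies; noncommutative ones share the same intersection
with L, and matching one outer element by an element commuting with L also preserves B. -/
theorem exists_conj_normal {B K K' : Subgroup UnitQuat} [Finite B] (hK : K ≤ B) (hK' : K' ≤ B)
    (hn : NormalIn K B) (hn' : NormalIn K' B) (hc : Nat.card B ≤ 2 * Nat.card K)
    (h : AlmostConjugate K K') : ∃ g, B.cj g = B ∧ K'.cj g = K := by
  have := h.1
  have := h.2.1
  have hcc := h.card_eq
  by_cases hKB : Nat.card B = Nat.card K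
  · refine ⟨1, B.cj_one, ?_⟩
    rw [Subgroup.cj_one, Subgroup.eq_of_le_of_card_ge hK hKB.le,
      Subgroup.eq_of_le_of_card_ge hK' (by omega)]
  rcases commOn_or_dih_or_exc B with hB | ⟨L, hB⟩ | hB
  · exact ⟨1, B.cj_one, by rw [Subgroup.cj_one]; exact CommOn.eq_of_card hB hK' hK hcc.symm⟩
  · by_cases hKc : CommOn K
    · have hKc' : CommOn K' := commOn_of_conjugate hKc (commOn_conjugate hKc h)
      have d : ∀ {N : Subgroup UnitQuat}, N ≤ B → CommOn N → Nat.card N = Nat.card K → Dih B N :=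
        fun {N} hN hNc hcN => ⟨hN, hNc, hB.not_comm, fun x hx y hy hx' hy' =>
          Subgroup.mul_mem_of_card_le hN (by omega) hx hy hx' hy'⟩
      exact (d hK' hKc' hcc.symm).conjugate (d hK hKc rfl) hcc.symm
    · have hKc' : ¬ CommOn K' := fun hc => hKc
        (commOn_of_conjugate hc (commOn_conjugate hc h.symm))
      have d := hB.inf hK hKc
      have d' := hB.inf hK' hKc'
      have : Finite L := Finite.of_injective _ (Subgroup.inclusion_injective hB.le)
      have e : K' ⊓ L = K ⊓ L := by
        refine CommOn.eq_of_card hB.comm inf_le_right inf_le_right ?_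
        have := d.card
        have := d'.card
        omega
      rw [e] at d'
      obtain ⟨w, hw, hwL⟩ := d.exists_notMem
      obtain ⟨v, hv, hvL⟩ := d'.exists_notMem
      have hwL' : w ∉ L := fun hl => hwL ⟨hw, hl⟩
      have hvL' : v ∉ L := fun hl => hvL (e.le ⟨hv, hl⟩)
      obtain ⟨t, ht, htv⟩ := hB.exists_comm_conj hB (hK' hv) hvL' (hK hw) hwL'
      have hLt : L.cj t = L := Subgroup.cj_eq_of_comm ht
      have hKt : (K ⊓ L).cj t = K ⊓ L := Subgroup.cj_eq_of_comm fun x hx => ht x hx.2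
      have hBt := hB.cj t
      have hd := d'.cj t
      rw [hLt] at hBt
      rw [hKt] at hd
      refine ⟨t, ?_, ?_⟩
      · refine hBt.eq_of_mem hB (w := w) ?_ (hK hw) hwL'
        rw [← htv]
        exact Subgroup.conj_mem_cj (hK' hv)
      · refine hd.eq_of_mem d (w := w) ?_ hw hwL
        rw [← htv]
        exact Subgroup.conj_mem_cj hv
  -- In the exceptional case K has order 24. The intersection of K and K' is normal and has index at
  -- most two in K, so its order is at least 12; the list of normal subgroups makes it 24, and K =
  -- K'.
  · have hpm : ∀ {N : Subgroup UnitQuat}, N ≤ pm → Nat.card N ≤ 2 := fun hN => by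
      rcases le_pm_cases hN with h | h <;> omega
    have hI : Nat.card K ≤ 2 * Nat.card (K ⊓ K' : Subgroup UnitQuat) := by
      by_cases hKK : K ≤ K'
      · rw [inf_eq_left.2 hKK]; omega
      obtain ⟨w, hw, hw'⟩ := SetLike.not_le_iff_exists.1 hKK
      refine (Subgroup.card_eq_two_mul inf_le_left (fun x hx y hy hx' hy' => ⟨K.mul_mem hx hy, ?_⟩)
        hw (fun h => hw' h.2)).le
      exact Subgroup.mul_mem_of_card_le hK' (by omega) (hK hx) (hK hy)
        (fun h => hx' ⟨hx, h⟩) (fun h => hy' ⟨hy, h⟩)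
    have := hB.card
    have hIle := Subgroup.card_le_of_le (inf_le_left : K ⊓ K' ≤ K)
    have hK24 : Nat.card K = 24 := by
      rcases hB.normal_cases hK hn with h1 | h1 | ⟨-, h1 | h1⟩
      · have := hpm h1; omega
      · omega
      · rw [h1] at hKB; exact absurd rfl hKB
      · exact h1.2
    have hI24 : Nat.card (K ⊓ K' : Subgroup UnitQuat) = 24 := by
      rcases hB.normal_cases (inf_le_left.trans hK) (hn.inf hn') with h1 | h1 | ⟨-, h1 | h1⟩
      · have := hpm h1; omega
      · omega
      · rw [h1] at hIle; omega
      · exact h1.2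
    refine ⟨1, B.cj_one, ?_⟩
    rw [Subgroup.cj_one, ← Subgroup.eq_of_le_of_card_ge (inf_le_left : K ⊓ K' ≤ K) (by omega)]
    exact (Subgroup.eq_of_le_of_card_ge inf_le_right (by omega)).symm

variable {Γ Γ' Λ Λ' : Subgroup (UnitQuat × UnitQuat)}

theorem exists_conj_pr1_k1 (h : AlmostConjugate Γ Γ')
    (hc : Nat.card (pr1 Γ) ≤ 2 * Nat.card (k1 Γ)) :
    ∃ g, (pr1 Γ').cj g = pr1 Γ ∧ (k1 Γ').cj g = k1 Γ := by
  have := h.1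
  obtain ⟨g, hg⟩ := (conjugate_of_almostConjugate (almostConjugate_pr1 h)).symm
  obtain ⟨k, hk1, hk2⟩ := exists_conj_normal (K := k1 Γ) (K' := (k1 Γ').cj g) (k1_le_pr1 Γ)
    (hg.le.trans' (Subgroup.cj_mono (k1_le_pr1 Γ')))
    (fun a ha x hx => k1_normal ha hx) (by
      have : NormalIn (k1 Γ') (pr1 Γ') := fun a ha x hx => k1_normal ha hx
      have := this.cj g
      rwa [show (pr1 Γ').cj g = pr1 Γ from hg] at this) hc ((almostConjugate_k1 h).cj_right g)
  refine ⟨k * g, ?_, ?_⟩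
  · rw [← Subgroup.cj_cj, show (pr1 Γ').cj g = pr1 Γ from hg, hk1]
  · rw [← Subgroup.cj_cj, hk2]

/-- The indices of the kernels in the projections coincide, because both products of orders count Γ.
-/
theorem card_pr2_le [Finite Γ] (hc : Nat.card (pr1 Γ) ≤ 2 * Nat.card (k1 Γ)) :
    Nat.card (pr2 Γ) ≤ 2 * Nat.card (k2 Γ) := by
  have h1 := card_eq_pr1_mul_k2 Γ
  have h2 := card_eq_pr2_mul_k1 Γ
  have h3 : 0 < Nat.card (k1 Γ) := Nat.card_pos
  rw [h1] at h2
  by_contra! hlt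
  have : Nat.card (pr1 Γ) * Nat.card (k2 Γ) < Nat.card (pr2 Γ) * Nat.card (k1 Γ) := by
    calc _ ≤ 2 * Nat.card (k1 Γ) * Nat.card (k2 Γ) := Nat.mul_le_mul_right _ hc
      _ = 2 * Nat.card (k2 Γ) * Nat.card (k1 Γ) := by ring
      _ < _ := Nat.mul_lt_mul_of_pos_right hlt h3
  omega

/-- Groups of order at most two have a unique isomorphism between them. Once projections and kernels
are aligned, the gluing is therefore the same for both groups. -/
theorem conjugate_of_card_le (h : AlmostConjugate Γ Γ')
    (hc : Nat.card (pr1 Γ) ≤ 2 * Nat.card (k1 Γ)) : ConjugateSubgroups Γ Γ' := by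
  have := h.1
  have := h.2.1
  have hc2 := card_pr2_le hc
  obtain ⟨g, hg1, hg2⟩ := exists_conj_pr1_k1 h hc
  obtain ⟨k, hk1, hk2⟩ := exists_conj_pr1_k1 (Γ := swap Γ) (Γ' := swap Γ') (almostConjugate_swap h)
    (by rwa [pr1_swap, k1_swap])
  rw [pr1_swap, pr1_swap] at hk1
  rw [k1_swap, k1_swap] at hk2
  apply ConjugateSubgroups.of_cj_right (g := (g, k))
  have hcc : Nat.card Γ = Nat.card (Γ'.cj (g, k)) := by rw [Subgroup.card_cj, h.card_eq]
  have e1 : pr1 (Γ'.cj (g, k)) = pr1 Γ := by rw [pr1_cj]; exact hg1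
  have e2 : k1 (Γ'.cj (g, k)) = k1 Γ := by rw [k1_cj]; exact hg2
  have e3 : pr2 (Γ'.cj (g, k)) = pr2 Γ := by rw [pr2_cj]; exact hk1
  have e4 : k2 (Γ'.cj (g, k)) = k2 Γ := by rw [k2_cj]; exact hk2
  generalize Γ'.cj (g, k) = Δ at *
  have : Finite Δ := Nat.finite_of_card_ne_zero (by rw [← hcc]; exact Nat.card_pos.ne')
  have nk : ∀ {Δ : Subgroup (UnitQuat × UnitQuat)} {a b : UnitQuat}, (a, b) ∈ Δ → a ∉ k1 Δ →
      b ∉ k2 Δ := by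
    intro Δ a b hab ha hb
    apply ha
    have := Δ.mul_mem hab (Δ.inv_mem (mem_k2.1 hb))
    simpa [mem_k1] using this
  rw [eq_of_lifts hcc _ e4.ge]
  · exact ConjugateSubgroups.refl _
  · intro a ha
    by_cases hak : a ∈ k1 Γ
    · exact mem_pr1.2 ⟨1, hak, e2.ge hak⟩
    · obtain ⟨b, hb⟩ := mem_pr1.1 ha
      obtain ⟨b', hb'⟩ := mem_pr1.1 (e1.ge ha)
      have h1 := nk hb hak
      have h2 := nk hb' (by rwa [e2])
      rw [e4] at h2
      have h3 := Subgroup.mul_mem_of_card_le (k2_le_pr2 Γ) hc2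
        (Subgroup.inv_mem _ (e3.le (mem_pr2.2 ⟨a, hb'⟩))) (mem_pr2.2 ⟨a, hb⟩)
        (fun h => h2 (by simpa using Subgroup.inv_mem _ h)) h1
      rw [← e4, mem_k2] at h3
      refine mem_pr1.2 ⟨b, hb, ?_⟩
      simpa using Δ.mul_mem hb' h3

end UnitQuat

/-! ### Commutative with dihedral, and dihedral with dihedral projections. -/

namespace UnitQuat

variable {Γ Γ' Λ Λ' : Subgroup (UnitQuat × UnitQuat)}

theorem Dih.mul_inv_mem {A L : Subgroup UnitQuat} (h : Dih A L) {x y : UnitQuat} (hx : x ∈ A)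
    (hx' : x ∉ L) (hy : y ∈ A) (hy' : y ∉ L) : x * y⁻¹ ∈ L :=
  h.mul_mem x hx y⁻¹ (A.inv_mem hy) hx' (fun hi => hy' (by simpa using L.inv_mem hi))

theorem dih_zpowers {B : Subgroup UnitQuat} [Finite B] {z : UnitQuat} (hB : ¬ CommOn B) (hz : z ∈ B)
    (hc : Nat.card B ≤ 2 * orderOf z) : Dih B (Subgroup.zpowers z) where
  le := Subgroup.zpowers_le.2 hz
  comm := commOn_zpowers z
  not_comm := hB
  mul_mem := fun _ hx _ hy hx' hy' => Subgroup.mul_mem_of_card_le (Subgroup.zpowers_le.2 hz)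
    (by rwa [Nat.card_zpowers]) hx hy hx' hy'

theorem zpow_mem_prod {a z : UnitQuat} (h : (a, z) ∈ Γ) (k : ℤ) : (a ^ k, z ^ k) ∈ Γ :=
  Γ.zpow_mem h k

/-- The case of a commutative first and a dihedral second projection, once a generator of the
cyclic subgroup of index two has been matched. -/
theorem conjugate_of_comm_dih_of_mem (h : AlmostConjugate Γ Γ') {a z : UnitQuat}
    (hA : pr1 Γ' = pr1 Γ) (hAc : CommOn (pr1 Γ)) (haz : (a, z) ∈ Γ) (haz' : (a, z) ∈ Γ')
    (hB : Dih (pr2 Γ) (Subgroup.zpowers z)) (hB' : Dih (pr2 Γ') (Subgroup.zpowers z)) :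
    ConjugateSubgroups Γ Γ' := by
  have := h.1
  have := h.2.1
  have hk1 : k1 Γ = k1 Γ' := CommOn.eq_of_card hAc (k1_le_pr1 Γ) (hA ▸ k1_le_pr1 Γ')
    (almostConjugate_k1 h).card_eq
  have hk2 := (almostConjugate_k2 h).card_eq
  obtain ⟨w, hw, hwM⟩ := hB.exists_notMem
  obtain ⟨s, hsw⟩ := mem_pr2.1 hw
  -- Γ' needs an outer element over the same s. If the given v is a power of z, then `k2 Γ` reaches
  -- outside ⟨z⟩. So does `k2 Γ'`: otherwise it would lie in `k2 Γ` and equal it by order.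
  -- Multiplying v by an outer element of `k2 Γ'` repairs the choice.
  obtain ⟨v, hsv, hvM⟩ : ∃ v, (s, v) ∈ Γ' ∧ v ∉ Subgroup.zpowers z := by
    obtain ⟨v, hsv⟩ := mem_pr1.1 (hA.ge (mem_pr1.2 ⟨w, hsw⟩))
    by_cases hv : v ∈ Subgroup.zpowers z
    swap
    · exact ⟨v, hsv, hv⟩
    obtain ⟨k, rfl⟩ := hv
    have h1 : (s⁻¹ * a ^ k, 1) ∈ Γ := hk1.ge (div_mem_k1 hsv (zpow_mem_prod haz' k))
    have h2 : (a ^ k, w) ∈ Γ := by simpa using Γ.mul_mem hsw h1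
    have h3 : (z ^ k)⁻¹ * w ∈ k2 Γ := div_mem_k2 (zpow_mem_prod haz k) h2
    obtain ⟨u, hu, huM⟩ : ∃ u ∈ k2 Γ', u ∉ Subgroup.zpowers z := by
      by_contra! hcon
      have hle : k2 Γ' ≤ k2 Γ := by
        intro u hu
        obtain ⟨j, rfl⟩ := hcon u hu
        have h5 : a ^ j ∈ k1 Γ' := by
          have := Γ'.mul_mem (zpow_mem_prod haz' j) (Γ'.inv_mem (mem_k2.1 hu))
          simpa [mem_k1] using this
        rw [← hk1] at h5
        have := Γ.mul_mem (zpow_mem_prod haz j) (Γ.inv_mem (mem_k1.1 h5))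
        simpa [mem_k2] using this
      have := Subgroup.eq_of_le_of_card_ge hle hk2.le
      rw [← this] at h3
      refine hwM ?_
      have := (Subgroup.zpowers z).mul_mem (Subgroup.zpow_mem_zpowers z k) (hcon _ h3)
      simpa using this
    refine ⟨z ^ k * u, by simpa using Γ'.mul_mem hsv hu, fun hc => huM ?_⟩
    have := (Subgroup.zpowers z).mul_mem
      ((Subgroup.zpowers z).inv_mem (Subgroup.zpow_mem_zpowers z k)) hc
    simpa using this
  obtain ⟨t, ht, htv⟩ := hB'.exists_comm_conj hB (mem_pr2.2 ⟨s, hsv⟩) hvM hw hwM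
  apply ConjugateSubgroups.of_cj_right (g := (1, t))
  have e1 : (a, z) ∈ Γ'.cj (1, t) := by
    have := conj_mem_cj_prod (g := 1) (h := t) haz'
    rwa [ht z (Subgroup.mem_zpowers z), mul_inv_cancel_right, one_mul, inv_one, mul_one] at this
  have e2 : (s, w) ∈ Γ'.cj (1, t) := by
    have := conj_mem_cj_prod (g := 1) (h := t) hsv
    rwa [htv, one_mul, inv_one, mul_one] at this
  rw [eq_of_lifts' (Γ := Γ) (Γ' := Γ'.cj (1, t)) (by rw [Subgroup.card_cj, h.card_eq])]
  · exact ConjugateSubgroups.refl _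
  · have hM : ∀ y ∈ Subgroup.zpowers z, y ∈ pr2 (Γ ⊓ Γ'.cj (1, t)) := by
      rintro _ ⟨k, rfl⟩
      exact mem_pr2.2 ⟨a ^ k, zpow_mem_prod haz k, zpow_mem_prod e1 k⟩
    intro y hy
    by_cases hyM : y ∈ Subgroup.zpowers z
    · exact hM y hyM
    · have := (pr2 (Γ ⊓ Γ'.cj (1, t))).mul_mem (hM _ (hB.mul_inv_mem hy hyM hw hwM))
        (mem_pr2.2 ⟨s, hsw, e2⟩)
      simpa using this
  · rw [k1_cj, hk1]
    exact (Subgroup.cj_one _).ge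

theorem conjugate_of_comm_dih (h : AlmostConjugate Γ Γ') {M : Subgroup UnitQuat}
    (hA : CommOn (pr1 Γ)) (hB : Dih (pr2 Γ) M) : ConjugateSubgroups Γ Γ' := by
  have := h.1
  have := h.2.1
  have : Finite M := Finite.of_injective _ (Subgroup.inclusion_injective hB.le)
  obtain ⟨z, rfl⟩ := CommOn.exists_zpowers hB.comm
  have hzM := Subgroup.mem_zpowers z
  obtain ⟨a, haz⟩ := mem_pr2.1 (hB.le hzM)
  by_cases hz : re z = 0
  -- Here all squares in `pr2 Γ` are 1 or -1. Since the first coordinates commute, the commutator of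
  -- lifts of w and z is (1, -1), so -1 lies in `k2`. Hence the square of a generator of `pr1 Γ`
  -- lies in `k1`, which then has index at most two.
  · apply conjugate_of_card_le h
    have hz2 := sq_eq_neg_one_iff.2 hz
    have hpr : ∀ b ∈ pr2 Γ, b ^ 2 ∈ pm := by
      intro b hb
      by_cases hbM : b ∈ Subgroup.zpowers z
      · obtain ⟨k, rfl⟩ := hbM
        show (z ^ k) ^ 2 ∈ pm
        rw [← zpow_natCast, zpow_comm, zpow_natCast, hz2]
        exact pm.zpow_mem neg_one_mem_pm k
      · rw [sq_eq_neg_one_iff.2 (hB.re_eq_zero hb hbM)]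
        exact neg_one_mem_pm
    have hneg : (-1 : UnitQuat) ∈ k2 Γ := by
      obtain ⟨w, hw, hwM⟩ := hB.exists_notMem
      obtain ⟨s, hs⟩ := mem_pr2.1 hw
      have h1 := Γ.mul_mem (Γ.mul_mem (Γ.mul_mem hs haz) (Γ.inv_mem hs)) (Γ.inv_mem haz)
      have e : s * a * s⁻¹ * a⁻¹ = 1 := by
        rw [hA s (mem_pr1.2 ⟨_, hs⟩) a (mem_pr1.2 ⟨_, haz⟩)]; group
      have e2 : w * z * w⁻¹ * z⁻¹ = -1 := by
        rw [hB.conj_eq_inv hw hwM hzM, ← mul_inv_rev, ← pow_two, hz2]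
        rw [inv_eq_iff_mul_eq_one]; simp
      simpa [mem_k2, e, e2] using h1
    obtain ⟨x, hx⟩ := CommOn.exists_zpowers hA
    obtain ⟨b, hxb⟩ := mem_pr1.1 (hx.ge (Subgroup.mem_zpowers x))
    refine Subgroup.card_le_of_sq_mem hx (k1_le_pr1 Γ) ?_
    have h2 : b ^ 2 ∈ k2 Γ := by
      rcases hpr b (mem_pr2.2 ⟨x, hxb⟩) with h3 | h3 <;> rw [h3]
      · exact one_mem _
      · exact hneg
    have := Γ.mul_mem (Γ.pow_mem hxb 2) (Γ.inv_mem (mem_k2.1 h2))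
    simpa [mem_k1] using this
  · have hcB := (almostConjugate_pr2 h).card_eq
    have hcA := (almostConjugate_pr1 h).card_eq
    have hA' : CommOn (pr1 Γ') := commOn_of_conjugate hA
      (commOn_conjugate hA (almostConjugate_pr1 h))
    have hBn : ¬ CommOn (pr2 Γ') := fun hc => hB.not_comm (commOn_of_conjugate hc
      (commOn_conjugate hc (almostConjugate_pr2 h).symm))
    obtain ⟨a', z', haz', ha', hz'⟩ := exists_same_re h haz
    have hB' : Dih (pr2 Γ') (Subgroup.zpowers z') := by
      refine dih_zpowers hBn (mem_pr2.2 ⟨a', haz'⟩) ?_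
      rw [orderOf_eq_of_re hz', ← hcB, hB.card, Nat.card_zpowers]
    obtain ⟨g, hg⟩ := CommOn.exists_le_torus hA
    obtain ⟨g', hg'⟩ := CommOn.exists_le_torus hA'
    obtain ⟨n, hn, hna⟩ := exists_normalizer_conj
      (hg' (Subgroup.conj_mem_cj (mem_pr1.2 ⟨z', haz'⟩)))
      (hg (Subgroup.conj_mem_cj (mem_pr1.2 ⟨z, haz⟩))) (by rw [re_conj, re_conj, ha'])
    obtain ⟨k, hk⟩ := exists_conj hz'
    apply ConjugateSubgroups.of_cj (g := (g, 1)) (h := (n * g', k))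
    have e1 : (g * a * g⁻¹, z) ∈ Γ.cj (g, 1) := by
      have := conj_mem_cj_prod (g := g) (h := 1) haz
      rwa [one_mul, inv_one, mul_one] at this
    have e2 : (g * a * g⁻¹, z) ∈ Γ'.cj (n * g', k) := by
      have := conj_mem_cj_prod (g := n * g') (h := k) haz'
      rwa [hk, show n * g' * a' * (n * g')⁻¹ = n * (g' * a' * g'⁻¹) * n⁻¹ by group, hna] at this
    refine conjugate_of_comm_dih_of_mem (h.cj_cj _ _) ?_ ?_ e1 e2 ?_ ?_
    · rw [pr1_cj, pr1_cj, ← Subgroup.cj_cj, hn.cj_eq hg']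
      exact torus_eq_of_card hg' hg (by rw [Subgroup.card_cj, Subgroup.card_cj, hcA])
    · rw [pr1_cj]; exact hA.cj g
    · rw [pr2_cj, Subgroup.cj_one]; exact hB
    · rw [pr2_cj]
      have := hB'.cj k
      rwa [Subgroup.cj_zpowers, hk] at this

/-- If y ∈ K lies outside L, its commutator with a generator z of L is z² ∈ K. Then K ∩ L has index
at most two in L and index two in K, so K has at least half the order of A. -/
theorem Dih.normal_le {A L K : Subgroup UnitQuat} [Finite A] (h : Dih A L) (hK : K ≤ A)
    (hn : NormalIn K A) (hc : 2 * Nat.card K < Nat.card A) : K ≤ L := by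
  have : Finite L := Finite.of_injective _ (Subgroup.inclusion_injective h.le)
  by_contra hcon
  obtain ⟨y, hy, hyL⟩ := SetLike.not_le_iff_exists.1 hcon
  obtain ⟨z, hz⟩ := CommOn.exists_zpowers h.comm
  have hzL : z ∈ L := hz.ge (Subgroup.mem_zpowers z)
  have h1 : z ^ 2 ∈ K ⊓ L := by
    refine ⟨?_, L.pow_mem hzL 2⟩
    have h2 := h.conj_eq_inv (hK hy) hyL (L.inv_mem hzL)
    have h3 := K.mul_mem (hn z (h.le hzL) y hy) (K.inv_mem hy)
    rwa [show z * y * z⁻¹ * y⁻¹ = z * (y * z⁻¹ * y⁻¹) by group, h2, inv_inv, ← pow_two] at h3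
  have h2 := Subgroup.card_le_of_sq_mem hz inf_le_right h1
  have h3 := Subgroup.card_eq_two_mul (inf_le_left : K ⊓ L ≤ K)
    (fun a ha b hb ha' hb' => ⟨K.mul_mem ha hb, h.mul_mem a (hK ha) b (hK hb)
      (fun hl => ha' ⟨ha, hl⟩) (fun hl => hb' ⟨hb, hl⟩)⟩) hy (fun hl => hyL hl.2)
  have := h.card
  omega

/-- The projections of `Γ` are dihedral with cyclic parts `L` and `M`, which do not correspond to
each other. -/
structure Unaligned (Γ : Subgroup (UnitQuat × UnitQuat)) (L M : Subgroup UnitQuat) : Prop where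
  dih1 : Dih (pr1 Γ) L
  dih2 : Dih (pr2 Γ) M
  k1_le : k1 Γ ≤ L
  k2_le : k2 Γ ≤ M
  exists1 : ∃ a b, (a, b) ∈ Γ ∧ a ∈ L ∧ b ∉ M
  exists2 : ∃ a b, (a, b) ∈ Γ ∧ a ∉ L ∧ b ∈ M

variable {L M L' M' : Subgroup UnitQuat}

theorem Unaligned.swap (h : Unaligned Γ L M) : Unaligned (swap Γ) M L where
  dih1 := by rw [pr1_swap]; exact h.dih2
  dih2 := by rw [pr2_swap]; exact h.dih1
  k1_le := h.k2_le
  k2_le := h.k1_le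
  exists1 := by obtain ⟨a, b, h1, h2, h3⟩ := h.exists2; exact ⟨b, a, h1, h3, h2⟩
  exists2 := by obtain ⟨a, b, h1, h2, h3⟩ := h.exists1; exact ⟨b, a, h1, h3, h2⟩

theorem conj_mem_cj_iff {g a : UnitQuat} {A : Subgroup UnitQuat} : g * a * g⁻¹ ∈ A.cj g ↔ a ∈ A := by
  rw [Subgroup.mem_cj]
  simp [mul_assoc]

theorem Unaligned.cj (h : Unaligned Γ L M) (g k : UnitQuat) :
    Unaligned (Γ.cj (g, k)) (L.cj g) (M.cj k) where
  dih1 := by rw [pr1_cj]; exact h.dih1.cj g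
  dih2 := by rw [pr2_cj]; exact h.dih2.cj k
  k1_le := by rw [k1_cj]; exact Subgroup.cj_mono h.k1_le
  k2_le := by rw [k2_cj]; exact Subgroup.cj_mono h.k2_le
  exists1 := by
    obtain ⟨a, b, h1, h2, h3⟩ := h.exists1
    exact ⟨_, _, conj_mem_cj_prod h1, conj_mem_cj_iff.2 h2, fun hc => h3 (conj_mem_cj_iff.1 hc)⟩
  exists2 := by
    obtain ⟨a, b, h1, h2, h3⟩ := h.exists2
    exact ⟨_, _, conj_mem_cj_prod h1, fun hc => h2 (conj_mem_cj_iff.1 hc), conj_mem_cj_iff.2 h3⟩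

/-- If a lift of the generator x of L had second coordinate in M, then, as `k2 Γ ≤ M`, every lift of
every element of L would have it there. -/
theorem Unaligned.notMem {x w : UnitQuat} (h : Unaligned Γ (Subgroup.zpowers x) M)
    (hxw : (x, w) ∈ Γ) : w ∉ M := by
  intro hw
  obtain ⟨_, b, hab, ⟨k, rfl⟩, hb⟩ := h.exists1
  apply hb
  have := M.mul_mem (M.zpow_mem hw k) (h.k2_le (div_mem_k2 (zpow_mem_prod hxw k) hab))
  rwa [mul_inv_cancel_left] at this

/-- The index bound puts the kernels into the cyclic parts. If L and M correspond, the part of Γ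
over L is the required Λ. If not, a mismatch of one type multiplied by an outer element gives a
mismatch of the other type. -/
theorem aligned_or_unaligned [Finite Γ] (h1 : Dih (pr1 Γ) L) (h2 : Dih (pr2 Γ) M)
    (hc : 2 * Nat.card (k1 Γ) < Nat.card (pr1 Γ)) :
    (∃ Λ, Aligned Γ Λ) ∨ Unaligned Γ L M := by
  have hc2 : 2 * Nat.card (k2 Γ) < Nat.card (pr2 Γ) := by
    by_contra! hle
    have := card_pr2_le (Γ := UnitQuat.swap Γ) (by rwa [pr1_swap, k1_swap])
    rw [pr2_swap, k2_swap] at this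
    omega
  have hk1 := h1.normal_le (k1_le_pr1 Γ) (fun a ha x hx => k1_normal ha hx) hc
  have hk2 := h2.normal_le (k2_le_pr2 Γ) (fun a ha x hx => k2_normal ha hx) hc2
  by_cases hal : ∀ a b, (a, b) ∈ Γ → (a ∈ L ↔ b ∈ M)
  · left
    refine ⟨Γ ⊓ L.comap (MonoidHom.fst _ _), inf_le_left, ?_, ?_, h1.not_comm, h2.not_comm, ?_⟩
    · refine h1.comm.mono fun a ha => ?_
      obtain ⟨b, hb⟩ := mem_pr1.1 ha
      exact hb.2
    · refine h2.comm.mono fun b hb => ?_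
      obtain ⟨a, ha⟩ := mem_pr2.1 hb
      exact (hal a b ha.1).1 ha.2
    · rintro ⟨a, b⟩ hx ⟨c, d⟩ hy hx' hy'
      exact ⟨Γ.mul_mem hx hy, h1.mul_mem a (mem_pr1.2 ⟨b, hx⟩) c (mem_pr1.2 ⟨d, hy⟩)
        (fun hl => hx' ⟨hx, hl⟩) (fun hl => hy' ⟨hy, hl⟩)⟩
  · right
    have key : ∀ {Γ : Subgroup (UnitQuat × UnitQuat)} {L M : Subgroup UnitQuat}, Dih (pr1 Γ) L →
        Dih (pr2 Γ) M → (∃ a b, (a, b) ∈ Γ ∧ a ∈ L ∧ b ∉ M) → ∃ a b, (a, b) ∈ Γ ∧ a ∉ L ∧ b ∈ M := by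
      rintro Γ L M h1 h2 ⟨a, b, hab, ha, hb⟩
      obtain ⟨c, hcA, hcL⟩ := h1.exists_notMem
      obtain ⟨d, hcd⟩ := mem_pr1.1 hcA
      by_cases hd : d ∈ M
      · exact ⟨c, d, hcd, hcL, hd⟩
      · refine ⟨a * c, b * d, Γ.mul_mem hab hcd, fun hac => hcL ?_,
          h2.mul_mem b (mem_pr2.2 ⟨a, hab⟩) d (mem_pr2.2 ⟨c, hcd⟩) hb hd⟩
        simpa using L.mul_mem (L.inv_mem ha) hac
    have key2 : (∃ a b, (a, b) ∈ Γ ∧ a ∉ L ∧ b ∈ M) → ∃ a b, (a, b) ∈ Γ ∧ a ∈ L ∧ b ∉ M := by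
      rintro ⟨a, b, p, q, r⟩
      obtain ⟨b, a, p, q, r⟩ := key (Γ := UnitQuat.swap Γ) (L := M) (M := L) (by rwa [pr1_swap])
        (by rwa [pr2_swap]) ⟨b, a, p, r, q⟩
      exact ⟨a, b, p, r, q⟩
    push Not at hal
    obtain ⟨a, b, hab, h3⟩ := hal
    rcases h3 with ⟨h3, h4⟩ | ⟨h3, h4⟩
    · exact ⟨h1, h2, hk1, hk2, ⟨a, b, hab, h3, h4⟩, key h1 h2 ⟨a, b, hab, h3, h4⟩⟩
    · exact ⟨h1, h2, hk1, hk2, key2 ⟨a, b, hab, h3, h4⟩, ⟨a, b, hab, h3, h4⟩⟩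

/-- Generators x of L and z of M have lifts (x, w) and (y, z) with w ∉ M and y ∉ L. One element
centralizing L matches the y's while another centralizing M matches the w's, independently of each
other; x and y then generate `pr1`. -/
theorem Unaligned.conjugate (h : Unaligned Γ L M) (h' : Unaligned Γ' L' M')
    (hc : AlmostConjugate Γ Γ') : ConjugateSubgroups Γ Γ' := by
  have := hc.1
  have := hc.2.1
  obtain ⟨g, hg1, hg2⟩ := h'.dih1.conjugate h.dih1 (by
    have := h.dih1.card; have := h'.dih1.card; have := (almostConjugate_pr1 hc).card_eq; omega)
  obtain ⟨k, hk1, hk2⟩ := h'.dih2.conjugate h.dih2 (by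
    have := h.dih2.card; have := h'.dih2.card; have := (almostConjugate_pr2 hc).card_eq; omega)
  apply ConjugateSubgroups.of_cj_right (g := (g, k))
  replace h' := h'.cj g k
  replace hc := hc.cj_right (g, k)
  have hA : pr1 (Γ'.cj (g, k)) = pr1 Γ := by rw [pr1_cj]; exact hg1
  have hB : pr2 (Γ'.cj (g, k)) = pr2 Γ := by rw [pr2_cj]; exact hk1
  rw [hg2, hk2] at h'
  generalize Γ'.cj (g, k) = Γ' at *
  have : Finite L := Finite.of_injective _ (Subgroup.inclusion_injective h.dih1.le)
  have : Finite M := Finite.of_injective _ (Subgroup.inclusion_injective h.dih2.le)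
  obtain ⟨x, rfl⟩ := CommOn.exists_zpowers h.dih1.comm
  obtain ⟨z, rfl⟩ := CommOn.exists_zpowers h.dih2.comm
  have hxA := h.dih1.le (Subgroup.mem_zpowers x)
  have hzB := h.dih2.le (Subgroup.mem_zpowers z)
  obtain ⟨w, hw⟩ := mem_pr1.1 hxA
  obtain ⟨w', hw'⟩ := mem_pr1.1 (hA.ge hxA)
  obtain ⟨y, hy⟩ := mem_pr2.1 hzB
  obtain ⟨y', hy'⟩ := mem_pr2.1 (hB.ge hzB)
  have hyL := h.swap.notMem hy
  obtain ⟨t, ht, htw⟩ := h'.dih2.exists_comm_conj h.dih2 (mem_pr2.2 ⟨_, hw'⟩) (h'.notMem hw')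
    (mem_pr2.2 ⟨_, hw⟩) (h.notMem hw)
  obtain ⟨s, hs, hsy⟩ := h'.dih1.exists_comm_conj h.dih1 (mem_pr1.2 ⟨_, hy'⟩) (h'.swap.notMem hy')
    (mem_pr1.2 ⟨_, hy⟩) hyL
  have e1 : (x, w) ∈ Γ'.cj (s, t) := by
    have := conj_mem_cj_prod (g := s) (h := t) hw'
    rwa [htw, hs x (Subgroup.mem_zpowers x), mul_inv_cancel_right] at this
  have e2 : (y, z) ∈ Γ'.cj (s, t) := by
    have := conj_mem_cj_prod (g := s) (h := t) hy'
    rwa [hsy, ht z (Subgroup.mem_zpowers z), mul_inv_cancel_right] at this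
  apply ConjugateSubgroups.of_cj_right (g := (s, t))
  have := hc.2.1
  rw [eq_of_lifts (Γ := Γ) (Γ' := Γ'.cj (s, t)) (by rw [Subgroup.card_cj, hc.card_eq])]
  · exact ConjugateSubgroups.refl _
  · have hL : ∀ l ∈ Subgroup.zpowers x, l ∈ pr1 (Γ ⊓ Γ'.cj (s, t)) := by
      rintro _ ⟨j, rfl⟩
      exact mem_pr1.2 ⟨w ^ j, zpow_mem_prod hw j, zpow_mem_prod e1 j⟩
    intro a ha
    by_cases haL : a ∈ Subgroup.zpowers x
    · exact hL a haL
    · have := (pr1 (Γ ⊓ Γ'.cj (s, t))).mul_mem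
        (hL _ (h.dih1.mul_inv_mem ha haL (mem_pr1.2 ⟨_, hy⟩) hyL)) (mem_pr1.2 ⟨z, hy, e2⟩)
      simpa using this
  · rw [k2_cj, Subgroup.cj_eq_of_comm fun x hx => ht x (h'.k2_le hx)]
    exact (CommOn.eq_of_card h.dih2.comm h.k2_le h'.k2_le (almostConjugate_k2 hc).card_eq).le

/-- Here L has order 4 and a quaternion group of order 8 has other cyclic subgroups of index two:
the part of Γ over M serves instead. Were its first projection noncommutative, it would contain a
noncentral power of x, hence x itself, contrary to `Unaligned.notMem`. -/
theorem Unaligned.aligned_of_re_eq_zero {x : UnitQuat} (h : Unaligned Γ (Subgroup.zpowers x) M)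
    (hx : re x = 0) : Aligned Γ (Γ ⊓ M.comap (MonoidHom.snd _ _)) where
  le := inf_le_left
  comm1 := by
    by_contra hn
    have hle : pr1 (Γ ⊓ M.comap (MonoidHom.snd _ _)) ≤ pr1 Γ := by
      intro a ha
      obtain ⟨b, hb⟩ := mem_pr1.1 ha
      exact mem_pr1.2 ⟨b, hb.1⟩
    obtain ⟨l, ⟨hl, k, rfl⟩, hlp⟩ := SetLike.not_le_iff_exists.1 (h.dih1.inf hle hn).not_le_pm
    have hx2 := sq_eq_neg_one_iff.2 hx
    have hxm : x ∈ pr1 (Γ ⊓ M.comap (MonoidHom.snd _ _)) := by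
      have hpw : ∀ j : ℤ, x ^ (2 * j) ∈ pm := fun j => by
        rw [zpow_mul, zpow_ofNat, hx2]; exact pm.zpow_mem neg_one_mem_pm j
      rcases Int.even_or_odd' k with ⟨j, rfl | rfl⟩
      · exact absurd (hpw j) hlp
      · have h1 : (x ^ (2 * j + 1)) ^ 2 = -1 := by
          rw [← zpow_natCast, zpow_comm, zpow_natCast, hx2, zpow_add, zpow_mul]; simp
        have h2 : (-1 : UnitQuat) ∈ pr1 (Γ ⊓ M.comap (MonoidHom.snd _ _)) := by
          rw [← h1]; exact Subgroup.pow_mem _ hl 2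
        replace hl : x ^ (2 * j + 1) ∈ _ := hl
        rw [zpow_add, zpow_one] at hl
        have h3 : x ^ (2 * j) ∈ pr1 (Γ ⊓ M.comap (MonoidHom.snd _ _)) := by
          rcases hpw j with h3 | h3 <;> rw [h3]
          · exact one_mem _
          · exact h2
        simpa using Subgroup.mul_mem _ (Subgroup.inv_mem _ h3) hl
    obtain ⟨b, hb⟩ := mem_pr1.1 hxm
    exact h.notMem hb.1 hb.2
  comm2 := h.dih2.comm.mono fun b hb => by
    obtain ⟨a, ha⟩ := mem_pr2.1 hb
    exact ha.2
  not_comm1 := h.dih1.not_comm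
  not_comm2 := h.dih2.not_comm
  mul_mem := by
    rintro ⟨a, b⟩ hx ⟨c, d⟩ hy hx' hy'
    exact ⟨Γ.mul_mem hx hy, h.dih2.mul_mem b (mem_pr2.2 ⟨a, hx⟩) d (mem_pr2.2 ⟨c, hy⟩)
      (fun hl => hx' ⟨hx, hl⟩) (fun hl => hy' ⟨hy, hl⟩)⟩

/-- If x' or z' has trace 0, the cyclic parts can be changed. Otherwise partners (x, b) and (a, z)
lie in Λ, x generates `pr1 Λ`, and re b = 0 because b' ∉ M'. Traces show that `k2 Γ` is central;
with a = xᵏ, z equals bᵏ up to sign, so z² is central. Then z is central or has trace 0, and both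
are excluded. -/
theorem Aligned.exists_of_unaligned (h : Aligned Γ Λ) (h' : Unaligned Γ' L' M')
    (hc : AlmostConjugate Γ Γ') : ∃ Λ', Aligned Γ' Λ' := by
  have := hc.1
  have := hc.2.1
  have : Finite Λ := Finite.of_injective _ (Subgroup.inclusion_injective h.le)
  have : Finite L' := Finite.of_injective _ (Subgroup.inclusion_injective h'.dih1.le)
  have : Finite M' := Finite.of_injective _ (Subgroup.inclusion_injective h'.dih2.le)
  obtain ⟨x', rfl⟩ := CommOn.exists_zpowers h'.dih1.comm
  obtain ⟨z', rfl⟩ := CommOn.exists_zpowers h'.dih2.comm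
  by_cases hx : re x' = 0
  · exact ⟨_, h'.aligned_of_re_eq_zero hx⟩
  by_cases hz : re z' = 0
  · exact ⟨_, (h'.swap.aligned_of_re_eq_zero hz).swap⟩
  exfalso
  obtain ⟨b', hxb'⟩ := mem_pr1.1 (h'.dih1.le (Subgroup.mem_zpowers x'))
  obtain ⟨a', haz'⟩ := mem_pr2.1 (h'.dih2.le (Subgroup.mem_zpowers z'))
  obtain ⟨x, b, hxb, hrx, hrb⟩ := UnitQuat.exists_same_re hc.symm hxb'
  obtain ⟨a, z, haz, hra, hrz⟩ := UnitQuat.exists_same_re hc.symm haz'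
  have hrb0 : re b = 0 := by
    rw [hrb]; exact h'.dih2.re_eq_zero (mem_pr2.2 ⟨_, hxb'⟩) (h'.notMem hxb')
  have hxb2 : (x, b) ∈ Λ := by
    by_contra hn
    exact hx (by rw [← hrx]; exact (h.re_eq_zero hxb hn).1)
  have haz2 : (a, z) ∈ Λ := by
    by_contra hn
    exact hz (by rw [← hrz]; exact (h.re_eq_zero haz hn).2)
  have hgen : pr1 Λ = Subgroup.zpowers x := by
    refine (Subgroup.eq_of_le_of_card_ge (Subgroup.zpowers_le.2 (mem_pr1.2 ⟨b, hxb2⟩)) ?_).symm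
    have e1 := h.dih1.card
    have e2 := h'.dih1.card
    have e3 := (almostConjugate_pr1 hc).card_eq
    rw [Nat.card_zpowers] at e2 ⊢
    rw [orderOf_eq_of_re hrx]
    omega
  have hk2 : k2 Γ ≤ pm := by
    intro m hm
    obtain ⟨p, q, hpq, hp, hq⟩ := UnitQuat.exists_same_re hc (Γ.mul_mem hxb (mem_k2.1 hm))
    rw [mul_one] at hp
    have hpL : p ∈ Subgroup.zpowers x' := by
      by_contra hn
      have := h'.dih1.re_eq_zero (mem_pr1.2 ⟨q, hpq⟩) hn
      rw [hp, hrx] at this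
      exact hx this
    have hqM : q ∉ Subgroup.zpowers z' := by
      rcases eq_or_inv_of_comm (h'.dih1.comm _ hpL _ (Subgroup.mem_zpowers x'))
        (by rw [hp, hrx]) with rfl | rfl
      · exact h'.notMem hpq
      · intro hc
        exact h'.notMem (by simpa using Γ'.inv_mem hpq) (Subgroup.inv_mem _ hc)
    have h0 : re (b * m) = re b := by
      rw [hrb0, ← hq]; exact h'.dih2.re_eq_zero (mem_pr2.2 ⟨p, hpq⟩) hqM
    have hbM : b ∈ pr2 Λ := mem_pr2.2 ⟨x, hxb2⟩
    have hmM : m ∈ pr2 Λ := k2_le_pr2 Λ (h.k2_eq.ge hm)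
    rcases eq_or_inv_of_comm (h.comm2 _ (Subgroup.mul_mem _ hbM hmM) _ hbM) h0 with h1 | h1
    · left; simpa using h1
    · right
      have h2 : m = (b ^ 2)⁻¹ := by
        rw [pow_two, mul_inv_rev, eq_inv_mul_iff_mul_eq]; exact h1
      rw [h2, sq_eq_neg_one_iff.2 hrb0, inv_eq_iff_mul_eq_one]; simp
  obtain ⟨k, rfl⟩ := hgen.le (mem_pr1.2 ⟨z, haz2⟩)
  have h1 := hk2 (div_mem_k2 (zpow_mem_prod hxb k) haz)
  have h2 : z ^ 2 ∈ pm := by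
    set p := (b ^ k)⁻¹ * z with hp
    have e : z = b ^ k * p := by rw [hp]; group
    have e2 : z ^ 2 = (b ^ 2) ^ k * p ^ 2 := by
      have e3 : (b ^ 2) ^ k = b ^ k * b ^ k := by
        rw [← zpow_natCast, zpow_comm, zpow_natCast, pow_two]
      rw [e, e3, pow_two, mul_assoc, ← mul_assoc p, pm_comm h1, pow_two]
      simp only [mul_assoc]
    rw [e2, sq_eq_neg_one_iff.2 hrb0]
    exact pm.mul_mem (pm.zpow_mem neg_one_mem_pm k) (pm.pow_mem h1 2)
  by_cases hzp : z ∈ pm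
  · apply h'.dih2.not_le_pm
    rw [Subgroup.zpowers_le, mem_pm_iff_re, ← hrz]
    exact mem_pm_iff_re.1 hzp
  · exact hz (by rw [← hrz]; exact re_of_pow_two_mem h2 hzp)

theorem conjugate_of_dih (h : AlmostConjugate Γ Γ') (h1 : Dih (pr1 Γ) L) (h2 : Dih (pr2 Γ) M) :
    ConjugateSubgroups Γ Γ' := by
  have := h.1
  have := h.2.1
  by_cases hc : Nat.card (pr1 Γ) ≤ 2 * Nat.card (k1 Γ)
  · exact conjugate_of_card_le h hc
  obtain ⟨L', h1', -⟩ := exists_dih_of_almostConjugate h1 (almostConjugate_pr1 h)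
  obtain ⟨M', h2', -⟩ := exists_dih_of_almostConjugate h2 (almostConjugate_pr2 h)
  have e1 := (almostConjugate_pr1 h).card_eq
  have e2 := (almostConjugate_k1 h).card_eq
  rcases aligned_or_unaligned h1 h2 (by omega) with ⟨Λ, hu⟩ | hu <;>
    rcases aligned_or_unaligned h1' h2' (by omega) with ⟨Λ', hv⟩ | hv
  · exact hu.conjugate hv h
  · obtain ⟨Λ', hv⟩ := hu.exists_of_unaligned hv h
    exact hu.conjugate hv h
  · obtain ⟨Λ, hu⟩ := hv.exists_of_unaligned hu h.symm
    exact hu.conjugate hv h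
  · exact hu.conjugate hv h

end UnitQuat

/-! ### Quotients of order six, and exceptional projections with central kernel. -/

section General

/-- In the symmetric group on three letters all automorphisms are inner, so all pairs of an element
of order 3 and one of order 2 are conjugate. -/
theorem exists_conj_of_card_six {Q : Type*} [Group Q] (hQ : Nat.card Q = 6)
    (hn : ∃ a b : Q, a * b ≠ b * a) {x x' y y' : Q} (hx : orderOf x = 3) (hx' : orderOf x' = 3)
    (hy : orderOf y = 2) (hy' : orderOf y' = 2) :
    ∃ q, q * x' * q⁻¹ = x ∧ q * y' * q⁻¹ = y := by
  classical
  have : Finite Q := Nat.finite_of_card_ne_zero (by omega)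
  have hx3 : x ^ 3 = 1 := by rw [← hx]; exact pow_orderOf_eq_one x
  have hidx : (Subgroup.zpowers x).index = 2 := by
    have := (Subgroup.zpowers x).card_mul_index
    rw [Nat.card_zpowers, hx, hQ] at this
    omega
  have hPn := Subgroup.normal_of_index_eq_two hidx
  have hmem : ∀ {u : Q}, orderOf u = 3 → u ∈ Subgroup.zpowers x := by
    intro u hu
    have h1 := Subgroup.sq_mem_of_index_two hidx u
    have h2 : u ^ 3 = 1 := by rw [← hu]; exact pow_orderOf_eq_one u
    have := Subgroup.pow_mem _ h1 2
    rwa [← pow_mul, show 2 * 2 = 3 + 1 from rfl, pow_succ, h2, one_mul] at this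
  have hcases : ∀ {u : Q}, u ∈ Subgroup.zpowers x → u = 1 ∨ u = x ∨ u = x⁻¹ := by
    intro u hu
    obtain ⟨k, hk, rfl⟩ := (mem_zpowers_iff_mem_range_orderOf (x := x)).1 hu |> Finset.mem_image.1
    rw [Finset.mem_range, hx] at hk
    interval_cases k
    · simp
    · simp
    · right; right
      rw [eq_inv_iff_mul_eq_one, ← pow_succ, hx3]
  have hnot : ∀ {u : Q}, orderOf u = 2 → u ∉ Subgroup.zpowers x := by
    intro u hu hc
    have := orderOf_dvd_natCard (⟨u, hc⟩ : Subgroup.zpowers x)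
    rw [Nat.card_zpowers, hx, Subgroup.orderOf_mk, hu] at this
    omega
  have hinv : ∀ {u : Q}, u ∉ Subgroup.zpowers x → u * x * u⁻¹ = x⁻¹ := by
    intro u hu
    rcases hcases (hPn.conj_mem x (Subgroup.mem_zpowers x) u) with h | h | h
    · rw [mul_inv_eq_one, mul_eq_left] at h
      rw [h, orderOf_one] at hx
      omega
    · exfalso
      obtain ⟨a, b, hab⟩ := hn
      have hux : Commute u x := mul_inv_eq_iff_eq_mul.1 h
      have hcx : ∀ c : Q, Commute c x := by
        intro c
        by_cases hc : c ∈ Subgroup.zpowers x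
        · obtain ⟨k, rfl⟩ := hc
          exact (Commute.refl x).zpow_left k
        · obtain ⟨k, hk⟩ := (Subgroup.mul_mem_iff_of_index_two hidx (a := c) (b := u)).2 (by tauto)
          have : c = x ^ k * u⁻¹ := by rw [eq_mul_inv_iff_mul_eq]; exact hk.symm
          rw [this]
          exact ((Commute.refl x).zpow_left k).mul_left hux.inv_left
      have hcu : ∀ c : Q, Commute c u := by
        intro c
        by_cases hc : c ∈ Subgroup.zpowers x
        · obtain ⟨k, rfl⟩ := hc
          exact (hux.symm).zpow_left k
        · obtain ⟨k, hk⟩ := (Subgroup.mul_mem_iff_of_index_two hidx (a := c) (b := u)).2 (by tauto)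
          have : c = x ^ k * u⁻¹ := by rw [eq_mul_inv_iff_mul_eq]; exact hk.symm
          rw [this]
          exact (hux.symm.zpow_left k).mul_left (Commute.refl u).inv_left
      apply hab
      by_cases hc : b ∈ Subgroup.zpowers x
      · obtain ⟨k, rfl⟩ := hc
        exact (hcx a).zpow_right k
      · obtain ⟨k, hk⟩ := (Subgroup.mul_mem_iff_of_index_two hidx (a := b) (b := u)).2 (by tauto)
        have : b = x ^ k * u⁻¹ := by rw [eq_mul_inv_iff_mul_eq]; exact hk.symm
        rw [this]
        exact ((hcx a).zpow_right k).mul_right (hcu a).inv_right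
    · exact h
  have key : ∀ {v : Q}, orderOf v = 2 → ∃ q, q * x * q⁻¹ = x ∧ q * v * q⁻¹ = y := by
    intro v hv
    obtain ⟨k, hk⟩ := (Subgroup.mul_mem_iff_of_index_two hidx (a := y) (b := v)).2
      (iff_of_false (hnot hy) (hnot hv))
    have hy2 : y * y = 1 := by
      rw [← pow_two, ← hy]; exact pow_orderOf_eq_one y
    have hvk : v = y * x ^ k := by
      rw [show x ^ k = y * v from hk, ← mul_assoc, hy2, one_mul]
    have hyk : x ^ (-k) * y = y * x ^ k := by
      have h1 : y * x ^ k * y⁻¹ = x⁻¹ ^ k := by rw [← hinv (hnot hy), conj_zpow]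
      rw [zpow_neg, ← inv_zpow, ← h1, inv_mul_cancel_right]
    -- As y inverts x and v = y xᵏ, conjugating v by x⁻ᵏ gives y x³ᵏ = y.
    refine ⟨x ^ (-k), ?_, ?_⟩
    · rw [((Commute.refl x).zpow_left (-k)).eq, mul_inv_cancel_right]
    · rw [hvk, ← mul_assoc, hyk, mul_assoc, mul_assoc, zpow_neg, inv_inv, ← zpow_add, ← zpow_add,
        show k + (k + k) = 3 * k by ring, zpow_mul, zpow_ofNat, hx3, one_zpow, mul_one]
  rcases hcases (hmem hx') with rfl | rfl | rfl
  · rw [orderOf_one] at hx'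
    omega
  · exact key hy'
  · obtain ⟨q, hq1, hq2⟩ := key (v := y * y' * y⁻¹) (by
      rw [← hy']; exact orderOf_injective (MulAut.conj y).toMonoidHom (MulAut.conj y).injective y')
    refine ⟨q * y, ?_, ?_⟩
    · have h1 : y * x⁻¹ * y⁻¹ = x := by
        calc y * x⁻¹ * y⁻¹ = (y * x * y⁻¹)⁻¹ := by group
          _ = x := by rw [hinv (hnot hy), inv_inv]
      calc q * y * x⁻¹ * (q * y)⁻¹ = q * (y * x⁻¹ * y⁻¹) * q⁻¹ := by group
        _ = x := by rw [h1, hq1]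
    · calc q * y * y' * (q * y)⁻¹ = q * (y * y' * y⁻¹) * q⁻¹ := by group
        _ = y := hq2

theorem eq_top_of_card_six {Q : Type*} [Group Q] (hQ : Nat.card Q = 6) {x y : Q}
    (hx : orderOf x = 3) (hy : orderOf y = 2) {H : Subgroup Q} (hxH : x ∈ H) (hyH : y ∈ H) :
    H = ⊤ := by
  have : Finite Q := Nat.finite_of_card_ne_zero (by omega)
  apply Subgroup.eq_top_of_card_eq
  have h1 := orderOf_dvd_natCard (⟨x, hxH⟩ : H)
  have h2 := orderOf_dvd_natCard (⟨y, hyH⟩ : H)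
  have h3 := H.card_subgroup_dvd_card
  rw [Subgroup.orderOf_mk] at h1 h2
  rw [hx] at h1
  rw [hy] at h2
  rw [hQ] at h3 ⊢
  have := Nat.le_of_dvd (by norm_num) h3
  have : 0 < Nat.card H := Nat.card_pos
  omega

end General

namespace UnitQuat

variable {Γ Γ' : Subgroup (UnitQuat × UnitQuat)}

/-- Two subgroups with the same projections and kernels whose quotient is nonabelian of order six
are conjugate. -/
theorem conjugate_of_card_six [Finite Γ] [Finite Γ'] (h1 : pr1 Γ' = pr1 Γ) (h2 : pr2 Γ' = pr2 Γ)
    (h3 : k1 Γ' = k1 Γ) (h4 : k2 Γ' = k2 Γ) (hc : Nat.card (pr1 Γ) = 6 * Nat.card (k1 Γ))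
    (hn : ∃ a ∈ pr1 Γ, ∃ b ∈ pr1 Γ, a * b * a⁻¹ * b⁻¹ ∉ k1 Γ) : ConjugateSubgroups Γ Γ' := by
  set A := pr1 Γ with hA
  set K := k1 Γ with hK
  have hKA : K ≤ A := k1_le_pr1 Γ
  have hnor : (K.subgroupOf A).Normal :=
    ⟨fun n hn g => k1_normal (Γ := Γ) g.2 (Subgroup.mem_subgroupOf.1 hn)⟩
  set f : A →* A ⧸ K.subgroupOf A := QuotientGroup.mk' _ with hf
  have hker : ∀ {a : A}, f a = 1 ↔ (a : UnitQuat) ∈ K := fun {a} =>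
    QuotientGroup.eq_one_iff a
  have hcQ : Nat.card (A ⧸ K.subgroupOf A) = 6 := by
    have e := Subgroup.card_eq_card_quotient_mul_card_subgroup (K.subgroupOf A)
    rw [hc, Nat.card_congr (Subgroup.subgroupOfEquivOfLe hKA).toEquiv] at e
    exact (Nat.eq_of_mul_eq_mul_right Nat.card_pos e).symm
  have hnQ : ∃ a b : A ⧸ K.subgroupOf A, a * b ≠ b * a := by
    obtain ⟨a, ha, b, hb, hab⟩ := hn
    refine ⟨f ⟨a, ha⟩, f ⟨b, hb⟩, fun hcom => hab ?_⟩
    have : f (⟨a, ha⟩ * ⟨b, hb⟩ * ⟨a, ha⟩⁻¹ * ⟨b, hb⟩⁻¹) = 1 := by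
      rw [map_mul, map_mul, map_mul, hcom, map_inv, map_inv]; group
    exact hker.1 this
  have : Finite (A ⧸ K.subgroupOf A) := Nat.finite_of_card_ne_zero (by omega)
  -- The elements x and x' lie over the same b in Γ and Γ'. Powers of b decide membership in the
  -- common kernel for both, so their classes in the quotient have the same order. For p = 3 and p =
  -- 2 these classes are matched by an inner automorphism of the quotient, and any representative of
  -- it conjugates Γ' onto Γ.
  have lift : ∀ p : ℕ, p.Prime → p ∣ 6 → ∃ (x x' : A) (b : UnitQuat), (x.1, b) ∈ Γ ∧
      (x'.1, b) ∈ Γ' ∧ orderOf (f x) = p ∧ orderOf (f x') = p := by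
    intro p hp hdvd
    have := Fact.mk hp
    obtain ⟨u, hu⟩ := exists_prime_orderOf_dvd_card' p (hcQ ▸ hdvd)
    obtain ⟨x, rfl⟩ := QuotientGroup.mk'_surjective _ u
    obtain ⟨b, hb⟩ := mem_pr1.1 x.2
    obtain ⟨x', hx'⟩ := mem_pr2.1 (h2.ge (mem_pr2.2 ⟨_, hb⟩))
    have hx'A : x' ∈ A := h1.le (mem_pr1.2 ⟨_, hx'⟩)
    have tr : ∀ n : ℕ, f x ^ n = 1 ↔ f ⟨x', hx'A⟩ ^ n = 1 := by
      intro n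
      rw [← map_pow, ← map_pow, hker, hker]
      have e1 : (x : UnitQuat) ^ n ∈ K ↔ b ^ n ∈ k2 Γ := by
        have e0 := Γ.pow_mem hb n
        constructor
        · intro hk
          simpa [mem_k2] using Γ.mul_mem e0 (Γ.inv_mem (mem_k1.1 hk))
        · intro hk
          simpa [hK, mem_k1] using Γ.mul_mem e0 (Γ.inv_mem (mem_k2.1 hk))
      have e2 : x' ^ n ∈ k1 Γ' ↔ b ^ n ∈ k2 Γ' := by
        have e0 := Γ'.pow_mem hx' n
        constructor
        · intro hk
          simpa [mem_k2] using Γ'.mul_mem e0 (Γ'.inv_mem (mem_k1.1 hk))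
        · intro hk
          simpa [mem_k1] using Γ'.mul_mem e0 (Γ'.inv_mem (mem_k2.1 hk))
      rw [h3, h4] at e2
      exact e1.trans e2.symm
    refine ⟨x, ⟨x', hx'A⟩, b, hb, hx', hu, ?_⟩
    rw [← hu]
    exact Nat.dvd_antisymm (orderOf_dvd_of_pow_eq_one ((tr _).1 (pow_orderOf_eq_one _)))
      (orderOf_dvd_of_pow_eq_one ((tr _).2 (pow_orderOf_eq_one _)))
  obtain ⟨x, x', b, hx, hx', ox, ox'⟩ := lift 3 Nat.prime_three (by norm_num)
  obtain ⟨y, y', c, hy, hy', oy, oy'⟩ := lift 2 Nat.prime_two (by norm_num)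
  obtain ⟨q, hq1, hq2⟩ := exists_conj_of_card_six hcQ hnQ ox ox' oy oy'
  obtain ⟨a, rfl⟩ := QuotientGroup.mk'_surjective _ q
  have haK : K ≤ k1 (Γ'.cj (a.1, 1)) := by
    intro k hk
    rw [k1_cj, h3, Subgroup.mem_cj]
    have := k1_normal (Γ := Γ) (A.inv_mem a.2) hk
    rwa [inv_inv] at this
  have move : ∀ {x x' : A} {b : UnitQuat}, (x'.1, b) ∈ Γ' → f a * f x' * (f a)⁻¹ = f x →
      (x.1, b) ∈ Γ'.cj (a.1, 1) := by
    intro x x' b hx' e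
    have e1 : (a.1 * x'.1 * a.1⁻¹)⁻¹ * x.1 ∈ K := by
      have : f ((a * x' * a⁻¹)⁻¹ * x) = 1 := by
        rw [map_mul, map_inv, map_mul, map_mul, map_inv, e, inv_mul_cancel]
      exact hker.1 this
    have := (Γ'.cj (a.1, 1)).mul_mem (conj_mem_cj_prod (g := a.1) (h := 1) hx')
      (mem_k1.1 (haK e1))
    simpa only [Prod.mk_mul_mk, mul_inv_cancel_left, one_mul, inv_one, mul_one] using this
  apply ConjugateSubgroups.of_cj_right (g := (a.1, 1))
  have hcard : Nat.card Γ = Nat.card (Γ'.cj (a.1, 1)) := by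
    rw [Subgroup.card_cj, card_eq_pr1_mul_k2, card_eq_pr1_mul_k2, h1, h4]
  rw [eq_of_lifts hcard]
  · exact ConjugateSubgroups.refl _
  · set H := pr1 (Γ ⊓ Γ'.cj (a.1, 1)) with hH
    have htop : (H.subgroupOf A).map f = ⊤ :=
      eq_top_of_card_six hcQ ox oy
        ⟨x, Subgroup.mem_subgroupOf.2 (mem_pr1.2 ⟨b, hx, move hx' hq1⟩), rfl⟩
        ⟨y, Subgroup.mem_subgroupOf.2 (mem_pr1.2 ⟨c, hy, move hy' hq2⟩), rfl⟩
    intro z hz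
    obtain ⟨w, hw, hwz⟩ : f ⟨z, hz⟩ ∈ (H.subgroupOf A).map f := htop ▸ Subgroup.mem_top _
    have e : w.1⁻¹ * z ∈ K := by
      have : f (w⁻¹ * ⟨z, hz⟩) = 1 := by rw [map_mul, map_inv, hwz, inv_mul_cancel]
      exact hker.1 this
    have e2 : w.1⁻¹ * z ∈ H := mem_pr1.2 ⟨1, e, haK e⟩
    simpa using H.mul_mem hw e2
  · rw [k2_cj, h4]
    exact (Subgroup.cj_one _).ge

theorem Exc.exists_orderOf_three {A : Subgroup UnitQuat} (hA : Exc A) : ∃ x ∈ A, orderOf x = 3 := by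
  have := hA.1
  have := Fact.mk Nat.prime_three
  obtain ⟨x, hx⟩ := exists_prime_orderOf_dvd_card' (G := A) 3 (by
    rcases hA.card with h | h | h <;> rw [h] <;> norm_num)
  exact ⟨x, x.2, by rwa [Subgroup.orderOf_coe]⟩

theorem card_le_two {N : Subgroup UnitQuat} (h : N ≤ pm) : Nat.card N ≤ 2 := by
  rcases le_pm_cases h with h | h <;> omega

theorem pow_card_mem {K : Subgroup UnitQuat} {x : UnitQuat} (hx : x ∈ K) : x ^ Nat.card K = 1 := by
  have := pow_card_eq_one' (x := (⟨x, hx⟩ : K))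
  exact congrArg Subtype.val this

/-- The product T = K K' is normal. If it is larger than K, it is exceptional and contains y of
order 3; but y⁸ ∈ K, so y⁶⁴ = 1, which is impossible. -/
theorem Exc.eq_of_card_eight {A K K' : Subgroup UnitQuat} (hA : Exc A) (hK : K ≤ A) (hK' : K' ≤ A)
    (hn : NormalIn K A) (hn' : NormalIn K' A) (hc : Nat.card K = 8) (hc' : Nat.card K' = 8) :
    K = K' := by
  let T : Subgroup UnitQuat :=
    { carrier := {x | x ∈ A ∧ ∃ v ∈ K', x * v⁻¹ ∈ K}
      one_mem' := ⟨A.one_mem, 1, K'.one_mem, by simp [K.one_mem]⟩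
      mul_mem' := by
        rintro x y ⟨hx, v, hv, hxv⟩ ⟨hy, w, hw, hyw⟩
        refine ⟨A.mul_mem hx hy, v * w, K'.mul_mem hv hw, ?_⟩
        have := K.mul_mem (hn x hx _ hyw) hxv
        rwa [show x * (y * w⁻¹) * x⁻¹ * (x * v⁻¹) = x * y * (v * w)⁻¹ by group] at this
      inv_mem' := by
        rintro x ⟨hx, v, hv, hxv⟩
        refine ⟨A.inv_mem hx, v⁻¹, K'.inv_mem hv, ?_⟩
        have := hn _ (A.inv_mem hx) _ (K.inv_mem hxv)
        rwa [show x⁻¹ * (x * v⁻¹)⁻¹ * x⁻¹⁻¹ = x⁻¹ * v⁻¹⁻¹ by group] at this }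
  have hT : ∀ x, x ∈ T ↔ x ∈ A ∧ ∃ v ∈ K', x * v⁻¹ ∈ K := fun _ => Iff.rfl
  have hTA : T ≤ A := fun x hx => hx.1
  have hKT : K ≤ T := fun x hx => ⟨hK hx, 1, K'.one_mem, by simpa using hx⟩
  have hKT' : K' ≤ T := fun x hx => ⟨hK' hx, x, hx, by simp [K.one_mem]⟩
  have hTn : NormalIn T A := by
    rintro a ha x ⟨hx, v, hv, hxv⟩
    refine ⟨A.mul_mem (A.mul_mem ha hx) (A.inv_mem ha), _, hn' a ha v hv, ?_⟩
    have := hn a ha _ hxv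
    rwa [show a * (x * v⁻¹) * a⁻¹ = a * x * a⁻¹ * (a * v * a⁻¹)⁻¹ by group] at this
  have := hA.1
  have : Finite T := Finite.of_injective _ (Subgroup.inclusion_injective hTA)
  have hle := Subgroup.card_le_of_le hKT
  rcases hA.normal_cases hTA hTn with h | h | ⟨h, -⟩
  · have := card_le_two h; omega
  · rw [Subgroup.eq_of_le_of_card_ge hKT (by omega), Subgroup.eq_of_le_of_card_ge hKT' (by omega)]
  · exfalso
    obtain ⟨y, hy, hy3⟩ := h.exists_orderOf_three
    obtain ⟨hyA, v, hv, hyv⟩ := hy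
    have hpow : ∀ j : ℕ, y ^ j * (v ^ j)⁻¹ ∈ K := by
      intro j
      induction j with
      | zero => simp [K.one_mem]
      | succ j ih =>
        have := K.mul_mem (hn y hyA _ ih) hyv
        rwa [show y * (y ^ j * (v ^ j)⁻¹) * y⁻¹ * (y * v⁻¹) = y ^ (j + 1) * (v ^ (j + 1))⁻¹ by
          rw [pow_succ' y, pow_succ v]; group] at this
    have h8 := hpow 8
    have hv8 : v ^ 8 = 1 := by rw [← hc']; exact pow_card_mem hv
    rw [hv8, inv_one, mul_one] at h8
    have h9 := pow_card_mem h8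
    rw [hc, ← pow_mul] at h9
    have := orderOf_dvd_of_pow_eq_one h9
    rw [hy3] at this
    omega

/-- If all commutators were 1 or -1, an element of nonzero trace could never be sent to its negative
and would be central. -/
theorem Exc.exists_commutator {A : Subgroup UnitQuat} (hA : Exc A) :
    ∃ a ∈ A, ∃ b ∈ A, a * b * a⁻¹ * b⁻¹ ∉ pm := by
  by_contra! hcon
  obtain ⟨x, hx, hp⟩ := hA.exists_prim
  refine hA.not_normalizes hp.notMem_pm fun a ha => Or.inl ?_
  rcases hcon a ha x hx with h | h
  · exact mul_inv_eq_one.1 h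
  · rw [mul_inv_eq_iff_eq_mul, neg_one_mul] at h
    have := re_conj a x
    rw [h, re_neg] at this
    exact absurd (by linarith) hp.re_ne_zero

theorem commutator_mem_k1 {a b c d : UnitQuat} (hab : (a, b) ∈ Γ) (hcd : (c, d) ∈ Γ)
    (h : b * d = d * b) : a * c * a⁻¹ * c⁻¹ ∈ k1 Γ := by
  have h1 := Γ.mul_mem (Γ.mul_mem (Γ.mul_mem hab hcd) (Γ.inv_mem hab)) (Γ.inv_mem hcd)
  have e : b * d * b⁻¹ * d⁻¹ = 1 := by rw [h]; group
  simpa [mem_k1, e] using h1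

/-- Commutators of elements whose second coordinates commute lie in `k1`, so they are central. This
excludes a commutative `pr2`. If `pr2` were dihedral, the part of `pr1` over its cyclic subgroup
would be normal of index at most two, hence still exceptional, with the same contradiction. -/
theorem exc_pr2 [Finite Γ] (hA : Exc (pr1 Γ)) (h1 : k1 Γ ≤ pm) : Exc (pr2 Γ) := by
  rcases commOn_or_dih_or_exc (pr2 Γ) with h | ⟨M, h⟩ | h
  · exfalso
    obtain ⟨a, ha, c, hc, hac⟩ := hA.exists_commutator
    obtain ⟨b, hb⟩ := mem_pr1.1 ha
    obtain ⟨d, hd⟩ := mem_pr1.1 hc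
    exact hac (h1 (commutator_mem_k1 hb hd (h _ (mem_pr2.2 ⟨_, hb⟩) _ (mem_pr2.2 ⟨_, hd⟩))))
  · exfalso
    set Λ := Γ ⊓ M.comap (MonoidHom.snd _ _) with hΛ
    have hle : pr1 Λ ≤ pr1 Γ := by
      intro a ha
      obtain ⟨b, hb⟩ := mem_pr1.1 ha
      exact mem_pr1.2 ⟨b, hb.1⟩
    have hn : NormalIn (pr1 Λ) (pr1 Γ) := by
      intro a ha x hx
      obtain ⟨b, hb⟩ := mem_pr1.1 ha
      obtain ⟨y, hy, hyM⟩ := mem_pr1.1 hx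
      replace hyM : y ∈ M := hyM
      refine mem_pr1.2 ⟨b * y * b⁻¹, Γ.mul_mem (Γ.mul_mem hb hy) (Γ.inv_mem hb), ?_⟩
      by_cases hbM : b ∈ M
      · exact M.mul_mem (M.mul_mem hbM hyM) (M.inv_mem hbM)
      · show b * y * b⁻¹ ∈ M
        rw [h.conj_eq_inv (mem_pr2.2 ⟨_, hb⟩) hbM hyM]
        exact M.inv_mem hyM
    have hcard : Nat.card (pr1 Γ) ≤ 2 * Nat.card (pr1 Λ) := by
      by_cases hall : pr1 Γ ≤ pr1 Λ
      · have : Finite (pr1 Λ) := Finite.of_injective _ (Subgroup.inclusion_injective hle)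
        have := Subgroup.card_le_of_le hall
        omega
      obtain ⟨w, hw, hw'⟩ := SetLike.not_le_iff_exists.1 hall
      refine (Subgroup.card_eq_two_mul hle (fun x hx y hy hx' hy' => ?_) hw hw').le
      obtain ⟨b, hb⟩ := mem_pr1.1 hx
      obtain ⟨d, hd⟩ := mem_pr1.1 hy
      refine mem_pr1.2 ⟨b * d, Γ.mul_mem hb hd, h.mul_mem b (mem_pr2.2 ⟨_, hb⟩) d
        (mem_pr2.2 ⟨_, hd⟩) (fun hc => hx' (mem_pr1.2 ⟨b, hb, hc⟩))
        (fun hc => hy' (mem_pr1.2 ⟨d, hd, hc⟩))⟩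
    have hE : Exc (pr1 Λ) := by
      have := hA.card
      rcases hA.normal_cases hle hn with h | h | ⟨h, -⟩
      · have := card_le_two h; omega
      · omega
      · exact h
    obtain ⟨a, ha, c, hc, hac⟩ := hE.exists_commutator
    obtain ⟨b, hb, hbM⟩ := mem_pr1.1 ha
    obtain ⟨d, hd, hdM⟩ := mem_pr1.1 hc
    exact hac (h1 (commutator_mem_k1 hb hd (h.comm _ hbM _ hdM)))
  · exact h

theorem card_mul_eq [Finite Γ] :
    Nat.card (pr1 Γ) * Nat.card (k2 Γ) = Nat.card (pr2 Γ) * Nat.card (k1 Γ) := by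
  rw [← card_eq_pr1_mul_k2, card_eq_pr2_mul_k1]

/-- Orders decide, through |pr1| |k2| = |pr2| |k1| with |k1| ≤ 2. If k2 has order 8, the left side
is at least 192 and the right side at most 96; larger kernels would make `pr1` too small. -/
theorem k2_le_pm [Finite Γ] (hA : Exc (pr1 Γ)) (h1 : k1 Γ ≤ pm) : k2 Γ ≤ pm := by
  have hB := exc_pr2 hA h1
  have e := card_mul_eq (Γ := Γ)
  have e1 := card_le_two h1
  have e2 := hA.card
  have e3 := hB.card
  rcases hB.normal_cases (k2_le_pr2 Γ) (fun a ha x hx => k2_normal ha hx) with h | h | ⟨h, h' | h'⟩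
  · exact h
  · exfalso
    rw [h.1] at e
    have : Nat.card (pr2 Γ) * Nat.card (k1 Γ) ≤ 48 * 2 := Nat.mul_le_mul (by omega) e1
    omega
  · exfalso
    rw [h', mul_comm] at e
    have := Nat.eq_of_mul_eq_mul_left Nat.card_pos e
    omega
  · exfalso
    rw [h'.1, h'.2] at e
    omega

theorem conjugate_of_exc_of_le_pm (h : AlmostConjugate Γ Γ') (hA : Exc (pr1 Γ)) (h1 : k1 Γ ≤ pm) :
    ConjugateSubgroups Γ Γ' := by
  have := h.1
  have := h.2.1
  obtain ⟨g, hg⟩ := conjugate_of_almostConjugate (almostConjugate_pr1 h)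
  have hA' : Exc (pr1 Γ') := hg ▸ hA.cj g
  have h1' : k1 Γ' ≤ pm := by
    obtain ⟨k, hk⟩ := conjugate_of_almostConjugate (almostConjugate_k1 h)
    rw [← hk]
    exact (cj_eq_of_le_pm h1 k).le.trans h1
  exact conjugate_of_exc h hA (exc_pr2 hA h1) hA' (exc_pr2 hA' h1') h1 (k2_le_pm hA h1) h1'
    (k2_le_pm hA' h1')

end UnitQuat

/-! ### Exceptional projections with a kernel of order eight; the theorem for the product. -/

namespace UnitQuat

variable {Γ Γ' : Subgroup (UnitQuat × UnitQuat)}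

theorem sq_of_mem_pm {x : UnitQuat} (h : x ∈ pm) : x ^ 2 = 1 := sq_eq_one_iff.2 h

theorem Prim.twentyfour {x : UnitQuat} (h : Prim 24 x) : x ^ 3 ∈ pm ∧ x ∉ pm := by
  rcases h with h | h | h
  · exact h.2
  · omega
  · omega

theorem pm_le_of_card_eight {K : Subgroup UnitQuat} (hK : Nat.card K = 8) : pm ≤ K := by
  have : Finite K := Nat.finite_of_card_ne_zero (by omega)
  have := Fact.mk Nat.prime_two
  obtain ⟨u, hu⟩ := exists_prime_orderOf_dvd_card' (G := K) 2 (by rw [hK]; norm_num)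
  rw [← Subgroup.orderOf_coe] at hu
  have h1 : (u : UnitQuat) ^ 2 = 1 := by rw [← hu]; exact pow_orderOf_eq_one _
  have h2 : (u : UnitQuat) = -1 := by
    rcases sq_eq_one_iff.1 h1 with h | h
    · rw [h, orderOf_one] at hu; omega
    · exact h
  rintro x (rfl | rfl)
  · exact K.one_mem
  · rw [← h2]; exact u.2

theorem Prim.notMem_of_card_eight {K : Subgroup UnitQuat} (hK : Nat.card K = 8) {x : UnitQuat}
    (hx : Prim 24 x) : x ∉ K := by
  intro h
  have h8 := pow_card_mem h
  have h6 := sq_of_mem_pm hx.twentyfour.1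
  rw [← pow_mul] at h6
  rw [hK, show 8 = 3 * 2 + 2 from rfl, pow_add, h6, one_mul] at h8
  exact hx.twentyfour.2 (sq_eq_one_iff.1 h8)

theorem mem_k2_of_mem_k1 {a b : UnitQuat} (h : (a, b) ∈ Γ) (ha : a ∈ k1 Γ) : b ∈ k2 Γ := by
  simpa [mem_k2] using Γ.mul_mem h (Γ.inv_mem (mem_k1.1 ha))

theorem mem_k1_of_mem_k2 {a b : UnitQuat} (h : (a, b) ∈ Γ) (hb : b ∈ k2 Γ) : a ∈ k1 Γ :=
  mem_k2_of_mem_k1 (Γ := swap Γ) h hb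

theorem mem_of_pow_mem {K : Subgroup UnitQuat} {x : UnitQuat} (h2 : x ^ 2 ∈ K) (h3 : x ^ 3 ∈ K) :
    x ∈ K := by
  rw [pow_succ] at h3
  exact (K.mul_mem_cancel_left h2).1 h3

/-- Conjugating x by an element of `k1` that does not commute with it yields y over the same b. By
`Exc.pair` the trace of xy is 0 or 1/2. If it were 0, then (xy)² = -1 ∈ k1 would give b⁴ ∈ k2; as b³
∈ k2 too, b would lie in `k2` and x in `k1`, where no element has order 3 modulo the center. -/
theorem exists_pair_of_card_eight [Finite Γ] (hA : Exc (pr1 Γ)) (hc : Nat.card (pr1 Γ) = 24)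
    (hk : Nat.card (k1 Γ) = 8) {x b : UnitQuat} (hxb : (x, b) ∈ Γ) (hp : Prim 24 x) :
    ∃ y, (y, b) ∈ Γ ∧ x * y ≠ y * x ∧ re y = re x ∧ re (x * y) = 1 / 2 := by
  have hxk := hp.notMem_of_card_eight hk
  have hpm := pm_le_of_card_eight hk
  have hx3 := hpm hp.twentyfour.1
  have hxA : x ∈ pr1 Γ := mem_pr1.2 ⟨b, hxb⟩
  obtain ⟨u, hu, hux⟩ : ∃ u ∈ k1 Γ, u * x ≠ x * u := by
    by_contra! hcon
    have hle : k1 Γ ≤ cent (pr1 Γ) x := fun u hu => mem_cent.2 ⟨k1_le_pr1 Γ hu, hcon u hu⟩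
    have : Finite (cent (pr1 Γ) x) := Finite.of_injective _ (Subgroup.inclusion_injective (cent_le _ x))
    have hle := Subgroup.card_le_of_le hle
    rcases hA.card_cases with ⟨-, h1, -⟩ | ⟨h1, -⟩ | ⟨h1, -⟩
    · have := h1 x hxA hp.notMem_pm
      omega
    · omega
    · omega
  have hy : (u * x * u⁻¹, b) ∈ Γ := by
    simpa using Γ.mul_mem (Γ.mul_mem (mem_k1.1 hu) hxb) (Γ.inv_mem (mem_k1.1 hu))
  have hxy : x * (u * x * u⁻¹) ≠ u * x * u⁻¹ * x := by
    intro hcom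
    rcases eq_or_inv_of_comm hcom.symm (re_conj u x) with h | h
    · exact hux (mul_inv_eq_iff_eq_mul.1 h)
    · rw [h] at hy
      have h1 := div_mem_k1 hy hxb
      rw [inv_inv, ← pow_two] at h1
      exact hxk (mem_of_pow_mem h1 hx3)
  refine ⟨_, hy, hxy, re_conj u x, ?_⟩
  refine (hA.pair hxA (mem_pr1.2 ⟨b, hy⟩) (hc ▸ hp) (re_conj u x) hxy).2.2 hc fun h0 => hxk ?_
  have h1 := Γ.pow_mem (Γ.mul_mem hxb hy) 2
  rw [Prod.mk_mul_mk, Prod.pow_mk, sq_eq_neg_one_iff.2 h0] at h1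
  have h2 := mem_k2_of_mem_k1 h1 (hpm neg_one_mem_pm)
  have h3 : b ^ 3 ∈ k2 Γ := mem_k2_of_mem_k1 (Γ.pow_mem hxb 3) hx3
  apply mem_k1_of_mem_k2 hxb
  have := (k2 Γ).mul_mem ((k2 Γ).inv_mem h3) h2
  rwa [show (b ^ 3)⁻¹ * (b * b) ^ 2 = b by
    rw [← pow_two, ← pow_mul, inv_mul_eq_iff_eq_mul, ← pow_succ]] at this

theorem exc_pr1_of_almostConjugate (h : AlmostConjugate Γ Γ') (hA : Exc (pr1 Γ)) :
    Exc (pr1 Γ') := by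
  obtain ⟨g, hg⟩ := conjugate_of_almostConjugate (almostConjugate_pr1 h)
  exact hg ▸ hA.cj g

theorem exc_pr2_of_almostConjugate (h : AlmostConjugate Γ Γ') (hB : Exc (pr2 Γ)) :
    Exc (pr2 Γ') := by
  obtain ⟨g, hg⟩ := conjugate_of_almostConjugate (almostConjugate_pr2 h)
  exact hg ▸ hB.cj g

/-- Both generators x and y of `pr1` have the same second coordinate b. So the first coordinates are
matched as a pair, while b only has to be matched inside a torus. -/
theorem conjugate_of_card_eight_comm (h : AlmostConjugate Γ Γ') (hA : Exc (pr1 Γ))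
    (hc : Nat.card (pr1 Γ) = 24) (hk : Nat.card (k1 Γ) = 8) (hB : CommOn (pr2 Γ)) :
    ConjugateSubgroups Γ Γ' := by
  have := h.1
  have := h.2.1
  have hA' := exc_pr1_of_almostConjugate h hA
  have hc' := (almostConjugate_pr1 h).card_eq.symm.trans hc
  have hk' := (almostConjugate_k1 h).card_eq.symm.trans hk
  have hB' : CommOn (pr2 Γ') := commOn_of_conjugate hB
    (commOn_conjugate hB (almostConjugate_pr2 h))
  obtain ⟨x, hx, hp⟩ := hA.exists_prim
  rw [hc] at hp
  obtain ⟨b, hxb⟩ := mem_pr1.1 hx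
  obtain ⟨x', b', hxb', hrx, hrb⟩ := exists_same_re h hxb
  obtain ⟨y, hy, hxy, hry, hrxy⟩ := exists_pair_of_card_eight hA hc hk hxb hp
  obtain ⟨y', hy', hxy', hry', hrxy'⟩ := exists_pair_of_card_eight hA' hc' hk' hxb'
    (hp.of_re hrx.symm)
  obtain ⟨g, hg1, hg2⟩ := exists_conj_pair hrx (by rw [hry', hry, hrx] : re y' = re y)
    (by rw [hrxy, hrxy'])
  obtain ⟨k, hk1⟩ := CommOn.exists_le_torus hB
  obtain ⟨k', hk1'⟩ := CommOn.exists_le_torus hB'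
  obtain ⟨n, hn, hnb⟩ := exists_normalizer_conj
    (hk1' (Subgroup.conj_mem_cj (mem_pr2.2 ⟨x', hxb'⟩)))
    (hk1 (Subgroup.conj_mem_cj (mem_pr2.2 ⟨x, hxb⟩))) (by rw [re_conj, re_conj, hrb])
  apply ConjugateSubgroups.of_cj (g := (1, k)) (h := (g, n * k'))
  have e : ∀ {u v w : UnitQuat}, (u, b) ∈ Γ → (v, b') ∈ Γ' → g * v * g⁻¹ = u →
      u ∈ pr1 (Γ.cj (1, k) ⊓ Γ'.cj (g, n * k')) := by
    intro u v w hu hv huv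
    refine mem_pr1.2 ⟨k * b * k⁻¹, ?_, ?_⟩
    · have := conj_mem_cj_prod (g := 1) (h := k) hu
      rwa [one_mul, inv_one, mul_one] at this
    · have := conj_mem_cj_prod (g := g) (h := n * k') hv
      rwa [huv, show n * k' * b' * (n * k')⁻¹ = n * (k' * b' * k'⁻¹) * n⁻¹ by group, hnb] at this
  rw [eq_of_lifts (Γ := Γ.cj (1, k)) (Γ' := Γ'.cj (g, n * k'))
    (by rw [Subgroup.card_cj, Subgroup.card_cj, h.card_eq])]
  · exact ConjugateSubgroups.refl _
  · rw [pr1_cj, Subgroup.cj_one, ← hA.closure_pair hx (mem_pr1.2 ⟨b, hy⟩) (hc ▸ hp) hry hxy,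
      Subgroup.closure_le]
    rintro z (rfl | rfl)
    · exact e (w := 1) hxb hxb' hg1
    · exact e (w := 1) hy hy' hg2
  · rw [k2_cj, k2_cj]
    have e1 : (k2 Γ).cj k ≤ torus := (Subgroup.cj_mono (k2_le_pr2 Γ)).trans hk1
    have e2 : (k2 Γ').cj k' ≤ torus := (Subgroup.cj_mono (k2_le_pr2 Γ')).trans hk1'
    rw [show ((g, n * k') : UnitQuat × UnitQuat).2 = n * k' from rfl, ← Subgroup.cj_cj, hn.cj_eq e2]
    refine (torus_eq_of_card e1 e2 ?_).le
    rw [Subgroup.card_cj, Subgroup.card_cj, (almostConjugate_k2 h).card_eq]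

theorem Prim.snd_of_card_eight (hB : Exc (pr2 Γ)) (hcB : Nat.card (pr2 Γ) = 24)
    (hk : Nat.card (k1 Γ) = 8) (hk2 : Nat.card (k2 Γ) = 8) {x b : UnitQuat} (hxb : (x, b) ∈ Γ)
    (hp : Prim 24 x) : Prim 24 b := by
  have hxk := hp.notMem_of_card_eight hk
  have hx3 := pm_le_of_card_eight hk hp.twentyfour.1
  have hpm := pm_le_of_card_eight hk2
  rcases hB.pow_mem (mem_pr2.2 ⟨x, hxb⟩) with h | h | ⟨h, -⟩ | ⟨h, -⟩
  · have h1 : x ^ 2 ∈ k1 Γ := mem_k1_of_mem_k2 (Γ.pow_mem hxb 2) (hpm h)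
    exact absurd (mem_of_pow_mem h1 hx3) hxk
  · exact Or.inl ⟨rfl, h, fun hb => hxk (mem_k1_of_mem_k2 hxb (hpm hb))⟩
  · omega
  · omega

/-- After conjugation the intersection of the two groups contains (x, b), (y, b) and (x, c), so it
has full projections. Its first kernel is normal in `pr1` and contains the noncentral x⁻¹y, hence
has order at least 8. So the intersection has order at least 24 · 8 = 192, the order of both groups.
-/
theorem conjugate_of_card_eight_exc (h : AlmostConjugate Γ Γ') (hA : Exc (pr1 Γ))
    (hB : Exc (pr2 Γ)) (hc : Nat.card (pr1 Γ) = 24) (hk : Nat.card (k1 Γ) = 8)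
    (hcB : Nat.card (pr2 Γ) = 24) (hk2 : Nat.card (k2 Γ) = 8) :
    ConjugateSubgroups Γ Γ' := by
  have := h.1
  have := h.2.1
  have hA' := exc_pr1_of_almostConjugate h hA
  have hB' := exc_pr2_of_almostConjugate h hB
  have hc' := (almostConjugate_pr1 h).card_eq.symm.trans hc
  have hk' := (almostConjugate_k1 h).card_eq.symm.trans hk
  have hcB' := (almostConjugate_pr2 h).card_eq.symm.trans hcB
  have hk2' := (almostConjugate_k2 h).card_eq.symm.trans hk2
  obtain ⟨x, hx, hp⟩ := hA.exists_prim
  rw [hc] at hp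
  obtain ⟨b, hxb⟩ := mem_pr1.1 hx
  obtain ⟨x', b', hxb', hrx, hrb⟩ := exists_same_re h hxb
  have hpb := hp.snd_of_card_eight hB hcB hk hk2 hxb
  obtain ⟨y, hy, hxy, hry, hrxy⟩ := exists_pair_of_card_eight hA hc hk hxb hp
  obtain ⟨y', hy', hxy', hry', hrxy'⟩ := exists_pair_of_card_eight hA' hc' hk' hxb'
    (hp.of_re hrx.symm)
  obtain ⟨g, hg1, hg2⟩ := exists_conj_pair hrx (by rw [hry', hry, hrx] : re y' = re y)
    (by rw [hrxy, hrxy'])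
  obtain ⟨c, hc1, hbc, hrc, hrbc⟩ := exists_pair_of_card_eight (Γ := swap Γ) (by rwa [pr1_swap])
    (by rwa [pr1_swap]) (by rwa [k1_swap]) (mem_swap.2 hxb) hpb
  obtain ⟨c', hc1', hbc', hrc', hrbc'⟩ := exists_pair_of_card_eight (Γ := swap Γ')
    (by rwa [pr1_swap]) (by rwa [pr1_swap]) (by rwa [k1_swap]) (mem_swap.2 hxb')
    (hpb.of_re hrb.symm)
  rw [mem_swap] at hc1 hc1'
  obtain ⟨k, hk3, hk4⟩ := exists_conj_pair hrb (by rw [hrc', hrc, hrb] : re c' = re c)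
    (by rw [hrbc, hrbc'])
  apply ConjugateSubgroups.of_cj_right (g := (g, k))
  have e1 : (x, b) ∈ Γ ⊓ Γ'.cj (g, k) := ⟨hxb, by rw [← hg1, ← hk3]; exact conj_mem_cj_prod hxb'⟩
  have e2 : (y, b) ∈ Γ ⊓ Γ'.cj (g, k) := ⟨hy, by rw [← hg2, ← hk3]; exact conj_mem_cj_prod hy'⟩
  have e3 : (x, c) ∈ Γ ⊓ Γ'.cj (g, k) := ⟨hc1, by rw [← hg1, ← hk4]; exact conj_mem_cj_prod hc1'⟩
  have hcΓ : Nat.card Γ = 192 := by rw [card_eq_pr1_mul_k2, hc, hk2]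
  have hcΓ' : Nat.card (Γ'.cj (g, k)) = 192 := by rw [Subgroup.card_cj, ← h.card_eq, hcΓ]
  generalize Γ'.cj (g, k) = Δ at *
  have : Finite Δ := Nat.finite_of_card_ne_zero (by omega)
  set K := Γ ⊓ Δ with hK
  have hKΓ : K ≤ Γ := inf_le_left
  have : Finite K := Finite.of_injective _ (Subgroup.inclusion_injective hKΓ)
  have hA1 : pr1 Γ ≤ pr1 K := by
    rw [← hA.closure_pair hx (mem_pr1.2 ⟨b, hy⟩) (hc ▸ hp) hry hxy, Subgroup.closure_le]
    rintro z (rfl | rfl)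
    · exact mem_pr1.2 ⟨b, e1⟩
    · exact mem_pr1.2 ⟨b, e2⟩
  have hB1 : pr2 Γ ≤ pr2 K := by
    rw [← hB.closure_pair (mem_pr2.2 ⟨x, hxb⟩) (mem_pr2.2 ⟨x, hc1⟩) (hcB ▸ hpb) hrc hbc,
      Subgroup.closure_le]
    rintro z (rfl | rfl)
    · exact mem_pr2.2 ⟨x, e1⟩
    · exact mem_pr2.2 ⟨x, e3⟩
  have hkk : x⁻¹ * y ∈ k1 K := div_mem_k1 e1 e2
  have hnpm : ¬ k1 K ≤ pm := by
    intro hle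
    have h1 := pm_comm (hle hkk) x
    apply hxy
    calc x * y = x * (x * (x⁻¹ * y)) := by group
      _ = y * x := by rw [← h1]; group
  have hk8 : 8 ≤ Nat.card (k1 K) := by
    rcases hA.normal_cases (N := k1 K) (fun z hz => mem_pr1.2 ⟨1, hKΓ (mem_k1.1 hz)⟩)
      (fun a ha z hz => k1_normal (hA1 ha) hz) with h | h | ⟨h, -⟩
    · exact absurd h hnpm
    · omega
    · have := h.card; omega
  have hcK : 192 ≤ Nat.card K := by
    rw [card_eq_pr2_mul_k1]
    have := Subgroup.card_le_of_le hB1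
    calc 192 = 24 * 8 := by norm_num
      _ ≤ _ := Nat.mul_le_mul (by omega) hk8
  have h1 : K = Γ := Subgroup.eq_of_le_of_card_ge hKΓ (by omega)
  have h2 : K = Δ := Subgroup.eq_of_le_of_card_ge inf_le_right (by omega)
  rw [← h2.symm.trans h1]
  exact ConjugateSubgroups.refl _

/-- If A / K were commutative, T = {x ∈ A | x² ∈ K} would be a normal subgroup containing K. If T is
exceptional, an element of order 3 in T would lie in K. If T = K, then an x of order 8 has x⁶ ∈ K,
so x² ∈ K and T = ⟨x⟩ is cyclic and normal, against `Exc.not_normalizes`. -/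
theorem Exc.exists_commutator_notMem {A K : Subgroup UnitQuat} (hA : Exc A)
    (hc : Nat.card A = 48) (hKA : K ≤ A) (hn : NormalIn K A) (hK : Nat.card K = 8) :
    ∃ a ∈ A, ∃ b ∈ A, a * b * a⁻¹ * b⁻¹ ∉ K := by
  by_contra! hcon
  have := hA.1
  let T : Subgroup UnitQuat :=
    { carrier := {x | x ∈ A ∧ x ^ 2 ∈ K}
      one_mem' := ⟨A.one_mem, by rw [one_pow]; exact K.one_mem⟩
      mul_mem' := by
        rintro x y ⟨hx, hx2⟩ ⟨hy, hy2⟩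
        refine ⟨A.mul_mem hx hy, ?_⟩
        have := K.mul_mem (K.mul_mem (hn x hx _ (hcon y hy x hx)) hx2) hy2
        rwa [show x * (y * x * y⁻¹ * x⁻¹) * x⁻¹ * x ^ 2 * y ^ 2 = (x * y) ^ 2 by
          rw [pow_two, pow_two, pow_two]; group] at this
      inv_mem' := by
        rintro x ⟨hx, hx2⟩
        exact ⟨A.inv_mem hx, by rw [inv_pow]; exact K.inv_mem hx2⟩ }
  have hTA : T ≤ A := fun x hx => hx.1
  have hKT : K ≤ T := fun x hx => ⟨hKA hx, K.pow_mem hx 2⟩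
  have hTn : NormalIn T A := by
    rintro a ha x ⟨hx, hx2⟩
    refine ⟨A.mul_mem (A.mul_mem ha hx) (A.inv_mem ha), ?_⟩
    rw [conj_pow]
    exact hn a ha _ hx2
  have : Finite T := Finite.of_injective _ (Subgroup.inclusion_injective hTA)
  have hle := Subgroup.card_le_of_le hKT
  rcases hA.normal_cases hTA hTn with h | h | ⟨h, -⟩
  · have := card_le_two h; omega
  · have hTK := Subgroup.eq_of_le_of_card_ge hKT (by omega)
    obtain ⟨x, hx, hp⟩ := hA.exists_prim
    obtain ⟨hx4, hx2⟩ : x ^ 4 ∈ pm ∧ x ^ 2 ∉ pm := by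
      rcases hp with h | h | h
      · omega
      · exact h.2
      · omega
    have hx8 : x ^ 8 = 1 := by
      have := sq_of_mem_pm hx4
      rwa [← pow_mul] at this
    have hx6 : x ^ 6 ∈ K := by
      have hnor : (K.subgroupOf A).Normal :=
        ⟨fun n hn' g => hn g g.2 n (Subgroup.mem_subgroupOf.1 hn')⟩
      have h1 := Subgroup.pow_index_mem (K.subgroupOf A) ⟨x, hx⟩
      have h2 : (K.subgroupOf A).index = 6 := by
        have := Subgroup.card_mul_relIndex_of_le hKA
        rw [hK, hc, Subgroup.relIndex] at this
        omega
      rw [h2] at h1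
      exact Subgroup.mem_subgroupOf.1 h1
    have hxT : x ∈ T := by
      refine ⟨hx, ?_⟩
      have := K.inv_mem hx6
      rwa [inv_eq_of_mul_eq_one_right (b := x ^ 2) (by rw [← pow_add]; exact hx8)] at this
    have hord : orderOf x = 8 :=
      orderOf_eq_prime_pow (p := 2) (n := 2)
        (fun h => hx2 (sq_eq_one_iff.1 (by rw [← pow_mul]; exact h))) hx8
    have hgen : Subgroup.zpowers x = T :=
      Subgroup.eq_of_le_of_card_ge (Subgroup.zpowers_le.2 hxT) (by rw [Nat.card_zpowers]; omega)
    refine hA.not_normalizes hp.notMem_pm fun a ha => ?_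
    refine eq_or_inv_of_comm ?_ (re_conj a x)
    refine commOn_zpowers x _ ?_ _ (Subgroup.mem_zpowers x)
    rw [hgen]
    exact hTn a ha x hxT
  · obtain ⟨y, hy, hy3⟩ := h.exists_orderOf_three
    have h3 : y ^ 3 = 1 := by rw [← hy3]; exact pow_orderOf_eq_one y
    have h1 := K.pow_mem hy.2 2
    rw [← pow_mul, pow_succ, h3, one_mul] at h1
    have h8 := orderOf_dvd_of_pow_eq_one (pow_card_mem h1)
    rw [hy3, hK] at h8
    omega

/-- The quotient is nonabelian of order six. This excludes a commutative `pr2`; in the other cases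
`k2` is unique of its order, either inside the cyclic part or as the normal subgroup of order 8.
Projections and kernels can thus be aligned before `conjugate_of_card_six` is applied. -/
theorem conjugate_of_card_fortyeight (h : AlmostConjugate Γ Γ') (hA : Exc (pr1 Γ))
    (hc : Nat.card (pr1 Γ) = 48) (hk : Nat.card (k1 Γ) = 8) : ConjugateSubgroups Γ Γ' := by
  have := h.1
  have := h.2.1
  have hn1 : NormalIn (k1 Γ) (pr1 Γ) := fun a ha x hx => k1_normal ha hx
  have hn1' : NormalIn (k1 Γ') (pr1 Γ') := fun a ha x hx => k1_normal ha hx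
  have hn2 : NormalIn (k2 Γ) (pr2 Γ) := fun a ha x hx => k2_normal ha hx
  have hn2' : NormalIn (k2 Γ') (pr2 Γ') := fun a ha x hx => k2_normal ha hx
  have hcom := hA.exists_commutator_notMem hc (k1_le_pr1 Γ) hn1 hk
  have hcB : Nat.card (pr2 Γ) = 6 * Nat.card (k2 Γ) := by
    have := card_mul_eq (Γ := Γ)
    rw [hc, hk] at this
    omega
  have hpos : 0 < Nat.card (k2 Γ) := Nat.card_pos
  have ec2 := (almostConjugate_k2 h).card_eq
  have ecB := (almostConjugate_pr2 h).card_eq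
  obtain ⟨g, hg⟩ := conjugate_of_almostConjugate (almostConjugate_pr1 h).symm
  replace hg : (pr1 Γ').cj g = pr1 Γ := hg
  have hgk : (k1 Γ').cj g = k1 Γ := by
    refine hA.eq_of_card_eight ?_ (k1_le_pr1 Γ) ?_ hn1 ?_ hk
    · rw [← hg]; exact Subgroup.cj_mono (k1_le_pr1 Γ')
    · rw [← hg]; exact hn1'.cj g
    · rw [Subgroup.card_cj, ← (almostConjugate_k1 h).card_eq, hk]
  obtain ⟨k, hk1, hk2⟩ : ∃ k, (pr2 Γ').cj k = pr2 Γ ∧ (k2 Γ').cj k = k2 Γ := by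
    rcases commOn_or_dih_or_exc (pr2 Γ) with hB | ⟨M, hB⟩ | hB
    · exfalso
      obtain ⟨a, ha, b, hb, hab⟩ := hcom
      obtain ⟨c, hac⟩ := mem_pr1.1 ha
      obtain ⟨d, hbd⟩ := mem_pr1.1 hb
      exact hab (commutator_mem_k1 hac hbd (hB _ (mem_pr2.2 ⟨_, hac⟩) _ (mem_pr2.2 ⟨_, hbd⟩)))
    · obtain ⟨M', hB', hM⟩ := exists_dih_of_almostConjugate hB (almostConjugate_pr2 h)
      obtain ⟨k, hk1, hk2⟩ := hB'.conjugate hB hM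
      refine ⟨k, hk1, ?_⟩
      have : Finite M := Finite.of_injective _ (Subgroup.inclusion_injective hB.le)
      refine CommOn.eq_of_card hB.comm ?_ (hB.normal_le (k2_le_pr2 Γ) hn2 (by omega)) ?_
      · rw [← hk2]
        exact Subgroup.cj_mono (hB'.normal_le (k2_le_pr2 Γ') hn2' (by omega))
      · rw [Subgroup.card_cj, ec2]
    · have hk8 : Nat.card (k2 Γ) = 8 ∧ Nat.card (pr2 Γ) = 48 := by
        have := hB.card
        rcases hB.normal_cases (k2_le_pr2 Γ) hn2 with h | h | ⟨h, -⟩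
        · have := card_le_two h; omega
        · omega
        · have := h.card; omega
      obtain ⟨k, hk1⟩ := conjugate_of_almostConjugate (almostConjugate_pr2 h).symm
      replace hk1 : (pr2 Γ').cj k = pr2 Γ := hk1
      refine ⟨k, hk1, hB.eq_of_card_eight ?_ (k2_le_pr2 Γ) ?_ hn2 ?_ hk8.1⟩
      · rw [← hk1]; exact Subgroup.cj_mono (k2_le_pr2 Γ')
      · rw [← hk1]; exact hn2'.cj k
      · rw [Subgroup.card_cj, ← ec2, hk8.1]
  apply ConjugateSubgroups.of_cj_right (g := (g, k))
  refine conjugate_of_card_six ?_ ?_ ?_ ?_ (by omega) hcom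
  · rw [pr1_cj]; exact hg
  · rw [pr2_cj]; exact hk1
  · rw [k1_cj]; exact hgk
  · rw [k2_cj]; exact hk2

theorem conjugate_of_exc_left (h : AlmostConjugate Γ Γ') (hA : Exc (pr1 Γ)) :
    ConjugateSubgroups Γ Γ' := by
  have := h.1
  have := h.2.1
  by_cases hle : Nat.card (pr1 Γ) ≤ 2 * Nat.card (k1 Γ)
  · exact conjugate_of_card_le h hle
  have hcard := hA.card
  rcases hA.normal_cases (k1_le_pr1 Γ) (fun a ha x hx => k1_normal ha hx) with
    h1 | ⟨h1, h2⟩ | ⟨-, h1 | h1⟩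
  · exact conjugate_of_exc_of_le_pm h hA h1
  · have he := card_mul_eq (Γ := Γ)
    have hpos : 0 < Nat.card (k2 Γ) := Nat.card_pos
    rcases hcard with hc | hc | hc
    · rw [hc, h1] at he
      have hn : NormalIn (k2 Γ) (pr2 Γ) := fun a ha x hx => k2_normal ha hx
      rcases commOn_or_dih_or_exc (pr2 Γ) with hB | ⟨M, hB⟩ | hB
      · exact conjugate_of_card_eight_comm h hA hc h1 hB
      -- The quotient has order 3, but in a dihedral group a normal subgroup of index above two lies
      -- in the cyclic part and has even index.
      · exfalso
        have h3 := Subgroup.card_mul_relIndex_of_le (hB.normal_le (k2_le_pr2 Γ) hn (by omega))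
        have h4 := hB.card
        have h5 : Nat.card (k2 Γ) * (2 * (k2 Γ).relIndex M) = Nat.card (k2 Γ) * 3 := by
          rw [mul_left_comm, h3]; omega
        have := Nat.eq_of_mul_eq_mul_left hpos h5
        omega
      · have hBc := hB.card
        have h8 : Nat.card (k2 Γ) = 8 := by
          rcases hB.normal_cases (k2_le_pr2 Γ) hn with h3 | h3 | ⟨-, h3 | h3⟩
          · have := card_le_two h3; omega
          · exact h3.1
          · rw [h3] at he; omega
          · omega
        exact conjugate_of_card_eight_exc h hA hB hc h1 (by omega) h8
    · exact conjugate_of_card_fortyeight h hA hc h1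
    · exact absurd hc h2
  · rw [h1] at hle; omega
  · omega

/-- Almost conjugate finite groups of pairs of unit quaternions are conjugate. -/
theorem conjugate_of_almostConjugate_prod (h : AlmostConjugate Γ Γ') : ConjugateSubgroups Γ Γ' := by
  have := h.1
  have hs := almostConjugate_swap h
  rcases commOn_or_dih_or_exc (pr1 Γ) with hA | ⟨L, hA⟩ | hA
  · rcases commOn_or_dih_or_exc (pr2 Γ) with hB | ⟨M, hB⟩ | hB
    · exact conjugate_of_commOn h hA hB
    · exact conjugate_of_comm_dih h hA hB
    · exact conjugate_of_swap (conjugate_of_exc_left hs (by rwa [pr1_swap]))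
  · rcases commOn_or_dih_or_exc (pr2 Γ) with hB | ⟨M, hB⟩ | hB
    · exact conjugate_of_swap (conjugate_of_comm_dih (M := L) hs (by rwa [pr1_swap])
        (by rwa [pr2_swap]))
    · exact conjugate_of_dih h hA hB
    · exact conjugate_of_swap (conjugate_of_exc_left hs (by rwa [pr1_swap]))
  · exact conjugate_of_exc_left h hA

end UnitQuat

/-! ### Transport along isomorphisms, and `SU(2)` as unit quaternions. -/

section Transfer

variable {G H : Type*} [Group G] [Group H]

theorem conjugate_of_mulEquiv (e : G ≃* H)
    (hH : ∀ Γ₁ Γ₂ : Subgroup H, AlmostConjugate Γ₁ Γ₂ → ConjugateSubgroups Γ₁ Γ₂)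
    (Γ₁ Γ₂ : Subgroup G) (h : AlmostConjugate Γ₁ Γ₂) : ConjugateSubgroups Γ₁ Γ₂ := by
  obtain ⟨h1, h2, φ, hφ⟩ := h
  obtain ⟨g, hg⟩ := hH (Γ₁.map e.toMonoidHom) (Γ₂.map e.toMonoidHom)
    ⟨Finite.of_equiv _ (e.subgroupMap Γ₁).toEquiv, Finite.of_equiv _ (e.subgroupMap Γ₂).toEquiv,
      ((e.subgroupMap Γ₁).toEquiv.symm.trans φ).trans (e.subgroupMap Γ₂).toEquiv, fun γ => by
        obtain ⟨γ, rfl⟩ := (e.subgroupMap Γ₁).surjective γ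
        obtain ⟨x, hx⟩ := hφ γ
        refine ⟨e x, ?_⟩
        show e x * e γ * (e x)⁻¹ =
          (e.subgroupMap Γ₂ (φ ((e.subgroupMap Γ₁).symm (e.subgroupMap Γ₁ γ))) : H)
        rw [MulEquiv.symm_apply_apply]
        show e x * e γ * (e x)⁻¹ = e (φ γ)
        rw [← hx, map_mul, map_mul, map_inv]⟩
  refine ⟨e.symm g, ?_⟩
  apply Subgroup.map_injective (f := e.toMonoidHom) e.injective
  rw [← hg, Subgroup.map_map, Subgroup.map_map]
  congr 1
  ext x
  simp

end Transfer

namespace UnitQuat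

/-- The matrix of a unit quaternion in `SU(2)`. -/
noncomputable def toMatrix (q : UnitQuat) : Matrix (Fin 2) (Fin 2) ℂ :=
  !![⟨(q : ℍ[ℝ]).re, (q : ℍ[ℝ]).imI⟩, ⟨(q : ℍ[ℝ]).imJ, (q : ℍ[ℝ]).imK⟩;
    ⟨-(q : ℍ[ℝ]).imJ, (q : ℍ[ℝ]).imK⟩, ⟨(q : ℍ[ℝ]).re, -(q : ℍ[ℝ]).imI⟩]

theorem toMatrix_mul (p q : UnitQuat) : toMatrix (p * q) = toMatrix p * toMatrix q := by
  ext i j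
  fin_cases i <;> fin_cases j <;>
    simp [toMatrix, Matrix.mul_apply, Complex.ext_iff] <;> constructor <;> ring

theorem toMatrix_mem (q : UnitQuat) : toMatrix q ∈ Matrix.specialUnitaryGroup (Fin 2) ℂ := by
  have h := sq_sum q
  rw [Matrix.mem_specialUnitaryGroup_iff, Matrix.mem_unitaryGroup_iff]
  constructor
  · ext i j
    fin_cases i <;> fin_cases j <;>
      simp [toMatrix, Matrix.mul_apply, Complex.ext_iff, Matrix.star_apply] <;>
      constructor <;> linarith
  · simp [toMatrix, Matrix.det_fin_two, Complex.ext_iff]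
    constructor <;> linarith

/-- Unit quaternions as elements of `SU(2)`. -/
noncomputable def toSU : UnitQuat →* SUGroup 2 where
  toFun q := ⟨toMatrix q, toMatrix_mem q⟩
  map_one' := by
    apply Subtype.ext
    ext i j
    fin_cases i <;> fin_cases j <;> simp [toMatrix, Complex.ext_iff]
  map_mul' p q := Subtype.ext (toMatrix_mul p q)

theorem toSU_bijective : Function.Bijective toSU := by
  constructor
  · intro p q h
    have h1 : toMatrix p = toMatrix q := congrArg Subtype.val h
    have h2 := congrFun (congrFun h1 0) 0
    have h3 := congrFun (congrFun h1 0) 1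
    simp only [toMatrix, Matrix.of_apply, Matrix.cons_val', Matrix.cons_val_zero,
      Matrix.cons_val_one, Complex.mk.injEq] at h2 h3
    exact ext' h2.1 h2.2 h3.1 h3.2
  · rintro ⟨U, hU⟩
    obtain ⟨hU1, hdet⟩ := Matrix.mem_specialUnitaryGroup_iff.1 hU
    -- In determinant 1 the adjugate is the inverse, which is the adjoint. For two by two matrices
    -- this equates the second row with the conjugate of the first up to order and sign.
    have hadj : U.adjugate = star U := by
      have h1 := Matrix.mem_unitaryGroup_iff.1 hU1
      have h2 := Matrix.adjugate_mul U
      rw [hdet, one_smul] at h2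
      calc U.adjugate = U.adjugate * (U * star U) := by rw [h1, mul_one]
        _ = star U := by rw [← mul_assoc, h2, one_mul]
    rw [Matrix.adjugate_fin_two] at hadj
    have e11 := congrFun (congrFun hadj 0) 0
    have e10 := congrFun (congrFun hadj 0) 1
    rw [Matrix.det_fin_two] at hdet
    simp [Matrix.star_apply] at e11 e10
    have e10' : U 1 0 = -(starRingEnd ℂ) (U 0 1) := by
      have := congrArg (starRingEnd ℂ) e10
      simpa using this.symm
    rw [e11, e10'] at hdet
    have hn : (U 0 0).re ^ 2 + (U 0 0).im ^ 2 + (U 0 1).re ^ 2 + (U 0 1).im ^ 2 = 1 := by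
      have := congrArg Complex.re hdet
      simp at this
      linarith
    refine ⟨mk4 (U 0 0).re (U 0 0).im (U 0 1).re (U 0 1).im hn, Subtype.ext ?_⟩
    show toMatrix _ = U
    ext i j
    fin_cases i <;> fin_cases j <;> simp [toMatrix, coe_mk4, e11, e10', Complex.ext_iff]

/-- `SU(2)` is the group of unit quaternions. -/
noncomputable def suEquiv : SUGroup 2 ≃* UnitQuat :=
  (MulEquiv.ofBijective toSU toSU_bijective).symm

theorem exists_sq_eq (x : UnitQuat) : ∃ y : UnitQuat, y ^ 2 = x := by
  have h1 := re_le_one x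
  have h2 : -1 ≤ re x := by nlinarith
  have h3 : re x ≤ 1 := by nlinarith
  have e1 : √((1 + re x) / 2) ^ 2 = (1 + re x) / 2 := Real.sq_sqrt (by linarith)
  have e2 : √((1 - re x) / 2) ^ 2 = (1 - re x) / 2 := Real.sq_sqrt (by linarith)
  obtain ⟨g, hg⟩ := exists_conj (x := mk4 √((1 + re x) / 2) √((1 - re x) / 2) 0 0
    (by rw [e1, e2]; ring) ^ 2) (y := x) (by
      rw [sq_coords, re, coe_mk4, quat_re, e1]; ring)
  exact ⟨_, by rw [conj_pow]; exact hg⟩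

/-- Write x = y² and let g conjugate y⁻¹, which has the trace of y, to y; then y (g y⁻¹ g⁻¹) = y².
-/
theorem exists_eq_commutator (x : UnitQuat) : ∃ y g : UnitQuat, y * g * y⁻¹ * g⁻¹ = x := by
  obtain ⟨y, rfl⟩ := exists_sq_eq x
  obtain ⟨g, hg⟩ := exists_conj (re_inv y)
  exact ⟨y, g, by rw [mul_assoc, mul_assoc, ← mul_assoc g, hg, pow_two]⟩

end UnitQuat

/-! ### `Spin(4)` through quaternionic matrices. -/

open CliffordAlgebra

namespace UnitQuat

/-- Vectors of `ℝ⁴` as quaternions. -/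
noncomputable def vecToQuat : (Fin 4 → ℝ) →ₗ[ℝ] ℍ[ℝ] where
  toFun v := quat (v 0) (v 1) (v 2) (v 3)
  map_add' v w := by apply Quaternion.ext <;> simp
  map_smul' r v := by apply Quaternion.ext <;> simp

/-- The image of a vector in the algebra of quaternionic matrices. -/
noncomputable def vecToMatrix : (Fin 4 → ℝ) →ₗ[ℝ] Matrix (Fin 2) (Fin 2) ℍ[ℝ] where
  toFun v := !![0, vecToQuat v; -star (vecToQuat v), 0]
  map_add' v w := by
    refine Matrix.ext fun i j => ?_
    fin_cases i <;> fin_cases j <;> simp [add_comm]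
  map_smul' r v := by
    refine Matrix.ext fun i j => ?_
    fin_cases i <;> fin_cases j <;> simp

theorem negEuclideanForm_four (v : Fin 4 → ℝ) :
    negEuclideanForm 4 v = -(v 0 ^ 2 + v 1 ^ 2 + v 2 ^ 2 + v 3 ^ 2) := by
  simp [negEuclideanForm, QuadraticMap.weightedSumSquares_apply, Fin.sum_univ_four]
  ring

theorem vecToMatrix_sq (v : Fin 4 → ℝ) : vecToMatrix v * vecToMatrix v =
    algebraMap ℝ (Matrix (Fin 2) (Fin 2) ℍ[ℝ]) (negEuclideanForm 4 v) := by
  rw [negEuclideanForm_four]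
  refine Matrix.ext fun i j => ?_
  fin_cases i <;> fin_cases j <;> apply Quaternion.ext <;>
    simp [vecToMatrix, vecToQuat, Matrix.mul_apply, Matrix.algebraMap_matrix_apply,
      -Quaternion.coe_pow] <;> ring

/-- The Clifford algebra of `ℝ⁴` acts by quaternionic matrices of size two. -/
noncomputable def cliffordRep :
    CliffordAlgebra (negEuclideanForm 4) →ₐ[ℝ] Matrix (Fin 2) (Fin 2) ℍ[ℝ] :=
  CliffordAlgebra.lift _ ⟨vecToMatrix, vecToMatrix_sq⟩

@[simp] theorem cliffordRep_ι (v : Fin 4 → ℝ) :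
    cliffordRep (ι (negEuclideanForm 4) v) = vecToMatrix v := by
  simp [cliffordRep]

/-- The coordinates of a quaternion. -/
def quatToVec (q : ℍ[ℝ]) : Fin 4 → ℝ := ![q.re, q.imI, q.imJ, q.imK]

@[simp] theorem vecToQuat_quatToVec (q : ℍ[ℝ]) : vecToQuat (quatToVec q) = q := by
  apply Quaternion.ext <;> simp [vecToQuat, quatToVec]

theorem cliffordRep_mul (p q : ℍ[ℝ]) :
    cliffordRep (ι (negEuclideanForm 4) (quatToVec p) * ι (negEuclideanForm 4) (quatToVec q)) =
      !![-(p * star q), 0; 0, -(star p * q)] := by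
  rw [map_mul, cliffordRep_ι, cliffordRep_ι]
  refine Matrix.ext fun i j => ?_
  fin_cases i <;> fin_cases j <;> simp [vecToMatrix, Matrix.mul_apply]

theorem cliffordRep_surjective : Function.Surjective cliffordRep := by
  have hd : ∀ v : ℍ[ℝ], !![v, 0; 0, star v] ∈ cliffordRep.range := fun v =>
    ⟨_, by
      have := cliffordRep_mul (-v) 1
      rwa [star_one, mul_one, mul_one, star_neg, neg_neg, neg_neg] at this⟩
  -- The matrix of i times that of j is diag(k, k); adding diag(k, -k) leaves diag(2k, 0), whose
  -- square is diag(-4, 0). This separates the two diagonal blocks.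
  have hk : !![(-1 : ℍ[ℝ]), 0; 0, 0] ∈ cliffordRep.range := by
    have h1 := cliffordRep.range.mul_mem (hd (quat 0 1 0 0)) (hd (quat 0 0 1 0))
    have h2 := cliffordRep.range.add_mem h1 (hd (quat 0 0 0 1))
    have h3 := cliffordRep.range.mul_mem h2 h2
    have h4 := cliffordRep.range.smul_mem h3 (1 / 4 : ℝ)
    convert h4 using 1
    refine Matrix.ext fun i j => ?_
    (fin_cases i <;> fin_cases j <;> apply Quaternion.ext <;> simp); norm_num
  have h1 : ∀ v : ℍ[ℝ], !![v, 0; 0, 0] ∈ cliffordRep.range := fun v => by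
    convert cliffordRep.range.mul_mem hk (hd (-v)) using 1
    refine Matrix.ext fun i j => ?_
    fin_cases i <;> fin_cases j <;> simp [Matrix.mul_apply]
  have h2 : ∀ v : ℍ[ℝ], !![0, 0; 0, v] ∈ cliffordRep.range := fun v => by
    convert cliffordRep.range.sub_mem (hd (star v)) (h1 (star v)) using 1
    refine Matrix.ext fun i j => ?_
    fin_cases i <;> fin_cases j <;> simp
  have hJ : !![(0 : ℍ[ℝ]), 1; -1, 0] ∈ cliffordRep.range := ⟨ι _ (quatToVec 1), by
    simp [vecToMatrix]⟩
  intro M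
  have h3 := cliffordRep.range.add_mem (cliffordRep.range.add_mem (h1 (M 0 0)) (h2 (M 1 1)))
    (cliffordRep.range.add_mem (cliffordRep.range.mul_mem (h1 (M 0 1)) hJ)
      (cliffordRep.range.mul_mem (h2 (-M 1 0)) hJ))
  show M ∈ cliffordRep.range
  convert h3 using 1
  refine Matrix.ext fun i j => ?_
  fin_cases i <;> fin_cases j <;> simp

/-- Both algebras have dimension 16, so surjectivity suffices. -/
theorem cliffordRep_injective : Function.Injective cliffordRep := by
  have := invertibleOfNonzero (two_ne_zero (α := ℝ))
  have b := (Pi.basisFun ℝ (Fin 4)).ExteriorAlgebra.map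
    (CliffordAlgebra.equivExterior (negEuclideanForm 4)).symm
  have : Module.Finite ℝ (CliffordAlgebra (negEuclideanForm 4)) := Module.Finite.of_basis b
  have h : Module.finrank ℝ (CliffordAlgebra (negEuclideanForm 4)) =
      Module.finrank ℝ (Matrix (Fin 2) (Fin 2) ℍ[ℝ]) := by
    rw [Module.finrank_eq_card_basis b, Module.finrank_matrix, Quaternion.finrank_eq_four]
    simp
  exact (LinearMap.injective_iff_surjective_of_finrank_eq_finrank h
    (f := cliffordRep.toLinearMap)).2 cliffordRep_surjective

theorem cliffordRep_star (x : CliffordAlgebra (negEuclideanForm 4)) :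
    cliffordRep (star x) = (cliffordRep x).conjTranspose := by
  induction x using CliffordAlgebra.induction with
  | algebraMap r =>
    rw [star_algebraMap, AlgHom.commutes]
    refine Matrix.ext fun i j => ?_
    fin_cases i <;> fin_cases j <;> simp [Matrix.algebraMap_matrix_apply]
  | ι v =>
    rw [star_ι, map_neg, cliffordRep_ι]
    refine Matrix.ext fun i j => ?_
    fin_cases i <;> fin_cases j <;> simp [vecToMatrix]
  | mul a b ha hb => rw [star_mul, map_mul, map_mul, ha, hb, Matrix.conjTranspose_mul]
  | add a b ha hb => rw [star_add, map_add, map_add, ha, hb, Matrix.conjTranspose_add]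

theorem cliffordRep_even {x : CliffordAlgebra (negEuclideanForm 4)} (hx : x ∈ evenOdd _ 0) :
    cliffordRep x 0 1 = 0 ∧ cliffordRep x 1 0 = 0 := by
  induction x, hx using CliffordAlgebra.even_induction with
  | algebraMap r => simp [Matrix.algebraMap_matrix_apply]
  | add x y hx hy ihx ihy => simp [ihx, ihy]
  | ι_mul_ι_mul v w x hx ih => simp [vecToMatrix, Matrix.mul_apply, ih]

theorem cliffordRep_spin (x : SpinGroup 4) :
    cliffordRep x 0 1 = 0 ∧ cliffordRep x 1 0 = 0 := by
  apply cliffordRep_even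
  rw [← even_toSubmodule]
  exact spinGroup.mem_even x.2

theorem cliffordRep_unitary (x : SpinGroup 4) :
    cliffordRep x 0 0 ∈ unitary ℍ[ℝ] ∧ cliffordRep x 1 1 ∈ unitary ℍ[ℝ] := by
  obtain ⟨h1, h2⟩ := cliffordRep_spin x
  have e1 := congrArg cliffordRep (spinGroup.star_mul_self_of_mem x.2)
  have e2 := congrArg cliffordRep (spinGroup.mul_star_self_of_mem x.2)
  rw [map_mul, cliffordRep_star, map_one] at e1 e2
  refine ⟨Unitary.mem_iff.2 ⟨?_, ?_⟩, Unitary.mem_iff.2 ⟨?_, ?_⟩⟩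
  · simpa [Matrix.mul_apply, h1, h2] using congrFun (congrFun e1 0) 0
  · simpa [Matrix.mul_apply, h1, h2] using congrFun (congrFun e2 0) 0
  · simpa [Matrix.mul_apply, h1, h2] using congrFun (congrFun e1 1) 1
  · simpa [Matrix.mul_apply, h1, h2] using congrFun (congrFun e2 1) 1

/-- The two half-spin representations of `Spin(4)`. -/
noncomputable def spinHom : SpinGroup 4 →* UnitQuat × UnitQuat where
  toFun x := (⟨_, (cliffordRep_unitary x).1⟩, ⟨_, (cliffordRep_unitary x).2⟩)
  map_one' := by
    refine Prod.ext (Subtype.ext ?_) (Subtype.ext ?_) <;> simp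
  map_mul' x y := by
    obtain ⟨h1, h2⟩ := cliffordRep_spin x
    refine Prod.ext (Subtype.ext ?_) (Subtype.ext ?_) <;> simp [Matrix.mul_apply, h1, h2]

theorem spinHom_injective : Function.Injective spinHom := by
  intro x y h
  apply Subtype.ext
  apply cliffordRep_injective
  obtain ⟨h1, h2⟩ := cliffordRep_spin x
  obtain ⟨h3, h4⟩ := cliffordRep_spin y
  have e1 : cliffordRep x 0 0 = cliffordRep y 0 0 := congrArg (fun z => (z.1 : ℍ[ℝ])) h
  have e2 : cliffordRep x 1 1 = cliffordRep y 1 1 := congrArg (fun z => (z.2 : ℍ[ℝ])) h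
  refine Matrix.ext fun i j => ?_
  fin_cases i <;> fin_cases j <;> simp [h1, h2, h3, h4, e1, e2]

end UnitQuat

theorem ι_mem_pinGroup {n : ℕ} {v : Fin n → ℝ} (hv : negEuclideanForm n v = -1) :
    ι (negEuclideanForm n) v ∈ pinGroup (negEuclideanForm n) := by
  have h := ι_sq_scalar (negEuclideanForm n) v
  rw [hv, map_neg, map_one] at h
  refine ⟨⟨⟨ι _ v, -ι _ v, by rw [mul_neg, h, neg_neg], by rw [neg_mul, h, neg_neg]⟩,
    Subgroup.subset_closure ⟨v, rfl⟩, rfl⟩, ?_⟩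
  refine Unitary.mem_iff.2 ?_
  rw [star_ι, neg_mul, mul_neg, h]
  simp

theorem ι_mul_ι_mem_spinGroup {n : ℕ} {v w : Fin n → ℝ} (hv : negEuclideanForm n v = -1)
    (hw : negEuclideanForm n w = -1) :
    ι (negEuclideanForm n) v * ι (negEuclideanForm n) w ∈ spinGroup (negEuclideanForm n) :=
  ⟨mul_mem (ι_mem_pinGroup hv) (ι_mem_pinGroup hw), ι_mul_ι_mem_evenOdd_zero _ v w⟩

namespace UnitQuat

theorem negEuclideanForm_quatToVec (q : UnitQuat) : negEuclideanForm 4 (quatToVec q) = -1 := by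
  rw [negEuclideanForm_four, ← sq_sum q]
  rfl

theorem mem_range_spinHom (p q : UnitQuat) : (-(p * q⁻¹), -(p⁻¹ * q)) ∈ spinHom.range := by
  refine ⟨⟨_, ι_mul_ι_mem_spinGroup (negEuclideanForm_quatToVec p)
    (negEuclideanForm_quatToVec q)⟩, ?_⟩
  refine Prod.ext (Subtype.ext ?_) (Subtype.ext ?_)
  · exact congrFun (congrFun (cliffordRep_mul p q) 0) 0
  · exact congrFun (congrFun (cliffordRep_mul p q) 1) 1

/-- The image contains all (p, p⁻¹). Multiplying three of them so that the first coordinates cancel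
produces (1, commutator), and every unit quaternion is a commutator. -/
theorem spinHom_surjective : Function.Surjective spinHom := by
  have h1 : ∀ p : UnitQuat, (p, p⁻¹) ∈ spinHom.range := by
    intro p
    have := mem_range_spinHom (-p) 1
    rwa [inv_one, mul_one, mul_one, neg_neg, show -(-p)⁻¹ = p⁻¹ by
      rw [← neg_one_mul p, mul_inv_rev, show (-1 : UnitQuat)⁻¹ = -1 by
        rw [inv_eq_iff_mul_eq_one]; simp]; simp] at this
  have h2 : ∀ q : UnitQuat, (1, q) ∈ spinHom.range := by
    intro q
    obtain ⟨y, g, rfl⟩ := exists_eq_commutator q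
    have := spinHom.range.mul_mem (spinHom.range.mul_mem (h1 y⁻¹) (h1 g⁻¹)) (h1 (g * y))
    simpa [mul_assoc] using this
  rintro ⟨p, q⟩
  have := spinHom.range.mul_mem (h1 p) (h2 (p * q))
  simpa using this

/-- `Spin(4)` is the group of pairs of unit quaternions. -/
noncomputable def spinEquiv : SpinGroup 4 ≃* UnitQuat × UnitQuat :=
  MulEquiv.ofBijective spinHom ⟨spinHom_injective, spinHom_surjective⟩

end UnitQuat

/-! ### Two binary codes and `O(6)`. -/

/-- Diagonal sign matrices. -/
noncomputable def signMatrix : (Fin 6 → ℤˣ) →* OGroup 6 where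
  toFun s := ⟨Matrix.diagonal fun i => ((s i : ℤ) : ℝ), by
    rw [Matrix.mem_orthogonalGroup_iff, Matrix.diagonal_transpose, Matrix.diagonal_mul_diagonal,
      ← Matrix.diagonal_one]
    congr 1
    funext i
    rcases Int.units_eq_one_or (s i) with h | h <;> simp [h]⟩
  map_one' := by
    apply Subtype.ext
    simp
  map_mul' s t := by
    apply Subtype.ext
    simp [Matrix.diagonal_mul_diagonal]

theorem coe_signMatrix (s : Fin 6 → ℤˣ) :
    (signMatrix s : Matrix (Fin 6) (Fin 6) ℝ) = Matrix.diagonal fun i => ((s i : ℤ) : ℝ) := rfl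

theorem trace_signMatrix (s : Fin 6 → ℤˣ) :
    (signMatrix s : Matrix (Fin 6) (Fin 6) ℝ).trace = ((∑ i, (s i : ℤ) : ℤ) : ℝ) := by
  rw [coe_signMatrix, Matrix.trace_diagonal]
  push_cast
  rfl

theorem signMatrix_injective : Function.Injective signMatrix := by
  intro s t h
  funext i
  have h1 := congrFun (congrFun (congrArg Subtype.val h) i) i
  rw [coe_signMatrix, coe_signMatrix, Matrix.diagonal_apply_eq, Matrix.diagonal_apply_eq] at h1
  exact Units.ext (by exact_mod_cast h1)

/-- Sign vectors with equally many negative entries give conjugate matrices. -/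
theorem exists_conj_signMatrix {s t : Fin 6 → ℤˣ}
    (h : ∀ c, Fintype.card {i // s i = c} = Fintype.card {i // t i = c}) :
    ∃ x : OGroup 6, x * signMatrix s * x⁻¹ = signMatrix t := by
  have e := fun c => Fintype.equivOfCardEq (h c)
  set π : Equiv.Perm (Fin 6) := Equiv.ofFiberEquiv e with hπ
  have hst : ∀ i, t (π i) = s i := fun i => Equiv.ofFiberEquiv_map e i
  have hmem : Equiv.Perm.permMatrix ℝ π⁻¹ ∈ Matrix.orthogonalGroup (Fin 6) ℝ := by
    rw [Matrix.mem_orthogonalGroup_iff, Matrix.transpose_permMatrix, ← Matrix.permMatrix_mul,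
      inv_inv, mul_inv_cancel, Matrix.permMatrix_one]
  refine ⟨⟨_, hmem⟩, ?_⟩
  rw [mul_inv_eq_iff_eq_mul]
  apply Subtype.ext
  show Equiv.Perm.permMatrix ℝ π⁻¹ * (signMatrix s : Matrix (Fin 6) (Fin 6) ℝ) =
    (signMatrix t : Matrix (Fin 6) (Fin 6) ℝ) * Equiv.Perm.permMatrix ℝ π⁻¹
  rw [coe_signMatrix, coe_signMatrix]
  ext i j
  rw [Matrix.mul_diagonal, Matrix.diagonal_mul]
  by_cases hij : π⁻¹ i = j
  · have : t i = s j := by rw [← hij, ← hst]; exact congrArg t (π.apply_symm_apply i).symm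
    rw [this, mul_comm]
  · have : Equiv.Perm.permMatrix ℝ π⁻¹ i j = 0 :=
      (PEquiv.toMatrix_apply _ _ _).trans (by simpa [Equiv.toPEquiv_apply] using hij)
    rw [this, mul_zero, zero_mul]

/-- The code generated by `110000`, `001100`, `000011`. -/
def pairCode : ℤˣ × ℤˣ × ℤˣ →* (Fin 6 → ℤˣ) where
  toFun v := ![v.1, v.1, v.2.1, v.2.1, v.2.2, v.2.2]
  map_one' := by decide
  map_mul' := by decide

/-- The code generated by `110000`, `101000`, `111111`. -/
def evenCode : ℤˣ × ℤˣ × ℤˣ →* (Fin 6 → ℤˣ) where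
  toFun v := ![v.1 * v.2.1 * v.2.2, v.1 * v.2.2, v.2.1 * v.2.2, v.2.2, v.2.2, v.2.2]
  map_one' := by decide
  map_mul' := by decide

/-- A bijection between the two codes that preserves the weight. -/
def codeMap (v : ℤˣ × ℤˣ × ℤˣ) : ℤˣ × ℤˣ × ℤˣ :=
  (v.1 * v.2.2, v.1 * v.2.1, if v.1 = v.2.1 then v.1 else v.2.2)

theorem codeMap_bijective : Function.Bijective codeMap := by decide

theorem card_codeMap : ∀ v c, Fintype.card {i // pairCode v i = c} =
    Fintype.card {i // evenCode (codeMap v) i = c} := by decide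

theorem pairCode_injective : Function.Injective pairCode := by decide

theorem evenCode_injective : Function.Injective evenCode := by decide

theorem evenCode_of_sum : ∀ v, ∑ i, (evenCode v i : ℤ) = 2 → v.2.2 = 1 := by decide

/-- Words of equal weight give conjugate matrices, by permuting coordinates. Trace 2 means weight
two. The three words of weight two of the first code multiply to -1, which every conjugation fixes,
whereas those of the second code lie in the subgroup with `v.2.2 = 1`, which omits -1. -/
theorem exists_orthogonal_pair : ∃ Γ₁ Γ₂ : Subgroup (OGroup 6),
    AlmostConjugate Γ₁ Γ₂ ∧ ¬ ConjugateSubgroups Γ₁ Γ₂ := by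
  have i1 : Function.Injective (signMatrix.comp pairCode) :=
    signMatrix_injective.comp pairCode_injective
  have i2 : Function.Injective (signMatrix.comp evenCode) :=
    signMatrix_injective.comp evenCode_injective
  refine ⟨(signMatrix.comp pairCode).range, (signMatrix.comp evenCode).range,
    ⟨inferInstance, inferInstance, ((MonoidHom.ofInjective i1).toEquiv.symm.trans
      (Equiv.ofBijective _ codeMap_bijective)).trans (MonoidHom.ofInjective i2).toEquiv, ?_⟩, ?_⟩
  · intro γ
    obtain ⟨v, rfl⟩ := (MonoidHom.ofInjective i1).surjective γ
    obtain ⟨x, hx⟩ := exists_conj_signMatrix (card_codeMap v)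
    refine ⟨x, ?_⟩
    show x * signMatrix (pairCode v) * x⁻¹ = ((MonoidHom.ofInjective i2) (codeMap
      ((MonoidHom.ofInjective i1).symm ((MonoidHom.ofInjective i1) v))) : OGroup 6)
    rw [MulEquiv.symm_apply_apply]
    exact hx
  · rintro ⟨g, hg⟩
    have key : ∀ v, ∑ i, (pairCode v i : ℤ) = 2 → ∃ w : ℤˣ × ℤˣ × ℤˣ, w.2.2 = 1 ∧
        g * signMatrix (pairCode v) * g⁻¹ = signMatrix (evenCode w) := by
      intro v hv
      have hm : g * signMatrix (pairCode v) * g⁻¹ ∈ (signMatrix.comp evenCode).range := by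
        rw [← hg]
        exact ⟨_, ⟨v, rfl⟩, rfl⟩
      obtain ⟨w, hw⟩ := hm
      refine ⟨w, evenCode_of_sum w ?_, hw.symm⟩
      have h1 := congrArg (fun x : OGroup 6 => (x : Matrix (Fin 6) (Fin 6) ℝ).trace) hw
      have h2 : ((g * signMatrix (pairCode v) * g⁻¹ : OGroup 6) : Matrix (Fin 6) (Fin 6) ℝ).trace =
          (signMatrix (pairCode v) : Matrix (Fin 6) (Fin 6) ℝ).trace := by
        show (g.1 * (signMatrix (pairCode v)).1 * (g⁻¹).1).trace = _
        rw [Matrix.trace_mul_comm, ← mul_assoc]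
        have : (g⁻¹).1 * g.1 = 1 := congrArg Subtype.val (inv_mul_cancel g)
        rw [this, one_mul]
      simp only [h2] at h1
      rw [trace_signMatrix, hv] at h1
      have h3 := trace_signMatrix (evenCode w)
      have h4 : ((∑ i, (evenCode w i : ℤ) : ℤ) : ℝ) = ((2 : ℤ) : ℝ) := h3.symm.trans h1
      exact_mod_cast h4
    obtain ⟨w1, hw1, e1⟩ := key (-1, 1, 1) (by decide)
    obtain ⟨w2, hw2, e2⟩ := key (1, -1, 1) (by decide)
    obtain ⟨w3, hw3, e3⟩ := key (1, 1, -1) (by decide)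
    have h1 : signMatrix (evenCode (w1 * w2 * w3)) = g * signMatrix (pairCode (-1, -1, -1)) * g⁻¹ := by
      have : ((-1, -1, -1) : ℤˣ × ℤˣ × ℤˣ) = (-1, 1, 1) * (1, -1, 1) * (1, 1, -1) := by decide
      rw [this]
      simp only [map_mul, ← e1, ← e2, ← e3]
      group
    have h2 : g * signMatrix (pairCode (-1, -1, -1)) * g⁻¹ = signMatrix (pairCode (-1, -1, -1)) := by
      rw [mul_inv_eq_iff_eq_mul]
      apply Subtype.ext
      show g.1 * (signMatrix (pairCode (-1, -1, -1))).1 = (signMatrix (pairCode (-1, -1, -1))).1 * g.1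
      have : (signMatrix (pairCode (-1, -1, -1))).1 = -1 := by
        rw [coe_signMatrix, ← Matrix.diagonal_one, Matrix.diagonal_neg]
        congr 1
        funext i
        fin_cases i <;> simp [pairCode]
      rw [this, mul_neg, neg_mul, mul_one, one_mul]
    have h3 := congrFun (signMatrix_injective (h1.trans h2)) 5
    have h4 : evenCode (w1 * w2 * w3) 5 = w1.2.2 * w2.2.2 * w3.2.2 := rfl
    rw [h4, hw1, hw2, hw3] at h3
    exact absurd h3 (by decide)

/-! ### Preimages of Klein four-groups modulo a central subgroup. -/

/-- The homomorphism from the Klein four-group given by two commuting involutions. -/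
def kleinHom {H : Type*} [Group H] (a b : H) (ha : a * a = 1) (hb : b * b = 1)
    (hab : a * b = b * a) : ℤˣ × ℤˣ →* H where
  toFun v := (if v.1 = 1 then 1 else a) * (if v.2 = 1 then 1 else b)
  map_one' := by simp
  map_mul' u v := by
    have hneg : ¬ (-1 : ℤˣ) = 1 := by decide
    have h1 : a * (a * b) = b := by rw [← mul_assoc, ha, one_mul]
    have h2 : b * (a * b) = a := by rw [hab, ← mul_assoc, hb, one_mul]
    have h3 : a * b * (a * b) = 1 := by rw [mul_assoc, h2, ha]
    have h4 : a * b * a = b := by rw [mul_assoc, ← hab, h1]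
    have h5 : a * b * b = a := by rw [mul_assoc, hb, mul_one]
    obtain ⟨u1, u2⟩ := u
    obtain ⟨v1, v2⟩ := v
    rcases Int.units_eq_one_or u1 with rfl | rfl <;> rcases Int.units_eq_one_or u2 with rfl | rfl <;>
      rcases Int.units_eq_one_or v1 with rfl | rfl <;>
        rcases Int.units_eq_one_or v2 with rfl | rfl <;>
          simp [hneg, ha, hb, h1, h2, h3, h4, h5, hab.symm]

theorem kleinHom_injective {H : Type*} [Group H] {a b : H} {ha : a * a = 1} {hb : b * b = 1}
    {hab : a * b = b * a} (h1 : a ≠ 1) (h2 : b ≠ 1) (h3 : a * b ≠ 1) :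
    Function.Injective (kleinHom a b ha hb hab) := by
  rw [injective_iff_map_eq_one]
  have hneg : ¬ (-1 : ℤˣ) = 1 := by decide
  rintro ⟨u, v⟩ h
  rcases Int.units_eq_one_or u with rfl | rfl <;> rcases Int.units_eq_one_or v with rfl | rfl
  · rfl
  · exact absurd (by simpa [kleinHom, hneg] using h) h2
  · exact absurd (by simpa [kleinHom, hneg] using h) h1
  · exact absurd (by simpa [kleinHom, hneg] using h) h3

section Central

variable {G : Type*} [Group G] {Z : Subgroup G} [Z.Normal]

/-- The elements of a subgroup that contains `Z`, as a product. -/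
noncomputable def sectionEquiv {V : Type*} [Group V] {f : V →* G ⧸ Z}
    (hf : Function.Injective f) (P : V → G) (hP : ∀ v, (P v : G ⧸ Z) = f v) :
    Z × V ≃ f.range.comap (QuotientGroup.mk' Z) :=
  Equiv.ofBijective (fun p => ⟨p.1 * P p.2, p.2, by
      rw [← hP, map_mul]
      simp [(QuotientGroup.eq_one_iff _).2 p.1.2]⟩) <| by
    constructor
    · rintro ⟨z, v⟩ ⟨w, u⟩ h
      have h1 : (z : G) * P v = w * P u := congrArg Subtype.val h
      have h2 := congrArg (fun x : G => (x : G ⧸ Z)) h1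
      simp only [QuotientGroup.mk_mul, (QuotientGroup.eq_one_iff _).2 z.2,
        (QuotientGroup.eq_one_iff _).2 w.2, one_mul, hP] at h2
      obtain rfl := hf h2
      obtain rfl := Subtype.ext (mul_right_cancel h1)
      rfl
    · rintro ⟨x, v, hv⟩
      refine ⟨(⟨x * (P v)⁻¹, ?_⟩, v), Subtype.ext ?_⟩
      · rw [← QuotientGroup.eq_one_iff, QuotientGroup.mk_mul, QuotientGroup.mk_inv, hP, hv]
        exact mul_inv_cancel _
      · simp

/-- A conjugation of P v to Q v also takes z (P v) to z (Q v), since z is central; so it is enough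
to compare one representative in each coset. -/
theorem almostConjugate_of_sections (hZ : Z ≤ Subgroup.center G) [Finite Z] {V : Type*} [Group V]
    [Finite V] {f g : V →* G ⧸ Z} (hf : Function.Injective f) (hg : Function.Injective g)
    (P Q : V → G) (hP : ∀ v, (P v : G ⧸ Z) = f v) (hQ : ∀ v, (Q v : G ⧸ Z) = g v)
    (h : ∀ v, IsConj (P v) (Q v)) :
    AlmostConjugate (f.range.comap (QuotientGroup.mk' Z))
      (g.range.comap (QuotientGroup.mk' Z)) := by
  refine ⟨Finite.of_equiv _ (sectionEquiv hf P hP), Finite.of_equiv _ (sectionEquiv hg Q hQ),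
    (sectionEquiv hf P hP).symm.trans (sectionEquiv hg Q hQ), fun γ => ?_⟩
  obtain ⟨⟨z, v⟩, rfl⟩ := (sectionEquiv hf P hP).surjective γ
  obtain ⟨x, hx⟩ := isConj_iff.1 (h v)
  refine ⟨x, ?_⟩
  rw [Equiv.trans_apply, Equiv.symm_apply_apply]
  show x * (z * P v) * x⁻¹ = z * Q v
  rw [← hx, ← mul_assoc, Subgroup.mem_center_iff.1 (hZ z.2) x]
  group

/-- The groups are the preimages of the Klein groups {1, A, B, AB} and {1, A, D, AD} of G / Z. C and
E represent the fourth cosets, chosen so as to be conjugate. A and D commute only modulo Z, so just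
one of the preimages is commutative. -/
theorem exists_almostConjugate_of_isConj (hZ : Z ≤ Subgroup.center G) [Finite Z] {A B C D E : G}
    (hA : A * A ∈ Z) (hB : B * B ∈ Z) (hD : D * D ∈ Z) (hAB : A * B = B * A)
    (hAD : ∃ z ∈ Z, A * D = z * (D * A)) (hne : A * D ≠ D * A)
    (hC : ∃ z ∈ Z, C = z * (A * B)) (hE : ∃ z ∈ Z, E = z * (A * D))
    (hA' : A ∉ Z) (hB' : B ∉ Z) (hC' : C ∉ Z) (hD' : D ∉ Z) (hE' : E ∉ Z)
    (hBD : IsConj B D) (hCE : IsConj C E) :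
    ∃ Γ₁ Γ₂ : Subgroup G, AlmostConjugate Γ₁ Γ₂ ∧ CommOn Γ₁ ∧ ¬ CommOn Γ₂ := by
  have hq : ∀ {x : G}, x ∈ Z → (x : G ⧸ Z) = 1 := fun h => (QuotientGroup.eq_one_iff _).2 h
  have hq' : ∀ {x : G}, x ∉ Z → (x : G ⧸ Z) ≠ 1 := fun h h' => h ((QuotientGroup.eq_one_iff _).1 h')
  have hmul : ∀ {x y : G}, (∃ z ∈ Z, x = z * y) → (x : G ⧸ Z) = y := by
    rintro _ y ⟨z, hz, rfl⟩
    rw [QuotientGroup.mk_mul, hq hz, one_mul]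
  have hneg : ¬ (-1 : ℤˣ) = 1 := by decide
  have eC : (C : G ⧸ Z) = A * B := hmul hC
  have eE : (E : G ⧸ Z) = A * D := hmul hE
  let f := kleinHom (A : G ⧸ Z) B (hq hA) (hq hB) (congrArg (fun x : G => (x : G ⧸ Z)) hAB)
  let g := kleinHom (A : G ⧸ Z) D (hq hA) (hq hD) (hmul hAD)
  have hf : Function.Injective f := kleinHom_injective (hq' hA') (hq' hB') (eC ▸ hq' hC')
  have hg : Function.Injective g := kleinHom_injective (hq' hA') (hq' hD') (eE ▸ hq' hE')
  let P : ℤˣ × ℤˣ → G := fun v =>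
    if v.1 = 1 then if v.2 = 1 then 1 else B else if v.2 = 1 then A else C
  let Q : ℤˣ × ℤˣ → G := fun v =>
    if v.1 = 1 then if v.2 = 1 then 1 else D else if v.2 = 1 then A else E
  have hP : ∀ v, (P v : G ⧸ Z) = f v := by
    rintro ⟨u, v⟩
    by_cases hu : u = 1 <;> by_cases hv : v = 1 <;> simp [P, f, kleinHom, hu, hv, eC]
  have hQ : ∀ v, (Q v : G ⧸ Z) = g v := by
    rintro ⟨u, v⟩
    by_cases hu : u = 1 <;> by_cases hv : v = 1 <;> simp [Q, g, kleinHom, hu, hv, eE]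
  refine ⟨_, _, almostConjugate_of_sections hZ hf hg P Q hP hQ ?_, ?_, ?_⟩
  · rintro ⟨u, v⟩
    by_cases hu : u = 1 <;> by_cases hv : v = 1 <;> simp only [P, Q, hu, hv, ↓reduceIte]
    exacts [IsConj.refl _, hBD, IsConj.refl _, hCE]
  · have hz : ∀ z : Z, ∀ x : G, x * z = z * x := fun z => Subgroup.mem_center_iff.1 (hZ z.2)
    have hAC : A * C = C * A := by
      obtain ⟨z, hz', rfl⟩ := hC
      exact Commute.mul_right (hz ⟨z, hz'⟩ A) (Commute.mul_right rfl hAB)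
    have hBC : B * C = C * B := by
      obtain ⟨z, hz', rfl⟩ := hC
      exact Commute.mul_right (hz ⟨z, hz'⟩ B) (Commute.mul_right hAB.symm rfl)
    have hPP : ∀ u v, P u * P v = P v * P u := by
      rintro ⟨u, v⟩ ⟨u', v'⟩
      by_cases hu : u = 1 <;> by_cases hv : v = 1 <;> by_cases hu' : u' = 1 <;>
        by_cases hv' : v' = 1 <;> simp [P, hu, hv, hu', hv', hAB, hAC, hBC]
    intro x hx y hy
    obtain ⟨⟨z, v⟩, h1⟩ := (sectionEquiv hf P hP).surjective ⟨x, hx⟩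
    obtain ⟨⟨w, u⟩, h2⟩ := (sectionEquiv hf P hP).surjective ⟨y, hy⟩
    have h3 : (z : G) * P v = x := congrArg Subtype.val h1
    have h4 : (w : G) * P u = y := congrArg Subtype.val h2
    rw [← h3, ← h4]
    calc (z : G) * P v * (w * P u) = z * (P v * w) * P u := by group
      _ = (z * w) * (P v * P u) := by rw [hz w]; group
      _ = (w * z) * (P u * P v) := by rw [hPP, hz w]
      _ = w * (z * P u) * P v := by group
      _ = w * P u * (z * P v) := by rw [← hz z]; group
  · intro h
    refine hne (h A ⟨(-1, 1), ?_⟩ D ⟨(1, -1), ?_⟩)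
    · simp [g, kleinHom, hneg]
    · simp [g, kleinHom, hneg]

end Central

theorem not_conjugate_of_commOn {G : Type*} [Group G] {Γ₁ Γ₂ : Subgroup G} (h₁ : CommOn Γ₁)
    (h₂ : ¬ CommOn Γ₂) : ¬ ConjugateSubgroups Γ₁ Γ₂ := by
  rintro ⟨g, rfl⟩
  apply h₂
  rintro _ ⟨x, hx, rfl⟩ _ ⟨y, hy, rfl⟩
  rw [← map_mul, ← map_mul, h₁ x hx y hy]

section Inclusion

variable {G H : Type*} [Group G] [Group H] {i : G →* H}

theorem AlmostConjugate.map {Γ₁ Γ₂ : Subgroup G} (h : AlmostConjugate Γ₁ Γ₂)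
    (hi : Function.Injective i) : AlmostConjugate (Γ₁.map i) (Γ₂.map i) := by
  obtain ⟨h₁, h₂, φ, hφ⟩ := h
  let e := fun Γ : Subgroup G => (Γ.equivMapOfInjective i hi).toEquiv
  refine ⟨Finite.of_equiv _ (e Γ₁), Finite.of_equiv _ (e Γ₂),
    ((e Γ₁).symm.trans φ).trans (e Γ₂), fun γ => ?_⟩
  obtain ⟨γ, rfl⟩ := (e Γ₁).surjective γ
  obtain ⟨x, hx⟩ := hφ γ
  refine ⟨i x, ?_⟩
  rw [Equiv.trans_apply, Equiv.trans_apply, Equiv.symm_apply_apply]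
  show i x * i γ * (i x)⁻¹ = i (φ γ)
  rw [← hx, map_mul, map_mul, map_inv]

theorem commOn_map_iff {Γ : Subgroup G} (hi : Function.Injective i) :
    CommOn (Γ.map i) ↔ CommOn Γ := by
  refine ⟨fun h x hx y hy => hi ?_, ?_⟩
  · rw [map_mul, map_mul]
    exact h _ ⟨x, hx, rfl⟩ _ ⟨y, hy, rfl⟩
  · rintro h _ ⟨x, hx, rfl⟩ _ ⟨y, hy, rfl⟩
    rw [← map_mul, ← map_mul, h x hx y hy]

end Inclusion

/-! ### Products of two generators in the spin group. -/

section Vectors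

variable {n : ℕ}

/-- The generators of the Clifford algebra. -/
noncomputable def gen (i : Fin n) : CliffordAlgebra (negEuclideanForm n) :=
  ι (negEuclideanForm n) (Pi.single i 1)

theorem negEuclideanForm_single (i : Fin n) : negEuclideanForm n (Pi.single i 1) = -1 := by
  simp [negEuclideanForm, QuadraticMap.weightedSumSquares_apply, Pi.single_apply]

theorem negEuclideanForm_single_add {i j : Fin n} (h : i ≠ j) (c : ℝ) :
    negEuclideanForm n (c • (Pi.single i 1 + Pi.single j 1)) = -(2 * c ^ 2) := by
  have : ∀ k : Fin n, (-1 : ℝ) • ((c • (Pi.single i 1 + Pi.single j 1) : Fin n → ℝ) k *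
      (c • (Pi.single i 1 + Pi.single j 1) : Fin n → ℝ) k) =
      (if k = i then -c ^ 2 else 0) + (if k = j then -c ^ 2 else 0) := by
    intro k
    by_cases h1 : k = i <;> by_cases h2 : k = j
    · exact absurd (h1.symm.trans h2) h
    all_goals simp [h1, h2, h, h.symm]
    all_goals ring
  rw [negEuclideanForm, QuadraticMap.weightedSumSquares_apply, Finset.sum_congr rfl fun k _ => this k,
    Finset.sum_add_distrib]
  simp
  ring

theorem gen_sq (i : Fin n) : gen i * gen i = -1 := by
  rw [gen, ι_sq_scalar, negEuclideanForm_single, map_neg, map_one]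

theorem gen_mul_gen {i j : Fin n} (h : i ≠ j) : gen i * gen j = -(gen j * gen i) := by
  have h1 := ι_sq_scalar (negEuclideanForm n) ((1 : ℝ) • (Pi.single i 1 + Pi.single j 1))
  rw [negEuclideanForm_single_add h, one_smul, map_add] at h1
  change (gen i + gen j) * (gen i + gen j) = _ at h1
  have h2 : gen i * gen j + gen j * gen i =
      (gen i + gen j) * (gen i + gen j) - gen i * gen i - gen j * gen j := by noncomm_ring
  rw [h1, gen_sq, gen_sq, one_pow, mul_one, map_neg, map_ofNat] at h2
  exact eq_neg_of_add_eq_zero_left (h2.trans (by norm_num))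

theorem gen_mul_pair {i j k : Fin n} (hi : k ≠ i) (hj : k ≠ j) :
    gen k * (gen i * gen j) = gen i * gen j * gen k := by
  rw [← mul_assoc, gen_mul_gen hi, neg_mul, mul_assoc, gen_mul_gen hj, mul_neg, neg_neg, mul_assoc]

theorem gen_mul_pair_left {i j : Fin n} (h : i ≠ j) :
    gen i * (gen i * gen j) = -(gen i * gen j * gen i) := by
  rw [gen_mul_gen h, mul_neg, ← mul_assoc, gen_mul_gen h, neg_mul]

theorem gen_mul_pair_right {i j : Fin n} (h : i ≠ j) :
    gen j * (gen i * gen j) = -(gen i * gen j * gen j) := by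
  rw [← mul_assoc, gen_mul_gen h.symm, neg_mul]

/-- The product of two generators in the spin group. -/
noncomputable def spinPair (i j : Fin n) : SpinGroup n :=
  ⟨gen i * gen j, ι_mul_ι_mem_spinGroup (negEuclideanForm_single i) (negEuclideanForm_single j)⟩

theorem coe_spinPair_self (i : Fin n) :
    (spinPair i i : CliffordAlgebra (negEuclideanForm n)) = -1 := gen_sq i

theorem spinPair_sq {i j : Fin n} (h : i ≠ j) : spinPair i j * spinPair i j = spinPair i i := by
  apply Subtype.ext
  show gen i * gen j * (gen i * gen j) = gen i * gen i
  rw [mul_assoc, gen_mul_pair_right h, mul_assoc, gen_sq]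
  simp [gen_sq]

theorem spinPair_self_ne_one (i : Fin n) : spinPair i i ≠ 1 := by
  intro h
  have := invertibleOfNonzero (two_ne_zero (α := ℝ))
  have h1 : (-1 : CliffordAlgebra (negEuclideanForm n)) = 1 :=
    (coe_spinPair_self i).symm.trans (congrArg Subtype.val h)
  have h2 := (algebraMap ℝ (CliffordAlgebra (negEuclideanForm n))).injective
    (show algebraMap ℝ _ (-1) = algebraMap ℝ _ 1 by rw [map_neg, map_one, h1])
  norm_num at h2

theorem spinPair_mul_spinPair {i j k : Fin n} (hij : i ≠ j) :
    spinPair i j * spinPair i k = spinPair j k := by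
  apply Subtype.ext
  show gen i * gen j * (gen i * gen k) = gen j * gen k
  rw [← mul_assoc, gen_mul_gen hij, neg_mul, mul_assoc, gen_sq]
  simp

theorem spinPair_comm {i j : Fin n} (h : i ≠ j) (l : Fin n) :
    spinPair i j = spinPair l l * spinPair j i := by
  apply Subtype.ext
  show gen i * gen j = gen l * gen l * (gen j * gen i)
  rw [gen_sq, neg_one_mul, gen_mul_gen h]

theorem spinPair_commute {i j k l : Fin n} (h1 : i ≠ k) (h2 : i ≠ l) (h3 : j ≠ k) (h4 : j ≠ l) :
    spinPair i j * spinPair k l = spinPair k l * spinPair i j := by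
  apply Subtype.ext
  show gen i * gen j * (gen k * gen l) = gen k * gen l * (gen i * gen j)
  rw [mul_assoc, gen_mul_pair h3 h4, ← mul_assoc, gen_mul_pair h1 h2, mul_assoc]

theorem spinPair_not_commute {i j k : Fin n} (hij : i ≠ j) (hik : i ≠ k) (hjk : j ≠ k) :
    spinPair i j * spinPair i k ≠ spinPair i k * spinPair i j := by
  rw [spinPair_mul_spinPair hij, spinPair_mul_spinPair hik, spinPair_comm hjk i]
  intro h
  exact spinPair_self_ne_one i (by simpa using h)

/-- The product of two unit vectors at an angle of 45° acts as a rotation by 90° in their plane and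
fixes its orthogonal complement. -/
theorem exists_spin_mul_gen {j k : Fin n} (h : j ≠ k) : ∃ x : SpinGroup n,
    x.1 * gen j = gen k * x.1 ∧ ∀ i, i ≠ j → i ≠ k → x.1 * gen i = gen i * x.1 := by
  have hc : negEuclideanForm n ((√2)⁻¹ • (Pi.single j 1 + Pi.single k 1)) = -1 := by
    rw [negEuclideanForm_single_add h, inv_pow, Real.sq_sqrt zero_le_two]
    norm_num
  refine ⟨⟨_, ι_mul_ι_mem_spinGroup hc (negEuclideanForm_single j)⟩, ?_⟩
  have hx : ι (negEuclideanForm n) ((√2)⁻¹ • (Pi.single j 1 + Pi.single k 1)) *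
      ι (negEuclideanForm n) (Pi.single j 1) = (√2)⁻¹ • (-1 + gen k * gen j) := by
    rw [map_smul, map_add, smul_mul_assoc, add_mul, ← gen, ← gen, gen_sq]
  simp only [hx]
  constructor
  · rw [smul_mul_assoc, mul_smul_comm, add_mul, mul_add, mul_assoc, gen_sq, ← mul_assoc, gen_sq]
    congr 1
    simp [add_comm]
  · intro i h1 h2
    rw [smul_mul_assoc, mul_smul_comm, add_mul, mul_add, gen_mul_pair h2 h1]
    simp

theorem isConj_spinPair_right {i j k : Fin n} (hij : i ≠ j) (hik : i ≠ k) (hjk : j ≠ k) :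
    IsConj (spinPair i j) (spinPair i k) := by
  obtain ⟨x, h1, h2⟩ := exists_spin_mul_gen hjk
  refine isConj_iff.2 ⟨x, mul_inv_eq_iff_eq_mul.2 (Subtype.ext ?_)⟩
  show x.1 * (gen i * gen j) = gen i * gen k * x.1
  rw [← mul_assoc, h2 i hij hik, mul_assoc, h1, mul_assoc]

theorem isConj_spinPair_left {i j k : Fin n} (hij : i ≠ j) (hik : i ≠ k) (hjk : j ≠ k) :
    IsConj (spinPair j i) (spinPair k i) := by
  obtain ⟨x, h1, h2⟩ := exists_spin_mul_gen hjk
  refine isConj_iff.2 ⟨x, mul_inv_eq_iff_eq_mul.2 (Subtype.ext ?_)⟩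
  show x.1 * (gen j * gen i) = gen k * gen i * x.1
  rw [← mul_assoc, h1, mul_assoc, h2 i hij hik, mul_assoc]

/-- An even element that anticommutes with the generators is central among the even elements. -/
theorem mem_center_of_gen {x : SpinGroup n} (h : ∀ i, x.1 * gen i = -(gen i * x.1)) :
    x ∈ Subgroup.center (SpinGroup n) := by
  have hv : ∀ v, x.1 * ι (negEuclideanForm n) v = -(ι (negEuclideanForm n) v * x.1) := by
    intro v
    have := (Pi.basisFun ℝ (Fin n)).ext
      (f₁ := (LinearMap.mulLeft ℝ x.1) ∘ₗ ι (negEuclideanForm n))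
      (f₂ := -((LinearMap.mulRight ℝ x.1) ∘ₗ ι (negEuclideanForm n)))
      (fun i => by simpa [gen] using h i)
    simpa using LinearMap.congr_fun this v
  have hx : ∀ y ∈ evenOdd (negEuclideanForm n) 0, y * x.1 = x.1 * y := by
    intro y hy
    induction y, hy using CliffordAlgebra.even_induction with
    | algebraMap r => exact Algebra.commutes r x.1
    | add a b ha hb iha ihb => rw [add_mul, mul_add, iha, ihb]
    | ι_mul_ι_mul v w a ha ih =>
      rw [mul_assoc, ih, ← mul_assoc x.1, ← mul_assoc x.1, hv, neg_mul, mul_assoc _ x.1 (ι _ w),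
        hv, mul_neg, neg_neg]
      simp only [mul_assoc]
  refine Subgroup.mem_center_iff.2 fun y => Subtype.ext (hx y ?_)
  rw [← even_toSubmodule]
  exact spinGroup.mem_even y.2

end Vectors

/-- The volume element. -/
noncomputable def volumeSpin : SpinGroup 6 := spinPair 0 1 * spinPair 3 2 * spinPair 4 5

theorem volumeSpin_mem_center : volumeSpin ∈ Subgroup.center (SpinGroup 6) := by
  apply mem_center_of_gen
  intro i
  have hl : ∀ {i j k : Fin 6}, k ≠ i → k ≠ j →
      SemiconjBy (gen k) (gen i * gen j) (gen i * gen j) := fun h h' => gen_mul_pair h h'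
  have h1 : ∀ {i j : Fin 6}, i ≠ j → SemiconjBy (gen i) (gen i * gen j) (-(gen i * gen j)) :=
    fun h => (gen_mul_pair_left h).trans (neg_mul _ _).symm
  have h2 : ∀ {i j : Fin 6}, i ≠ j → SemiconjBy (gen j) (gen i * gen j) (-(gen i * gen j)) :=
    fun h => (gen_mul_pair_right h).trans (neg_mul _ _).symm
  have key : SemiconjBy (gen i) (gen 0 * gen 1 * (gen 3 * gen 2) * (gen 4 * gen 5))
      (-(gen 0 * gen 1 * (gen 3 * gen 2) * (gen 4 * gen 5))) := by
    fin_cases i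
    · simpa using ((h1 (by decide)).mul_right (hl (by decide) (by decide))).mul_right
        (hl (i := 4) (j := 5) (k := 0) (by decide) (by decide))
    · simpa using ((h2 (by decide)).mul_right (hl (by decide) (by decide))).mul_right
        (hl (i := 4) (j := 5) (k := 1) (by decide) (by decide))
    · simpa using ((hl (by decide) (by decide)).mul_right (h2 (by decide))).mul_right
        (hl (i := 4) (j := 5) (k := 2) (by decide) (by decide))
    · simpa using ((hl (by decide) (by decide)).mul_right (h1 (by decide))).mul_right
        (hl (i := 4) (j := 5) (k := 3) (by decide) (by decide))
    · simpa using ((hl (by decide) (by decide)).mul_right (hl (by decide) (by decide))).mul_right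
        (h1 (i := 4) (j := 5) (by decide))
    · simpa using ((hl (by decide) (by decide)).mul_right (hl (by decide) (by decide))).mul_right
        (h2 (i := 4) (j := 5) (by decide))
  show gen 0 * gen 1 * (gen 3 * gen 2) * (gen 4 * gen 5) * gen i =
    -(gen i * (gen 0 * gen 1 * (gen 3 * gen 2) * (gen 4 * gen 5)))
  rw [key.eq, neg_mul, neg_neg]

theorem exists_spin_pair : ∃ Γ₁ Γ₂ : Subgroup (SpinGroup 6),
    AlmostConjugate Γ₁ Γ₂ ∧ CommOn Γ₁ ∧ ¬ CommOn Γ₂ := by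
  have hself : ∀ i : Fin 6, spinPair i i = spinPair 0 0 := fun i =>
    Subtype.ext ((coe_spinPair_self i).trans (coe_spinPair_self 0).symm)
  have hn : (spinPair 0 0 : SpinGroup 6) * spinPair 0 0 = 1 := Subtype.ext <| by
    show (spinPair 0 0 : SpinGroup 6).1 * (spinPair 0 0 : SpinGroup 6).1 = 1
    rw [coe_spinPair_self]
    simp
  have hsq : ∀ {i j : Fin 6}, i ≠ j → spinPair i j * spinPair i j = spinPair 0 0 :=
    fun h => (spinPair_sq h).trans (hself _)
  have c1 : Commute (spinPair 0 1 : SpinGroup 6) (spinPair 3 2) :=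
    spinPair_commute (by decide) (by decide) (by decide) (by decide)
  have c2 : Commute (spinPair 4 5 : SpinGroup 6) (spinPair 0 1) :=
    spinPair_commute (by decide) (by decide) (by decide) (by decide)
  have c3 : Commute (spinPair 4 5 : SpinGroup 6) (spinPair 3 2) :=
    spinPair_commute (by decide) (by decide) (by decide) (by decide)
  have hab : (spinPair 0 1 * spinPair 3 2 : SpinGroup 6) * (spinPair 0 1 * spinPair 3 2) = 1 := by
    rw [c1.symm.mul_mul_mul_comm, hsq (by decide), hsq (by decide), hn]
  have hv : volumeSpin * volumeSpin = spinPair 0 0 := by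
    rw [volumeSpin, (c2.mul_right c3).mul_mul_mul_comm, hab, hsq (by decide), one_mul]
  have hZ : Subgroup.zpowers volumeSpin ≤ Subgroup.center (SpinGroup 6) :=
    (Subgroup.zpowers_le).2 volumeSpin_mem_center
  have hfin : Finite (Subgroup.zpowers volumeSpin) := by
    refine Set.finite_coe_iff.2 (finite_zpowers.2 (isOfFinOrder_iff_pow_eq_one.2 ?_))
    exact ⟨4, by norm_num, by rw [show 4 = 2 * 2 by norm_num, pow_mul, pow_two, pow_two, hv, hn]⟩
  have hnormal : (Subgroup.zpowers volumeSpin).Normal :=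
    ⟨fun z hz g => by rwa [Subgroup.mem_center_iff.1 (hZ hz) g, mul_inv_cancel_right]⟩
  have hnZ : spinPair 0 0 ∈ Subgroup.zpowers volumeSpin :=
    hv ▸ mul_mem (Subgroup.mem_zpowers _) (Subgroup.mem_zpowers _)
  have hnot : ∀ {i j : Fin 6} (k : Fin 6), i ≠ j → i ≠ k → j ≠ k →
      spinPair i j ∉ Subgroup.zpowers volumeSpin := fun k h1 h2 h3 h =>
    spinPair_not_commute h1 h2 h3 (Subgroup.mem_center_iff.1 (hZ h) _).symm
  -- Z is generated by the volume element ω. Because (AB)² = 1, ω AB = e₄e₅ = C, so the coset of the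
  -- fourfold product AB contains a product of two generators, as does that of AD = e₁e₂ = E.
  -- Products of two distinct generators are conjugate by rotations: e₃e₂ to e₀e₂, and e₄e₅ to e₄e₂
  -- to e₁e₂. The reversed order in B = e₃e₂ makes the signs fit.
  refine exists_almostConjugate_of_isConj hZ (A := spinPair 0 1) (B := spinPair 3 2)
    (C := spinPair 4 5) (D := spinPair 0 2) (E := spinPair 1 2) ?_ ?_ ?_ c1 ?_
    (spinPair_not_commute (by decide) (by decide) (by decide)) ?_ ?_
    (hnot 2 (by decide) (by decide) (by decide)) (hnot 1 (by decide) (by decide) (by decide))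
    (hnot 1 (by decide) (by decide) (by decide)) (hnot 1 (by decide) (by decide) (by decide))
    (hnot 0 (by decide) (by decide) (by decide))
    (isConj_spinPair_left (by decide) (by decide) (by decide))
    ((isConj_spinPair_right (k := 2) (by decide) (by decide) (by decide)).trans
      (isConj_spinPair_left (by decide) (by decide) (by decide)))
  · rwa [hsq (by decide)]
  · rwa [hsq (by decide)]
  · rwa [hsq (by decide)]
  · refine ⟨_, hnZ, ?_⟩
    rw [spinPair_mul_spinPair (by decide), spinPair_mul_spinPair (by decide)]
    exact spinPair_comm (by decide) 0
  · refine ⟨_, Subgroup.mem_zpowers _, ?_⟩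
    rw [volumeSpin, mul_assoc, (c2.mul_right c3).eq, ← mul_assoc, hab, one_mul]
  · exact ⟨1, one_mem _, by rw [one_mul, spinPair_mul_spinPair (by decide)]⟩

/-- The inclusion of the spin group in the pin group. -/
def spinToPin (n : ℕ) : SpinGroup n →* PinGroup n where
  toFun x := ⟨x.1, spinGroup.mem_pin x.2⟩
  map_one' := rfl
  map_mul' _ _ := rfl

theorem spinToPin_injective (n : ℕ) : Function.Injective (spinToPin n) := fun _ _ h =>
  Subtype.ext (congrArg (fun z : PinGroup n => (z : CliffordAlgebra (negEuclideanForm n))) h)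

/-- Conjugation in the larger group could identify more subgroups, but it cannot make a commutative
group noncommutative. -/
theorem exists_pin_pair : ∃ Γ₁ Γ₂ : Subgroup (PinGroup 6),
    AlmostConjugate Γ₁ Γ₂ ∧ CommOn Γ₁ ∧ ¬ CommOn Γ₂ := by
  obtain ⟨Γ₁, Γ₂, h, h₁, h₂⟩ := exists_spin_pair
  exact ⟨_, _, h.map (spinToPin_injective 6), (commOn_map_iff (spinToPin_injective 6)).2 h₁,
    fun h' => h₂ ((commOn_map_iff (spinToPin_injective 6)).1 h')⟩

theorem mainTheorem4 :
    -- (a) almost conjugate subgroups of `SU(2)` are conjugate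
    (∀ Γ₁ Γ₂ : Subgroup (SUGroup 2), AlmostConjugate Γ₁ Γ₂ → ConjugateSubgroups Γ₁ Γ₂) ∧
    -- (b) almost conjugate subgroups of `Spin(4)` are conjugate; so are those of `SU(2) × SU(2)`
    ((∀ Γ₁ Γ₂ : Subgroup (SpinGroup 4), AlmostConjugate Γ₁ Γ₂ → ConjugateSubgroups Γ₁ Γ₂) ∧
      (∀ Γ₁ Γ₂ : Subgroup (SUGroup 2 × SUGroup 2),
        AlmostConjugate Γ₁ Γ₂ → ConjugateSubgroups Γ₁ Γ₂)) ∧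
    -- (c) `O(6)`, `Spin(6)` and `Pin(6)` have almost conjugate subgroups that are not conjugate
    ((∃ Γ₁ Γ₂ : Subgroup (OGroup 6), AlmostConjugate Γ₁ Γ₂ ∧ ¬ ConjugateSubgroups Γ₁ Γ₂) ∧
      (∃ Γ₁ Γ₂ : Subgroup (SpinGroup 6), AlmostConjugate Γ₁ Γ₂ ∧ ¬ ConjugateSubgroups Γ₁ Γ₂) ∧
      (∃ Γ₁ Γ₂ : Subgroup (PinGroup 6), AlmostConjugate Γ₁ Γ₂ ∧ ¬ ConjugateSubgroups Γ₁ Γ₂)) := by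
  refine ⟨fun Γ₁ Γ₂ h => ?_, ⟨fun Γ₁ Γ₂ h => ?_, fun Γ₁ Γ₂ h => ?_⟩, exists_orthogonal_pair, ?_, ?_⟩
  · exact conjugate_of_mulEquiv UnitQuat.suEquiv
      (fun _ _ => UnitQuat.conjugate_of_almostConjugate) Γ₁ Γ₂ h
  · exact conjugate_of_mulEquiv UnitQuat.spinEquiv
      (fun _ _ => UnitQuat.conjugate_of_almostConjugate_prod) Γ₁ Γ₂ h
  · exact conjugate_of_mulEquiv (UnitQuat.suEquiv.prodCongr UnitQuat.suEquiv)
      (fun _ _ => UnitQuat.conjugate_of_almostConjugate_prod) Γ₁ Γ₂ h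
  · obtain ⟨Γ₁, Γ₂, h, h₁, h₂⟩ := exists_spin_pair
    exact ⟨Γ₁, Γ₂, h, not_conjugate_of_commOn h₁ h₂⟩
  · obtain ⟨Γ₁, Γ₂, h, h₁, h₂⟩ := exists_pin_pair
    exact ⟨Γ₁, Γ₂, h, not_conjugate_of_commOn h₁ h₂⟩
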